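/- Let $X$ be a compact connected Kähler manifold of dimension $n\ge 1$ with Kähler form $\omega$. A Higgs sheaf $\mathfrak E=(E,\phi)$ over $X$ is a coherent sheaf of $\mathcal O_X$-modules $E$ together with a morphism of $\mathcal O_X$-modules $\phi:E\to E\otimes\Omega^1_X$ such that $\phi\wedge\phi=0$; that is, $[\phi_\alpha,\phi_\beta]=0$ for all $\alpha,\beta$ when $\phi=\sum_\alpha\phi_\alpha\,dz^\alpha$ in local coordinates. It is torsion-free if $E$ is. The tensor product of $\mathfrak E_1=(E_1,\phi_1)$ and $\mathfrak E_2=(E_2,\phi_2)$ is $\mathfrak E_1\otimes\mathfrak E_2=(E_1\otimes E_2,\ \phi_1\otimes 1+1\otimes\phi_2)$, and their Whitney sum is $\mathfrak E_1\oplus\mathfrak E_2=(E_1\oplus E_2,\ \mathrm{pr}_1^*\phi_1+\mathrm{pr}_2^*\phi_2)$. The sheaves below are locally free outside an analytic subset of codimension at least two. The degree of such a sheaf is $\deg E=\int_X c_1(\det E)\wedge\omega^{n-1}$, where $\det E$ is the determinant line bundle, and, if the rank is positive, its slope is $\mu(\mathfrak E)=\deg E/\operatorname{rk}E$. An admissible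 structure on $\mathfrak E$ is a (smooth) Hermitian metric $h$ on the holomorphic vector bundle $E|_U$, where $U\subset X$ is an open set such that $X\setminus U$ is an analytic subset of codimension at least two and $E|_U$ is locally free, such that the Chern curvature $R_h$ is square-integrable on $U$ and the mean curvature $K_h=i\Lambda R_h$ is integrable on $U$. Its Hitchin–Simpson mean curvature is $$\mathcal K_h=K_h+i\Lambda[\phi,\bar\phi_h],$$ where $\bar\phi_h$ is the adjoint of $\phi$ with respect to $h$. Put $$c=\frac{2\pi\,\mu(\mathfrak E)}{(n-1)!\,\operatorname{vol}X},\qquad \operatorname{vol}X=\int_X\frac{\omega^n}{n!}.$$ One says that $\mathfrak E$ admits an approximate Hermitian–Yang–Mills structure if for every $\epsilon>0$ there is an admissible structure $h_\epsilon$ on $\mathfrak E$, defined on an open set $U_\epsilon$, with $$\sup_{U_\epsilon}\bigl|\mathcal K_{h_\epsilon}-c\,I\bigr|<\epsilon ,$$ where $|A|=(\operatorname{tr}AA^{*})^{1/2}$ is the norm of endomorphisms defined by $h_\epsilon$. **Proposition.** Let $\mathfrak E_1$ and $\mathfrak E_2$ be torsion-free Higgs sheaves of positive rank over $X$. If both admit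 approximate Hermitian–Yang–Mills structures, then so does $\mathfrak E_1\otimes\mathfrak E_2$. If moreover $\mu(\mathfrak E_1)=\mu(\mathfrak E_2)$, then $\mathfrak E_1\oplus\mathfrak E_2$ also admits an approximate Hermitian–Yang–Mills structure. -/

import Mathlib

open CategoryTheory TopologicalSpace Opposite
open scoped Manifold ContDiff ComplexOrder

noncomputable section
namespace HYM
section
variable (n : ℕ) (X : Type) [TopologicalSpace X] [ChartedSpace (Fin n → ℂ) X]

/-- The sheaf `O` of holomorphic functions on `X`, as a sheaf of commutative rings: maps that are
smooth over `ℂ` in the charts. -/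
def structureSheafComm : TopCat.Sheaf CommRingCat.{0} (TopCat.of X) :=
  smoothSheafCommRing 𝓘(ℂ, Fin n → ℂ) 𝓘(ℂ) X ℂ

/-- The sheaf `O` as a sheaf of rings. -/
def structureSheaf : Sheaf (Opens.grothendieckTopology (TopCat.of X)) RingCat.{0} :=
  (sheafCompose _ (forget₂ CommRingCat RingCat)).obj (structureSheafComm n X)

/-- Sheaves of `O`-modules on `X`. -/
abbrev OModule := SheafOfModules.{0} (structureSheaf n X)

/-- Holomorphic functions on the open set `V`. -/
abbrev Hol {X : Type} [TopologicalSpace X] [ChartedSpace (Fin n → ℂ) X] (V : Opens X) : Type := (structureSheaf n X).obj.obj (op V)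

instance (V : Opens X) : CommRing (Hol n V) :=
  inferInstanceAs (CommRing ((structureSheafComm n X).obj.obj (op V)))

end
variable {n : ℕ} {X : Type} [TopologicalSpace X] [ChartedSpace (Fin n → ℂ) X]

/-- The value of a holomorphic function at a point. -/
def Hol.eval {V : Opens X} (f : Hol n V) (x : X) (hx : x ∈ V) : ℂ :=
  (show C^∞⟮𝓘(ℂ, Fin n → ℂ), V; 𝓘(ℂ), ℂ⟯ from f) ⟨x, hx⟩

/-- Restriction of a holomorphic function to a smaller open set. -/
def Hol.res {V W : Opens X} (h : W ≤ V) (f : Hol n V) : Hol n W :=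
  (structureSheaf n X).obj.map (homOfLE h).op f

theorem Hol.ext {V : Opens X} (f g : Hol n V)
    (h : ∀ (x : X) (hx : x ∈ V), f.eval x hx = g.eval x hx) : f = g :=
  Subtype.ext (funext fun x => h x.1 x.2)

theorem Hol.exists_of_locally {V : Opens X} (F : V → ℂ)
    (h : ∀ x : V, ∃ (W : Opens X) (_ : x.1 ∈ W) (hW : W ≤ V) (g : Hol n W),
      ∀ (y : X) (hy : y ∈ W), g.eval y hy = F ⟨y, hW hy⟩) :
    ∃ g : Hol n V, ∀ (y : X) (hy : y ∈ V), g.eval y hy = F ⟨y, hy⟩ := by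
  choose W hx hW g hg using h
  have := TopCat.Sheaf.existsUnique_gluing' (X := TopCat.of X) (C := CommRingCat)
    (structureSheafComm n X) W V (fun i => homOfLE (hW i))
    (fun x hx' => Opens.mem_iSup.2 ⟨⟨x, hx'⟩, hx ⟨x, hx'⟩⟩) g (fun i j => by
      refine Hol.ext _ _ fun y hy => ?_
      exact (hg i y hy.1).trans (hg j y hy.2).symm)
  obtain ⟨s, hs, -⟩ := this
  refine ⟨s, fun y hy => ?_⟩
  have h1 := hg ⟨y, hy⟩ y (hx ⟨y, hy⟩)
  rw [← h1, ← hs ⟨y, hy⟩]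
  rfl

/-- The holomorphic charts of `X` (members of the given atlas). -/
abbrev Chart (n : ℕ) (X : Type) [TopologicalSpace X] [ChartedSpace (Fin n → ℂ) X] : Type :=
  atlas (Fin n → ℂ) X

/-- The domain of a chart. -/
def Chart.dom (e : Chart n X) : Opens X := ⟨e.1.source, e.1.open_source⟩

/-- The holomorphic tangent space of `X` at `x`, a complex vector space of dimension `n`. -/
abbrev HolTangent (n : ℕ) {X : Type} [TopologicalSpace X] [ChartedSpace (Fin n → ℂ) X] (x : X) :=
  TangentSpace 𝓘(ℂ, Fin n → ℂ) x

/-- The coordinate vector `∂/∂z^α` of a chart at a point `x` of its domain. -/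
def Chart.coordVec (e : Chart n X) (α : Fin n) (x : X) : HolTangent n x :=
  (mfderiv 𝓘(ℂ, Fin n → ℂ) 𝓘(ℂ, Fin n → ℂ) e.1.symm (e.1 x) (Pi.single α (1 : ℂ) : Fin n → ℂ) :
    Fin n → ℂ)

/-- A family of covectors is a holomorphic one-form if all its coefficients `θ(∂/∂z^α)` in charts
are holomorphic. -/
def IsHolForm {V : Opens X} (θ : ∀ x : V, HolTangent n x.1 →ₗ[ℂ] ℂ) : Prop :=
  ∀ (e : Chart n X) (α : Fin n), ∃ f : Hol n (V ⊓ e.dom),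
    ∀ (x : X) (hx : x ∈ V ⊓ e.dom), f.eval x hx = θ ⟨x, hx.1⟩ (e.coordVec α x)

/-- Holomorphic one-forms on the open set `V`. -/
def HolForm (n : ℕ) {X : Type} [TopologicalSpace X] [ChartedSpace (Fin n → ℂ) X] (V : Opens X) :
    Type :=
  {θ : ∀ x : V, HolTangent n x.1 →ₗ[ℂ] ℂ // IsHolForm θ}

/-- Holomorphic one-forms as a subgroup of the group of families of covectors. -/
def holFormSubgroup (V : Opens X) : AddSubgroup (∀ x : V, HolTangent n x.1 →ₗ[ℂ] ℂ) where
  carrier := {θ | IsHolForm θ}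
  add_mem' := by
    intro a b ha hb e α
    obtain ⟨f, hf⟩ := ha e α
    obtain ⟨g, hg⟩ := hb e α
    exact ⟨f + g, fun x hx => congrArg₂ (· + ·) (hf x hx) (hg x hx)⟩
  zero_mem' := fun e α => ⟨0, fun x hx => rfl⟩
  neg_mem' := by
    intro a ha e α
    obtain ⟨f, hf⟩ := ha e α
    exact ⟨-f, fun x hx => congrArg Neg.neg (hf x hx)⟩

instance (V : Opens X) : AddCommGroup (HolForm n V) :=
  inferInstanceAs (AddCommGroup (holFormSubgroup (n := n) V))

instance (V : Opens X) : Module (Hol n V) (HolForm n V) where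
  smul f θ := ⟨fun x => f.eval x.1 x.2 • θ.1 x, fun e α => by
    obtain ⟨g, hg⟩ := θ.2 e α
    exact ⟨f.res inf_le_left * g, fun x hx => by
      rw [← smul_eq_mul]
      change f.eval x hx.1 * g.eval x hx = f.eval x hx.1 * _
      rw [hg x hx]⟩⟩
  one_smul θ := Subtype.ext (funext fun x => one_smul ℂ (θ.1 x))
  mul_smul f g θ := Subtype.ext (funext fun x => mul_smul (f.eval x.1 x.2) (g.eval x.1 x.2) (θ.1 x))
  smul_zero f := Subtype.ext (funext fun x => smul_zero (f.eval x.1 x.2))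
  smul_add f θ η := Subtype.ext (funext fun x => smul_add (f.eval x.1 x.2) (θ.1 x) (η.1 x))
  add_smul f g θ := Subtype.ext (funext fun x => add_smul (f.eval x.1 x.2) (g.eval x.1 x.2) (θ.1 x))
  zero_smul θ := Subtype.ext (funext fun x => zero_smul ℂ (θ.1 x))

/-- Restriction of a holomorphic one-form. -/
def HolForm.res {V W : Opens X} (h : W ≤ V) (θ : HolForm n V) : HolForm n W :=
  ⟨fun x => θ.1 ⟨x.1, h x.2⟩, fun e α => by
    obtain ⟨g, hg⟩ := θ.2 e α
    exact ⟨g.res (inf_le_inf_right _ h), fun x hx => hg x ⟨h hx.1, hx.2⟩⟩⟩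

variable (n X) in
/-- The presheaf of holomorphic one-forms. -/
def cotangentPresheaf : PresheafOfModules.{0} (structureSheaf n X).obj where
  obj V := ModuleCat.of (Hol n V.unop) (HolForm n V.unop)
  map {_ W} i := ModuleCat.ofHom
    (Y := (ModuleCat.restrictScalars ((structureSheaf n X).obj.map i).hom).obj
      (ModuleCat.of (Hol n W.unop) (HolForm n W.unop)))
    { toFun := fun θ => HolForm.res (leOfHom i.unop) θ
      map_add' := fun _ _ => rfl
      map_smul' := fun _ _ => rfl }
  map_id _ := rfl
  map_comp _ _ := rfl

theorem cotangent_isSheaf : Presheaf.IsSheaf (Opens.grothendieckTopology (TopCat.of X))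
    (cotangentPresheaf n X).presheaf := by
  rw [Presheaf.isSheaf_iff_isSheaf_forget _ _ (forget AddCommGrpCat)]
  apply TopCat.Presheaf.isSheaf_of_isSheafUniqueGluing_types
  intro ι U sf hsf
  have loc : ∀ x : (iSup U : Opens X), ∃ i, x.1 ∈ U i := fun x => Opens.mem_iSup.1 x.2
  have comp : ∀ (i j : ι) (x : X) (hi : x ∈ U i) (hj : x ∈ U j),
      (show HolForm n (U i) from sf i).1 ⟨x, hi⟩ = (show HolForm n (U j) from sf j).1 ⟨x, hj⟩ :=
    fun i j x hi hj =>
      congrFun (congrArg (Subtype.val (p := IsHolForm (n := n) (V := U i ⊓ U j))) (hsf i j))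
        ⟨x, hi, hj⟩
  choose k hk using loc
  refine ⟨(⟨fun x => (show HolForm n (U (k x)) from sf (k x)).1 ⟨x.1, hk x⟩, ?_⟩ :
    HolForm n (iSup U : Opens X)), ?_, ?_⟩
  · intro e α
    have := Hol.exists_of_locally (n := n) (V := iSup U ⊓ e.dom)
      (fun x : (iSup U ⊓ e.dom : Opens X) =>
        (show HolForm n (U (k ⟨x.1, x.2.1⟩)) from sf (k ⟨x.1, x.2.1⟩)).1 ⟨x.1, hk ⟨x.1, x.2.1⟩⟩
        (e.coordVec α x.1)) (by
      intro x
      obtain ⟨g, hg⟩ := (show HolForm n (U (k ⟨x.1, x.2.1⟩)) from sf (k ⟨x.1, x.2.1⟩)).2 e α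
      refine ⟨U (k ⟨x.1, x.2.1⟩) ⊓ e.dom, ⟨hk ⟨x.1, x.2.1⟩, x.2.2⟩,
        inf_le_inf_right _ (le_iSup U _), g, ?_⟩
      intro y hy
      rw [hg y hy, comp _ (k ⟨y, le_iSup U _ hy.1⟩) y hy.1 (hk ⟨y, le_iSup U _ hy.1⟩)])
    exact this
  · intro i
    exact Subtype.ext (funext fun x => comp _ _ _ _ _)
  · intro t ht
    refine Subtype.ext (funext fun x => ?_)
    exact congrFun (congrArg (Subtype.val (p := IsHolForm (n := n) (V := U (k x)))) (ht (k x)))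
      ⟨x.1, hk x⟩

variable (n X) in
/-- The cotangent sheaf `Ω¹` of holomorphic one-forms. -/
def cotangentSheaf : OModule n X := ⟨cotangentPresheaf n X, cotangent_isSheaf⟩

theorem HolForm.exists_coord (e : Chart n X) (α : Fin n) {V : Opens X} (hV : V ≤ e.dom)
    (θ : HolForm n V) :
    ∃ f : Hol n V, ∀ (x : X) (hx : x ∈ V), f.eval x hx = θ.1 ⟨x, hx⟩ (e.coordVec α x) := by
  obtain ⟨f, hf⟩ := θ.2 e α
  exact ⟨f.res (le_inf le_rfl hV), fun x hx => hf x ⟨hx, hV hx⟩⟩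

/-- The coefficient of `dz^α` of a holomorphic one-form over an open subset of a chart domain. -/
def HolForm.coord (e : Chart n X) (α : Fin n) {V : Opens X} (hV : V ≤ e.dom) :
    HolForm n V →ₗ[Hol n V] Hol n V where
  toFun θ := (HolForm.exists_coord e α hV θ).choose
  map_add' a b := Hol.ext _ _ fun x hx => by
    rw [(HolForm.exists_coord e α hV (a + b)).choose_spec x hx]
    exact congrArg₂ (· + ·) ((HolForm.exists_coord e α hV a).choose_spec x hx).symm
      ((HolForm.exists_coord e α hV b).choose_spec x hx).symm
  map_smul' f a := Hol.ext _ _ fun x hx => by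
    rw [(HolForm.exists_coord e α hV (f • a)).choose_spec x hx]
    exact congrArg (f.eval x hx * ·) ((HolForm.exists_coord e α hV a).choose_spec x hx).symm

theorem HolForm.coord_eval (e : Chart n X) (α : Fin n) {V : Opens X} (hV : V ≤ e.dom)
    (θ : HolForm n V) (x : X) (hx : x ∈ V) :
    (HolForm.coord e α hV θ).eval x hx = θ.1 ⟨x, hx⟩ (e.coordVec α x) :=
  (HolForm.exists_coord e α hV θ).choose_spec x hx

theorem HolForm.coord_res (e : Chart n X) (α : Fin n) {V W : Opens X} (hV : V ≤ e.dom) (h : W ≤ V)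
    (θ : HolForm n V) :
    (HolForm.coord e α hV θ).res h = HolForm.coord e α (h.trans hV) (θ.res h) :=
  Hol.ext _ _ fun x hx => (HolForm.coord_eval e α hV θ x (h hx)).trans
    (HolForm.coord_eval e α (h.trans hV) (θ.res h) x hx).symm

/-- Sections of a sheaf of modules over `V`. -/
abbrev Sec (E : OModule n X) (V : Opens X) : Type := E.val.obj (op V)

/-- Restriction of sections. -/
def res (E : OModule n X) {V W : Opens X} (h : W ≤ V) (s : Sec E V) : Sec E W :=
  E.val.map (homOfLE h).op s

theorem res_add (E : OModule n X) {V W : Opens X} (h : W ≤ V) (s t : Sec E V) :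
    res E h (s + t) = res E h s + res E h t := (E.val.restrictₛₗ (homOfLE h).op).map_add s t

theorem res_smul (E : OModule n X) {V W : Opens X} (h : W ≤ V) (f : Hol n V) (s : Sec E V) :
    res E h (f • s) = f.res h • res E h s := E.val.map_smul (homOfLE h).op f s

theorem res_res (E : OModule n X) {U V W : Opens X} (h : W ≤ V) (h' : V ≤ U) (s : Sec E U) :
    res E h (res E h' s) = res E (h.trans h') s :=
  (E.val.map_comp_apply (homOfLE h').op (homOfLE h).op s).symm

theorem res_self (E : OModule n X) {V : Opens X} (h : V ≤ V) (s : Sec E V) : res E h s = s :=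
  congrArg (fun f => f.hom s) (E.val.map_id (op V))

theorem sec_ext (E : OModule n X) {V : Opens X} (s t : Sec E V)
    (h : ∀ x ∈ V, ∃ (W : Opens X) (hW : W ≤ V), x ∈ W ∧ res E hW s = res E hW t) : s = t := by
  choose! W hW hx hs using h
  exact TopCat.Sheaf.eq_of_locally_eq' (X := TopCat.of X) (C := AddCommGrpCat)
    ⟨E.val.presheaf, E.isSheaf⟩ (fun x : V => W x.1) V (fun x => homOfLE (hW x.1 x.2))
    (fun x hx' => Opens.mem_iSup.2 ⟨⟨x, hx'⟩, hx x hx'⟩) s t (fun x => hs x.1 x.2)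

theorem sec_glue (E : OModule n X) {V : Opens X} {ι : Type} (W : ι → Opens X) (hW : ∀ i, W i ≤ V)
    (hcov : ∀ x ∈ V, ∃ i, x ∈ W i) (s : ∀ i, Sec E (W i))
    (hs : ∀ i j, res E (inf_le_left : W i ⊓ W j ≤ W i) (s i) = res E inf_le_right (s j)) :
    ∃ t : Sec E V, ∀ i, res E (hW i) t = s i := by
  have := TopCat.Sheaf.existsUnique_gluing' (X := TopCat.of X) (C := AddCommGrpCat)
    ⟨E.val.presheaf, E.isSheaf⟩ W V (fun i => homOfLE (hW i))
    (fun x hx => Opens.mem_iSup.2 (hcov x hx)) s (fun i j => hs i j)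
  exact this.exists

/-- The map on sections over `V` of a morphism of sheaves of modules. -/
def onSec {E F : OModule n X} (f : E ⟶ F) (V : Opens X) : Sec E V →ₗ[Hol n V] Sec F V :=
  (f.val.app (op V)).hom

theorem onSec_res {E F : OModule n X} (f : E ⟶ F) {V W : Opens X} (h : W ≤ V) (s : Sec E V) :
    res F h (onSec f V s) = onSec f W (res E h s) :=
  (PresheafOfModules.naturality_apply f.val (homOfLE h).op s).symm

/-- The presheaf `V ↦ E(V) ⊗ F(V)`. -/
abbrev preTensor (E F : OModule n X) : PresheafOfModules (structureSheaf n X).obj :=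
  PresheafOfModules.Monoidal.tensorObj (R := (structureSheafComm n X).obj) E.val F.val

/-- The tensor product `E ⊗ F` over `O`: the sheaf associated to `V ↦ E(V) ⊗ F(V)`. -/
def tensor (E F : OModule n X) : OModule n X :=
  (PresheafOfModules.sheafification (R := structureSheaf n X) (𝟙 (structureSheaf n X).obj)).obj
    (preTensor E F)

/-- The canonical map `E(V) ⊗ F(V) → (E ⊗ F)(V)`. -/
def toTensor (E F : OModule n X) (V : Opens X) :
    TensorProduct (Hol n V) (Sec E V) (Sec F V) →ₗ[Hol n V] Sec (tensor E F) V :=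
  (((PresheafOfModules.sheafificationAdjunction (𝟙 (structureSheaf n X).obj)).unit.app
    (preTensor E F)).app (op V)).hom

/-- Restriction in the presheaf `V ↦ E(V) ⊗ F(V)`. -/
def pres (E F : OModule n X) {V W : Opens X} (h : W ≤ V)
    (p : TensorProduct (Hol n V) (Sec E V) (Sec F V)) :
    TensorProduct (Hol n W) (Sec E W) (Sec F W) :=
  (preTensor E F).map (homOfLE h).op p

theorem pres_add (E F : OModule n X) {V W : Opens X} (h : W ≤ V)
    (p q : TensorProduct (Hol n V) (Sec E V) (Sec F V)) :
    pres E F h (p + q) = pres E F h p + pres E F h q :=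
  ((preTensor E F).restrictₛₗ (homOfLE h).op).map_add p q

theorem pres_tmul (E F : OModule n X) {V W : Opens X} (h : W ≤ V) (s : Sec E V) (t : Sec F V) :
    pres E F h (TensorProduct.tmul (Hol n V) s t) =
      TensorProduct.tmul (Hol n W) (res E h s) (res F h t) := rfl

theorem toTensor_res (E F : OModule n X) {V W : Opens X} (h : W ≤ V)
    (p : TensorProduct (Hol n V) (Sec E V) (Sec F V)) :
    res _ h (toTensor E F V p) = toTensor E F W (pres E F h p) :=
  (PresheafOfModules.naturality_apply
    ((PresheafOfModules.sheafificationAdjunction (𝟙 (structureSheaf n X).obj)).unit.app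
    (preTensor E F)) (homOfLE h).op p).symm

theorem toTensor_locally_surjective (E F : OModule n X) {V : Opens X} (t : Sec (tensor E F) V)
    (x : X) (hx : x ∈ V) :
    ∃ (W : Opens X) (h : W ≤ V), x ∈ W ∧ ∃ p, toTensor E F W p = res _ h t := by
  have := (inferInstance : Presheaf.IsLocallySurjective (Opens.grothendieckTopology (TopCat.of X))
    (CategoryTheory.toSheafify (Opens.grothendieckTopology (TopCat.of X)) (preTensor E F).presheaf))
  obtain ⟨W, f, ⟨p, hp⟩, hxW⟩ := this.imageSieve_mem (U := V) t x hx
  exact ⟨W, leOfHom f, hxW, p, hp⟩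

theorem toTensor_locally_injective (E F : OModule n X) {V : Opens X}
    (p q : TensorProduct (Hol n V) (Sec E V) (Sec F V))
    (h : toTensor E F V p = toTensor E F V q) (x : X) (hx : x ∈ V) :
    ∃ (W : Opens X) (h : W ≤ V), x ∈ W ∧ pres E F h p = pres E F h q := by
  have := (inferInstance : Presheaf.IsLocallyInjective (Opens.grothendieckTopology (TopCat.of X))
    (CategoryTheory.toSheafify (Opens.grothendieckTopology (TopCat.of X)) (preTensor E F).presheaf))
  obtain ⟨W, f, hp, hxW⟩ := this.equalizerSieve_mem (X := op V) p q h x hx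
  exact ⟨W, leOfHom f, hxW, hp⟩

/-- The section `s ⊗ t` of `E ⊗ F`. -/
def tmul {E F : OModule n X} {V : Opens X} (s : Sec E V) (t : Sec F V) : Sec (tensor E F) V :=
  toTensor E F V (TensorProduct.tmul (Hol n V) s t)

theorem res_tmul {E F : OModule n X} {V W : Opens X} (h : W ≤ V) (s : Sec E V) (t : Sec F V) :
    res _ h (tmul s t) = tmul (res E h s) (res F h t) := toTensor_res E F h _

theorem tmul_add {E F : OModule n X} {V : Opens X} (s : Sec E V) (t t' : Sec F V) :
    tmul s (t + t') = tmul s t + tmul s t' :=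
  (congrArg (toTensor E F V) (TensorProduct.tmul_add s t t')).trans (map_add _ _ _)

theorem add_tmul {E F : OModule n X} {V : Opens X} (s s' : Sec E V) (t : Sec F V) :
    tmul (s + s') t = tmul s t + tmul s' t :=
  (congrArg (toTensor E F V) (TensorProduct.add_tmul s s' t)).trans (map_add _ _ _)

theorem tmul_smul {E F : OModule n X} {V : Opens X} (f : Hol n V) (s : Sec E V) (t : Sec F V) :
    tmul s (f • t) = f • tmul s t :=
  (congrArg (toTensor E F V) (TensorProduct.tmul_smul f s t)).trans (map_smul _ _ _)

theorem smul_tmul {E F : OModule n X} {V : Opens X} (f : Hol n V) (s : Sec E V) (t : Sec F V) :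
    tmul (f • s) t = f • tmul s t :=
  (congrArg (toTensor E F V) (TensorProduct.smul_tmul' f s t).symm).trans (map_smul _ _ _)

/-- Two additive natural families of maps out of `E ⊗ F` over the open subsets of `U` agree as soon
as they agree on the sections `s ⊗ t`. -/
theorem tensor_hom_ext {E F G : OModule n X} {U : Opens X}
    (A B : ∀ W : Opens X, W ≤ U → Sec (tensor E F) W → Sec G W)
    (hA : ∀ (V W : Opens X) (hV : V ≤ U) (h : W ≤ V) (t), res G h (A V hV t) =
      A W (h.trans hV) (res _ h t))
    (hB : ∀ (V W : Opens X) (hV : V ≤ U) (h : W ≤ V) (t), res G h (B V hV t) =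
      B W (h.trans hV) (res _ h t))
    (hA' : ∀ (V : Opens X) (hV : V ≤ U) (s t), A V hV (s + t) = A V hV s + A V hV t)
    (hB' : ∀ (V : Opens X) (hV : V ≤ U) (s t), B V hV (s + t) = B V hV s + B V hV t)
    (H : ∀ (V : Opens X) (hV : V ≤ U) (s : Sec E V) (t : Sec F V),
      A V hV (tmul s t) = B V hV (tmul s t))
    {V : Opens X} (hV : V ≤ U) (t : Sec (tensor E F) V) : A V hV t = B V hV t := by
  refine sec_ext _ _ _ fun x hx => ?_
  obtain ⟨W, h, hxW, p, hp⟩ := toTensor_locally_surjective E F t x hx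
  refine ⟨W, h, hxW, ?_⟩
  rw [hA, hB, ← hp]
  clear hp
  induction p using TensorProduct.induction_on with
  | zero =>
    have a0 : A W (h.trans hV) 0 = 0 := by simpa using hA' W (h.trans hV) 0 0
    have b0 : B W (h.trans hV) 0 = 0 := by simpa using hB' W (h.trans hV) 0 0
    rw [map_zero, a0, b0]
  | tmul s t => exact H W _ s t
  | add p q hp hq => rw [map_add, hA', hB', hp, hq]

/-- A natural family of bilinear maps `E(W) × F(W) → G(W)` over the open subsets `W` of `U`. -/
structure Pairing (E F G : OModule n X) (U : Opens X) where
  toFun : ∀ W : Opens X, W ≤ U → Sec E W →ₗ[Hol n W] Sec F W →ₗ[Hol n W] Sec G W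
  res_toFun : ∀ (V W : Opens X) (hV : V ≤ U) (h : W ≤ V) (s : Sec E V) (t : Sec F V),
    res G h (toFun V hV s t) = toFun W (h.trans hV) (res E h s) (res F h t)

namespace Pairing
variable {E F G : OModule n X} {U : Opens X}

def preLift (b : Pairing E F G U) (W : Opens X) (hW : W ≤ U) :
    TensorProduct (Hol n W) (Sec E W) (Sec F W) →ₗ[Hol n W] Sec G W :=
  TensorProduct.lift (b.toFun W hW)

theorem preLift_res (b : Pairing E F G U) (V W : Opens X) (hV : V ≤ U) (h : W ≤ V)
    (p : TensorProduct (Hol n V) (Sec E V) (Sec F V)) :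
    res G h (b.preLift V hV p) = b.preLift W (h.trans hV) (pres E F h p) := by
  induction p using TensorProduct.induction_on with
  | zero =>
    have a0 : res G h 0 = 0 := by simpa using res_add G h 0 0
    have b0 : pres E F h 0 = 0 := by simpa using pres_add E F h 0 0
    rw [map_zero, a0, b0, map_zero]
  | tmul s t => exact b.res_toFun V W hV h s t
  | add p q hp hq => rw [map_add, res_add, pres_add, map_add, hp, hq]

theorem exists_lift (b : Pairing E F G U) {V : Opens X} (hV : V ≤ U) (t : Sec (tensor E F) V) :
    ∃ s : Sec G V, ∀ (W : Opens X) (h : W ≤ V) (p : TensorProduct (Hol n W) (Sec E W) (Sec F W)),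
      toTensor E F W p = res _ h t → res _ h s = b.preLift W (h.trans hV) p := by
  have key : ∀ (W : Opens X) (hW : W ≤ U) (p q : TensorProduct (Hol n W) (Sec E W) (Sec F W)),
      toTensor E F W p = toTensor E F W q → b.preLift W hW p = b.preLift W hW q := by
    intro W hW p q h
    refine sec_ext _ _ _ fun x hx => ?_
    obtain ⟨W', h', hx', e⟩ := toTensor_locally_injective E F p q h x hx
    refine ⟨W', h', hx', ?_⟩
    rw [preLift_res, preLift_res, e]
  have loc := toTensor_locally_surjective E F t
  choose! W hW hx p hp using loc
  obtain ⟨s, hs⟩ := sec_glue G (V := V) (fun x : V => W x.1) (fun x => hW x.1 x.2)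
    (fun x hx' => ⟨⟨x, hx'⟩, hx x hx'⟩)
    (fun x => b.preLift (W x.1) ((hW x.1 x.2).trans hV) (p x.1)) (by
      intro x y
      rw [preLift_res, preLift_res]
      apply key
      rw [← toTensor_res, ← toTensor_res, hp x.1 x.2, hp y.1 y.2, res_res, res_res])
  refine ⟨s, ?_⟩
  intro W' h' q hq
  refine sec_ext _ _ _ fun x hx' => ?_
  have hxV := h' hx'
  refine ⟨W' ⊓ W x, inf_le_left, ⟨hx', hx x hxV⟩, ?_⟩
  have e1 : res _ (inf_le_left : W' ⊓ W x ≤ W') (res _ h' s) =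
      res _ (inf_le_right : W' ⊓ W x ≤ W x) (res _ (hW x hxV) s) := by
    rw [res_res, res_res]
  rw [e1, hs ⟨x, hxV⟩, preLift_res, preLift_res]
  apply key
  rw [← toTensor_res, ← toTensor_res, hp x hxV, hq, res_res, res_res]

def liftFun (b : Pairing E F G U) {V : Opens X} (hV : V ≤ U) (t : Sec (tensor E F) V) : Sec G V :=
  (b.exists_lift hV t).choose

theorem res_liftFun_eq (b : Pairing E F G U) {V W : Opens X} (hV : V ≤ U)
    (t : Sec (tensor E F) V) (h : W ≤ V) (p : TensorProduct (Hol n W) (Sec E W) (Sec F W))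
    (hp : toTensor E F W p = res _ h t) :
    res _ h (b.liftFun hV t) = b.preLift W (h.trans hV) p :=
  (b.exists_lift hV t).choose_spec W h p hp

theorem res_liftFun (b : Pairing E F G U) {V W : Opens X} (hV : V ≤ U) (h : W ≤ V)
    (t : Sec (tensor E F) V) :
    res _ h (b.liftFun hV t) = b.liftFun (h.trans hV) (res _ h t) := by
  refine sec_ext _ _ _ fun x hx => ?_
  obtain ⟨W', h', hx', p, hp⟩ := toTensor_locally_surjective E F (res _ h t) x hx
  refine ⟨W', h', hx', ?_⟩
  rw [res_liftFun_eq b _ _ _ _ hp, res_res,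
    res_liftFun_eq b hV t (h'.trans h) p (by rw [hp, res_res])]

theorem liftFun_toTensor (b : Pairing E F G U) {V : Opens X} (hV : V ≤ U)
    (p : TensorProduct (Hol n V) (Sec E V) (Sec F V)) :
    b.liftFun hV (toTensor E F V p) = b.preLift V hV p := by
  have := b.res_liftFun_eq hV (toTensor E F V p) le_rfl p (res_self _ _ _).symm
  rwa [res_self] at this

/-- The linear map out of the sections of `E ⊗ F` induced by a pairing. -/
def lift (b : Pairing E F G U) {V : Opens X} (hV : V ≤ U) :
    Sec (tensor E F) V →ₗ[Hol n V] Sec G V where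
  toFun := b.liftFun hV
  map_add' s t := by
    refine sec_ext _ _ _ fun x hx => ?_
    obtain ⟨W₁, h₁, hx₁, p, hp⟩ := toTensor_locally_surjective E F s x hx
    obtain ⟨W₂, h₂, hx₂, q, hq⟩ := toTensor_locally_surjective E F (res _ h₁ t) x hx₁
    refine ⟨W₂, h₂.trans h₁, hx₂, ?_⟩
    have hs : res _ (h₂.trans h₁) s = toTensor E F W₂ (pres E F h₂ p) := by
      rw [← toTensor_res, hp, res_res]
    have ht : res _ (h₂.trans h₁) t = toTensor E F W₂ q := by rw [hq, res_res]
    rw [res_add, res_liftFun, res_liftFun, res_liftFun, res_add, hs, ht, ← map_add,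
      liftFun_toTensor, liftFun_toTensor, liftFun_toTensor, map_add]
  map_smul' a s := by
    refine sec_ext _ _ _ fun x hx => ?_
    obtain ⟨W₁, h₁, hx₁, p, hp⟩ := toTensor_locally_surjective E F s x hx
    refine ⟨W₁, h₁, hx₁, ?_⟩
    rw [RingHom.id_apply, res_smul, res_liftFun, res_liftFun, res_smul, ← hp, ← map_smul,
      liftFun_toTensor, liftFun_toTensor, map_smul]

theorem lift_tmul (b : Pairing E F G U) {V : Opens X} (hV : V ≤ U) (s : Sec E V) (t : Sec F V) :
    b.lift hV (tmul s t) = b.toFun V hV s t :=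
  b.liftFun_toTensor hV _

theorem res_lift (b : Pairing E F G U) {V W : Opens X} (hV : V ≤ U) (h : W ≤ V)
    (t : Sec (tensor E F) V) : res _ h (b.lift hV t) = b.lift (h.trans hV) (res _ h t) :=
  b.res_liftFun hV h t

/-- The morphism of sheaves of modules `E ⊗ F ⟶ G` induced by a pairing over `X`. -/
def liftHom (b : Pairing E F G ⊤) : tensor E F ⟶ G :=
  ⟨{ app := fun V => (ModuleCat.ofHom (X := Sec (tensor E F) V.unop) (Y := Sec G V.unop)
        (b.lift (V := V.unop) le_top) : (tensor E F).val.obj V ⟶ G.val.obj V)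
     naturality := fun {V W} i => by
      refine ModuleCat.hom_ext (LinearMap.ext fun t => ?_)
      exact (b.res_lift (V := V.unop) (W := W.unop) le_top (leOfHom i.unop) t).symm }⟩

theorem onSec_liftHom (b : Pairing E F G ⊤) (V : Opens X) (t : Sec (tensor E F) V) :
    onSec b.liftHom V t = b.lift le_top t := rfl

end Pairing

theorem Pairing.lift_congr {E F G : OModule n X} {U U' V : Opens X} (b : Pairing E F G U)
    (b' : Pairing E F G U') (hV : V ≤ U) (hV' : V ≤ U')
    (H : ∀ (W : Opens X) (h : W ≤ V) (s : Sec E W) (t : Sec F W),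
      b.toFun W (h.trans hV) s t = b'.toFun W (h.trans hV') s t) (u : Sec (tensor E F) V) :
    b.lift hV u = b'.lift hV' u :=
  tensor_hom_ext (U := V) (fun _ h u => b.lift (h.trans hV) u) (fun _ h u => b'.lift (h.trans hV') u)
    (fun _ _ _ h t => b.res_lift _ h t) (fun _ _ _ h t => b'.res_lift _ h t)
    (fun _ _ _ _ => map_add _ _ _) (fun _ _ _ _ => map_add _ _ _)
    (fun W h s t => by rw [Pairing.lift_tmul, Pairing.lift_tmul, H W h s t]) le_rfl u

/-- `HolForm.coord` as a map on sections of the sheaf `Ω¹`. -/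
def formCoord (e : Chart n X) (α : Fin n) {V : Opens X} (hV : V ≤ e.dom) :
    Sec (cotangentSheaf n X) V →ₗ[Hol n V] Hol n V :=
  HolForm.coord e α hV

theorem formCoord_res (e : Chart n X) (α : Fin n) {V W : Opens X} (hV : V ≤ e.dom) (h : W ≤ V)
    (θ : Sec (cotangentSheaf n X) V) :
    (formCoord e α hV θ).res h = formCoord e α (h.trans hV) (res _ h θ) :=
  HolForm.coord_res e α hV h θ

/-- The contraction `E ⊗ Ω¹ → E`, `s ⊗ θ ↦ θ(∂_α) s`, over the domain of the chart `e`. -/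
def contractPairing (E : OModule n X) (e : Chart n X) (α : Fin n) :
    Pairing E (cotangentSheaf n X) E e.dom where
  toFun W hW := LinearMap.mk₂ (Hol n W) (fun s θ => formCoord e α hW θ • s)
    (fun _ _ _ => smul_add _ _ _)
    (fun _ _ _ => smul_comm _ _ _)
    (fun s θ η => by rw [map_add, add_smul])
    (fun f s θ => by rw [map_smul, smul_assoc])
  res_toFun V W hV h s θ := by
    simp only [LinearMap.mk₂_apply]
    rw [res_smul, formCoord_res]

/-- The contraction `E ⊗ Ω¹ → E` with `∂/∂z^α`, on sections. -/
def contract (E : OModule n X) (e : Chart n X) (α : Fin n) {V : Opens X} (hV : V ≤ e.dom) :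
    Sec (tensor E (cotangentSheaf n X)) V →ₗ[Hol n V] Sec E V :=
  (contractPairing E e α).lift hV

theorem contract_tmul (E : OModule n X) (e : Chart n X) (α : Fin n) {V : Opens X} (hV : V ≤ e.dom)
    (s : Sec E V) (θ : Sec (cotangentSheaf n X) V) :
    contract E e α hV (tmul s θ) = formCoord e α hV θ • s :=
  Pairing.lift_tmul _ _ _ _

theorem res_contract (E : OModule n X) (e : Chart n X) (α : Fin n) {V W : Opens X}
    (hV : V ≤ e.dom) (h : W ≤ V) (u : Sec (tensor E (cotangentSheaf n X)) V) :
    res _ h (contract E e α hV u) = contract E e α (h.trans hV) (res _ h u) :=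
  Pairing.res_lift _ _ _ _

/-- The component `φ_α : E → E` of `φ = ∑ φ_α dz^α` over open subsets of the domain of a chart. -/
def fieldComp {E : OModule n X} (φ : E ⟶ tensor E (cotangentSheaf n X)) (e : Chart n X)
    (α : Fin n) {V : Opens X} (hV : V ≤ e.dom) : Sec E V →ₗ[Hol n V] Sec E V :=
  contract E e α hV ∘ₗ onSec φ V

theorem res_fieldComp {E : OModule n X} (φ : E ⟶ tensor E (cotangentSheaf n X)) (e : Chart n X)
    (α : Fin n) {V W : Opens X} (hV : V ≤ e.dom) (h : W ≤ V) (s : Sec E V) :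
    res E h (fieldComp φ e α hV s) = fieldComp φ e α (h.trans hV) (res E h s) :=
  (res_contract E e α hV h _).trans (congrArg _ (onSec_res φ h s))

variable (n X) in
/-- An `O`-module `E` with a Higgs field `φ : E → E ⊗ Ω¹` such that `φ ∧ φ = 0`, which in local
coordinates, `φ = ∑ φ_α dz^α`, says that `[φ_α, φ_β] = 0` for all `α`, `β`. (A Higgs sheaf is
such a pair with `E` coherent.) -/
structure HiggsModule where
  sheaf : OModule n X
  field : sheaf ⟶ tensor sheaf (cotangentSheaf n X)
  integrable : ∀ (e : Chart n X) (α β : Fin n) (V : Opens X) (hV : V ≤ e.dom) (s : Sec sheaf V),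
    fieldComp field e α hV (fieldComp field e β hV s) =
      fieldComp field e β hV (fieldComp field e α hV s)

section tensorField
variable {E F : OModule n X}

def insertRight (E : OModule n X) {U : Opens X} (t : Sec F U) :
    Pairing E (cotangentSheaf n X) (tensor (tensor E F) (cotangentSheaf n X)) U where
  toFun W hW := LinearMap.mk₂ (Hol n W) (fun s θ => tmul (tmul s (res F hW t)) θ)
    (fun _ _ _ => by rw [add_tmul, add_tmul]) (fun _ _ _ => by rw [smul_tmul, smul_tmul])
    (fun _ _ _ => tmul_add _ _ _) (fun _ _ _ => tmul_smul _ _ _)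
  res_toFun V W hV h s θ := by
    simp only [LinearMap.mk₂_apply]
    rw [res_tmul, res_tmul, res_res]

def insertLeft (F : OModule n X) {U : Opens X} (s : Sec E U) :
    Pairing F (cotangentSheaf n X) (tensor (tensor E F) (cotangentSheaf n X)) U where
  toFun W hW := LinearMap.mk₂ (Hol n W) (fun t θ => tmul (tmul (res E hW s) t) θ)
    (fun _ _ _ => by rw [tmul_add, add_tmul]) (fun _ _ _ => by rw [tmul_smul, smul_tmul])
    (fun _ _ _ => tmul_add _ _ _) (fun _ _ _ => tmul_smul _ _ _)
  res_toFun V W hV h s θ := by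
    simp only [LinearMap.mk₂_apply]
    rw [res_tmul, res_tmul, res_res]

theorem contract_insertRight (e : Chart n X) (α : Fin n) {V : Opens X} (hV : V ≤ e.dom)
    (t : Sec F V) (u : Sec (tensor E (cotangentSheaf n X)) V) :
    contract (tensor E F) e α hV ((insertRight E t).lift le_rfl u) =
      tmul (contract E e α hV u) t := by
  have := tensor_hom_ext (E := E) (F := cotangentSheaf n X) (G := tensor E F) (U := V)
    (fun _ h u => contract (tensor E F) e α (h.trans hV) ((insertRight E t).lift h u))
    (fun _ h u => tmul (contract E e α (h.trans hV) u) (res F h t))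
    (fun _ _ _ h u => by rw [res_contract, Pairing.res_lift])
    (fun _ _ _ h u => by rw [res_tmul, res_contract, res_res])
    (fun _ _ _ _ => by rw [map_add, map_add]) (fun _ _ _ _ => by rw [map_add, add_tmul])
    (fun W h s θ => by
      rw [Pairing.lift_tmul]
      refine (contract_tmul _ e α _ _ _).trans ?_
      refine Eq.trans ?_ (congrArg (fun z => tmul z (res F h t)) (contract_tmul E e α _ s θ)).symm
      rw [smul_tmul]) le_rfl u
  simpa only [res_self] using this

theorem contract_insertLeft (e : Chart n X) (α : Fin n) {V : Opens X} (hV : V ≤ e.dom)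
    (s : Sec E V) (u : Sec (tensor F (cotangentSheaf n X)) V) :
    contract (tensor E F) e α hV ((insertLeft F s).lift le_rfl u) =
      tmul s (contract F e α hV u) := by
  have := tensor_hom_ext (E := F) (F := cotangentSheaf n X) (G := tensor E F) (U := V)
    (fun _ h u => contract (tensor E F) e α (h.trans hV) ((insertLeft F s).lift h u))
    (fun _ h u => tmul (res E h s) (contract F e α (h.trans hV) u))
    (fun _ _ _ h u => by rw [res_contract, Pairing.res_lift])
    (fun _ _ _ h u => by rw [res_tmul, res_contract, res_res])
    (fun _ _ _ _ => by rw [map_add, map_add]) (fun _ _ _ _ => by rw [map_add, tmul_add])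
    (fun W h t θ => by
      rw [Pairing.lift_tmul]
      refine (contract_tmul _ e α _ _ _).trans ?_
      refine Eq.trans ?_ (congrArg (fun z => tmul (res E h s) z) (contract_tmul F e α _ t θ)).symm
      rw [tmul_smul]) le_rfl u
  simpa only [res_self] using this

theorem insertRight_lift_res {V W : Opens X} (h : W ≤ V) (t : Sec F V)
    (u : Sec (tensor E (cotangentSheaf n X)) V) :
    res _ h ((insertRight E t).lift le_rfl u) =
      (insertRight E (res F h t)).lift le_rfl (res _ h u) := by
  rw [Pairing.res_lift]
  refine Pairing.lift_congr _ _ _ _ (fun W' h' s θ => ?_) _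
  simp only [insertRight, LinearMap.mk₂_apply, res_res]

theorem insertLeft_lift_res {V W : Opens X} (h : W ≤ V) (s : Sec E V)
    (u : Sec (tensor F (cotangentSheaf n X)) V) :
    res _ h ((insertLeft F s).lift le_rfl u) =
      (insertLeft F (res E h s)).lift le_rfl (res _ h u) := by
  rw [Pairing.res_lift]
  refine Pairing.lift_congr _ _ _ _ (fun W' h' s θ => ?_) _
  simp only [insertLeft, LinearMap.mk₂_apply, res_res]

theorem insertRight_lift_add {V : Opens X} (t t' : Sec F V)
    (u : Sec (tensor E (cotangentSheaf n X)) V) :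
    (insertRight E (t + t')).lift le_rfl u =
      (insertRight E t).lift le_rfl u + (insertRight E t').lift le_rfl u := by
  refine tensor_hom_ext (U := V) (fun _ h u => (insertRight E (t + t')).lift h u)
    (fun _ h u => (insertRight E t).lift h u + (insertRight E t').lift h u)
    (fun _ _ _ _ _ => by rw [Pairing.res_lift])
    (fun _ _ _ _ _ => by rw [res_add, Pairing.res_lift, Pairing.res_lift])
    (fun _ _ _ _ => by rw [map_add]) (fun _ _ _ _ => by rw [map_add, map_add]; abel)
    (fun W h s θ => ?_) le_rfl u
  simp only [Pairing.lift_tmul, insertRight, LinearMap.mk₂_apply, res_add, tmul_add, add_tmul]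

theorem insertLeft_lift_add {V : Opens X} (s s' : Sec E V)
    (u : Sec (tensor F (cotangentSheaf n X)) V) :
    (insertLeft F (s + s')).lift le_rfl u =
      (insertLeft F s).lift le_rfl u + (insertLeft F s').lift le_rfl u := by
  refine tensor_hom_ext (U := V) (fun _ h u => (insertLeft F (s + s')).lift h u)
    (fun _ h u => (insertLeft F s).lift h u + (insertLeft F s').lift h u)
    (fun _ _ _ _ _ => by rw [Pairing.res_lift])
    (fun _ _ _ _ _ => by rw [res_add, Pairing.res_lift, Pairing.res_lift])
    (fun _ _ _ _ => by rw [map_add]) (fun _ _ _ _ => by rw [map_add, map_add]; abel)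
    (fun W h t θ => ?_) le_rfl u
  simp only [Pairing.lift_tmul, insertLeft, LinearMap.mk₂_apply, res_add, add_tmul]

theorem insertRight_lift_smul {V : Opens X} (f : Hol n V) (t : Sec F V)
    (u : Sec (tensor E (cotangentSheaf n X)) V) :
    (insertRight E (f • t)).lift le_rfl u = f • (insertRight E t).lift le_rfl u := by
  have := tensor_hom_ext (U := V) (fun _ h u => (insertRight E (f • t)).lift h u)
    (fun _ h u => f.res h • (insertRight E t).lift h u)
    (fun _ _ _ _ _ => by rw [Pairing.res_lift])
    (fun _ _ _ _ _ => by rw [res_smul, Pairing.res_lift]; rfl)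
    (fun _ _ _ _ => by rw [map_add]) (fun _ _ _ _ => by rw [map_add, smul_add])
    (fun W h s θ => by
      simp only [Pairing.lift_tmul, insertRight, LinearMap.mk₂_apply, res_smul, tmul_smul,
        smul_tmul]) le_rfl u
  exact this

theorem insertLeft_lift_smul {V : Opens X} (f : Hol n V) (s : Sec E V)
    (u : Sec (tensor F (cotangentSheaf n X)) V) :
    (insertLeft F (f • s)).lift le_rfl u = f • (insertLeft F s).lift le_rfl u := by
  have := tensor_hom_ext (U := V) (fun _ h u => (insertLeft F (f • s)).lift h u)
    (fun _ h u => f.res h • (insertLeft F s).lift h u)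
    (fun _ _ _ _ _ => by rw [Pairing.res_lift])
    (fun _ _ _ _ _ => by rw [res_smul, Pairing.res_lift]; rfl)
    (fun _ _ _ _ => by rw [map_add]) (fun _ _ _ _ => by rw [map_add, smul_add])
    (fun W h s θ => by
      simp only [Pairing.lift_tmul, insertLeft, LinearMap.mk₂_apply, res_smul,
        smul_tmul]) le_rfl u
  exact this

def tensorFieldPairing (φ : E ⟶ tensor E (cotangentSheaf n X))
    (ψ : F ⟶ tensor F (cotangentSheaf n X)) :
    Pairing E F (tensor (tensor E F) (cotangentSheaf n X)) ⊤ where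
  toFun W _ := LinearMap.mk₂ (Hol n W)
    (fun s t => (insertRight E t).lift le_rfl (onSec φ W s) +
      (insertLeft F s).lift le_rfl (onSec ψ W t))
    (fun _ _ _ => by rw [map_add, map_add, insertLeft_lift_add]; abel)
    (fun _ _ _ => by rw [map_smul, map_smul, insertLeft_lift_smul, smul_add])
    (fun _ _ _ => by rw [map_add, map_add, insertRight_lift_add]; abel)
    (fun _ _ _ => by rw [map_smul, map_smul, insertRight_lift_smul, smul_add])
  res_toFun V W hV h s t := by
    simp only [LinearMap.mk₂_apply]
    rw [res_add, insertRight_lift_res, insertLeft_lift_res, onSec_res, onSec_res]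

/-- The Higgs field `φ ⊗ 1 + 1 ⊗ ψ` on `E ⊗ F`. -/
def tensorField (φ : E ⟶ tensor E (cotangentSheaf n X)) (ψ : F ⟶ tensor F (cotangentSheaf n X)) :
    tensor E F ⟶ tensor (tensor E F) (cotangentSheaf n X) :=
  (tensorFieldPairing φ ψ).liftHom

theorem fieldComp_tensorField (φ : E ⟶ tensor E (cotangentSheaf n X))
    (ψ : F ⟶ tensor F (cotangentSheaf n X)) (e : Chart n X) (α : Fin n) {V : Opens X}
    (hV : V ≤ e.dom) (s : Sec E V) (t : Sec F V) :
    fieldComp (tensorField φ ψ) e α hV (tmul s t) =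
      tmul (fieldComp φ e α hV s) t + tmul s (fieldComp ψ e α hV t) := by
  have : onSec (tensorField φ ψ) V (tmul s t) = (insertRight E t).lift le_rfl (onSec φ V s) +
      (insertLeft F s).lift le_rfl (onSec ψ V t) := Pairing.lift_tmul _ _ _ _
  simp only [fieldComp, LinearMap.comp_apply]
  rw [this, map_add, contract_insertRight, contract_insertLeft]

end tensorField

namespace HiggsModule

/-- The tensor product `(E₁ ⊗ E₂, φ₁ ⊗ 1 + 1 ⊗ φ₂)`. -/
def tensorProduct (E₁ E₂ : HiggsModule n X) : HiggsModule n X where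
  sheaf := tensor E₁.sheaf E₂.sheaf
  field := tensorField E₁.field E₂.field
  integrable e α β V hV s := by
    refine tensor_hom_ext (U := V)
      (fun _ h s => fieldComp (tensorField E₁.field E₂.field) e α (h.trans hV)
        (fieldComp (tensorField E₁.field E₂.field) e β (h.trans hV) s))
      (fun _ h s => fieldComp (tensorField E₁.field E₂.field) e β (h.trans hV)
        (fieldComp (tensorField E₁.field E₂.field) e α (h.trans hV) s))
      (fun _ _ _ _ _ => by rw [res_fieldComp, res_fieldComp])
      (fun _ _ _ _ _ => by rw [res_fieldComp, res_fieldComp])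
      (fun _ _ _ _ => by rw [map_add, map_add]) (fun _ _ _ _ => by rw [map_add, map_add])
      (fun W h s t => ?_) le_rfl s
    simp only [fieldComp_tensorField, map_add]
    rw [E₁.integrable e α β, E₂.integrable e α β]
    abel

def whiskerPairing {E G : OModule n X} (f : E ⟶ G) :
    Pairing E (cotangentSheaf n X) (tensor G (cotangentSheaf n X)) ⊤ where
  toFun W _ := LinearMap.mk₂ (Hol n W) (fun s θ => tmul (onSec f W s) θ)
    (fun _ _ _ => by rw [map_add, add_tmul]) (fun _ _ _ => by rw [map_smul, smul_tmul])
    (fun _ _ _ => tmul_add _ _ _) (fun _ _ _ => tmul_smul _ _ _)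
  res_toFun V W hV h s θ := by
    simp only [LinearMap.mk₂_apply]
    rw [res_tmul, onSec_res]

/-- The morphism `f ⊗ 1 : E ⊗ Ω¹ ⟶ G ⊗ Ω¹`. -/
def whisker {E G : OModule n X} (f : E ⟶ G) :
    tensor E (cotangentSheaf n X) ⟶ tensor G (cotangentSheaf n X) :=
  (whiskerPairing f).liftHom

theorem contract_whisker {E G : OModule n X} (f : E ⟶ G) (e : Chart n X) (α : Fin n) {V : Opens X}
    (hV : V ≤ e.dom) (u : Sec (tensor E (cotangentSheaf n X)) V) :
    contract G e α hV (onSec (whisker f) V u) = onSec f V (contract E e α hV u) := by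
  refine tensor_hom_ext (U := V) (fun W h u => contract G e α (h.trans hV) (onSec (whisker f) W u))
    (fun W h u => onSec f W (contract E e α (h.trans hV) u))
    (fun _ _ _ _ _ => by rw [res_contract, onSec_res])
    (fun _ _ _ _ _ => by rw [onSec_res, res_contract])
    (fun _ _ _ _ => by rw [map_add, map_add]) (fun _ _ _ _ => by rw [map_add, map_add])
    (fun W h s θ => ?_) le_rfl u
  refine (congrArg _ (Pairing.lift_tmul (whiskerPairing f) le_top s θ)).trans ?_
  refine (contract_tmul _ e α _ _ _).trans ?_
  refine Eq.trans ?_ (congrArg _ (contract_tmul E e α _ s θ)).symm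
  rw [map_smul]

open Limits in
/-- The Higgs field `pr₁^* φ + pr₂^* ψ`, i.e. `(v, w) ↦ (φ v, ψ w)`, on `E ⊕ F`. -/
def sumField {E F : OModule n X} (φ : E ⟶ tensor E (cotangentSheaf n X))
    (ψ : F ⟶ tensor F (cotangentSheaf n X)) : E ⊞ F ⟶ tensor (E ⊞ F) (cotangentSheaf n X) :=
  biprod.fst ≫ φ ≫ whisker biprod.inl + biprod.snd ≫ ψ ≫ whisker biprod.inr

open Limits in
theorem fieldComp_sumField {E F : OModule n X} (φ : E ⟶ tensor E (cotangentSheaf n X))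
    (ψ : F ⟶ tensor F (cotangentSheaf n X)) (e : Chart n X) (α : Fin n) {V : Opens X}
    (hV : V ≤ e.dom) (v : Sec (E ⊞ F) V) :
    fieldComp (sumField φ ψ) e α hV v =
      onSec biprod.inl V (fieldComp φ e α hV (onSec biprod.fst V v)) +
      onSec biprod.inr V (fieldComp ψ e α hV (onSec biprod.snd V v)) := by
  have : onSec (sumField φ ψ) V v =
      onSec (whisker biprod.inl) V (onSec φ V (onSec biprod.fst V v)) +
      onSec (whisker biprod.inr) V (onSec ψ V (onSec biprod.snd V v)) := rfl
  simp only [fieldComp, LinearMap.comp_apply]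
  rw [this, map_add, contract_whisker, contract_whisker]

open Limits in
/-- The Whitney sum `(E₁ ⊕ E₂, pr₁^* φ₁ + pr₂^* φ₂)`. -/
def directSum (E₁ E₂ : HiggsModule n X) : HiggsModule n X where
  sheaf := E₁.sheaf ⊞ E₂.sheaf
  field := sumField E₁.field E₂.field
  integrable e α β V hV v := by
    have h11 : ∀ u, onSec (biprod.fst : E₁.sheaf ⊞ E₂.sheaf ⟶ _) V (onSec biprod.inl V u) = u :=
      fun u => congrArg (fun f => onSec f V u) (biprod.inl_fst (X := E₁.sheaf) (Y := E₂.sheaf))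
    have h12 : ∀ u, onSec (biprod.snd : E₁.sheaf ⊞ E₂.sheaf ⟶ _) V (onSec biprod.inl V u) = 0 :=
      fun u => congrArg (fun f => onSec f V u) (biprod.inl_snd (X := E₁.sheaf) (Y := E₂.sheaf))
    have h21 : ∀ u, onSec (biprod.fst : E₁.sheaf ⊞ E₂.sheaf ⟶ _) V (onSec biprod.inr V u) = 0 :=
      fun u => congrArg (fun f => onSec f V u) (biprod.inr_fst (X := E₁.sheaf) (Y := E₂.sheaf))
    have h22 : ∀ u, onSec (biprod.snd : E₁.sheaf ⊞ E₂.sheaf ⟶ _) V (onSec biprod.inr V u) = u :=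
      fun u => congrArg (fun f => onSec f V u) (biprod.inr_snd (X := E₁.sheaf) (Y := E₂.sheaf))
    simp only [fieldComp_sumField, map_add, h11, h12, h21, h22, map_zero, add_zero, zero_add]
    rw [E₁.integrable e α β, E₂.integrable e α β]

end HiggsModule

/-! ### Analytic subsets and torsion -/

/-- `A` is locally the common zero set of finitely many holomorphic functions. -/
def IsAnalyticSubset (n : ℕ) {X : Type} [TopologicalSpace X] [ChartedSpace (Fin n → ℂ) X]
    (A : Set X) : Prop :=
  ∀ x : X, ∃ V : Opens X, x ∈ V ∧ ∃ (m : ℕ) (f : Fin m → Hol n V),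
    ∀ (y : X) (hy : y ∈ V), y ∈ A ↔ ∀ i, (f i).eval y hy = 0

/-- `A` has codimension at least two: it contains no nonempty holomorphically immersed piece of
dimension `n - 1`. (The dimension of an analytic set is the largest dimension of a complex
submanifold contained in it.) -/
def CodimAtLeastTwo (n : ℕ) {X : Type} [TopologicalSpace X] [ChartedSpace (Fin n → ℂ) X]
    (A : Set X) : Prop :=
  ∀ (e : Chart n X) (V : Set (Fin (n - 1) → ℂ)) (f : (Fin (n - 1) → ℂ) → (Fin n → ℂ)),
    IsOpen V → V.Nonempty → DifferentiableOn ℂ f V →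
    (∀ t ∈ V, Function.Injective (fderiv ℂ f t)) →
    ¬ ∀ t ∈ V, f t ∈ e.1.target ∧ e.1.symm (f t) ∈ A

/-- The complement of `U` is an analytic subset of codimension at least two. -/
def IsBigOpen (n : ℕ) {X : Type} [TopologicalSpace X] [ChartedSpace (Fin n → ℂ) X]
    (U : Opens X) : Prop :=
  IsAnalyticSubset n (U : Set X)ᶜ ∧ CodimAtLeastTwo n (U : Set X)ᶜ

/-- `E` is torsion-free: a section killed by a holomorphic function all of whose germs are nonzero
vanishes. -/
def IsTorsionFree (E : OModule n X) : Prop :=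
  ∀ (V : Opens X) (f : Hol n V) (s : Sec E V),
    (∀ (W : Opens X) (h : W ≤ V), (W : Set X).Nonempty → f.res h ≠ 0) → f • s = 0 → s = 0

/-- Coherence, in the form: locally there is an exact sequence `O^q → O^p → E → 0`
(equivalent to the usual definition because `O` is coherent). -/
def IsCoherent (E : OModule n X) : Prop :=
  SheafOfModules.IsFinitePresentation E

/-! ### Kähler metrics -/

/-- The operator `∂/∂z_j`. -/
def dz (j : Fin n) (f : (Fin n → ℂ) → ℂ) (z : Fin n → ℂ) : ℂ :=
  (1 / 2) * (fderiv ℝ f z (Pi.single j 1) - Complex.I * fderiv ℝ f z (Pi.single j Complex.I))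

/-- The operator `∂/∂z̄_j`. -/
def dzbar (j : Fin n) (f : (Fin n → ℂ) → ℂ) (z : Fin n → ℂ) : ℂ :=
  (1 / 2) * (fderiv ℝ f z (Pi.single j 1) + Complex.I * fderiv ℝ f z (Pi.single j Complex.I))

/-- The matrix `g(∂_j, ∂_k)` of a family of sesquilinear forms in a chart, at the point with
coordinates `z`. -/
def chartMatrix (B : ∀ x : X, HolTangent n x →ₗ[ℂ] HolTangent n x →ₗ⋆[ℂ] ℂ) (e : Chart n X)
    (z : Fin n → ℂ) : Matrix (Fin n) (Fin n) ℂ :=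
  Matrix.of fun j k => B (e.1.symm z) (e.coordVec j (e.1.symm z)) (e.coordVec k (e.1.symm z))

variable (n X) in
/-- A Kähler metric: a smooth Hermitian metric `g` on the holomorphic tangent bundle whose
fundamental form `ω = i ∑ g_{jk} dz^j ∧ dz̄^k` is closed. -/
structure KahlerMetric where
  inner : ∀ x : X, HolTangent n x →ₗ[ℂ] HolTangent n x →ₗ⋆[ℂ] ℂ
  conj_symm : ∀ (x : X) (v w : HolTangent n x), inner x w v = star (inner x v w)
  pos : ∀ (x : X) (v : HolTangent n x), v ≠ 0 → 0 < (inner x v v).re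
  smooth : ∀ (e : Chart n X) (j k : Fin n),
    ContDiffOn ℝ ∞ (fun z => chartMatrix inner e z j k) e.1.target
  closed : ∀ (e : Chart n X) (j k l : Fin n), ∀ z ∈ e.1.target,
    dz l (fun w => chartMatrix inner e w j k) z = dz j (fun w => chartMatrix inner e w l k) z

namespace KahlerMetric

/-- The matrix `g_{jk}` in a chart. -/
def coeff (g : KahlerMetric n X) (e : Chart n X) (z : Fin n → ℂ) : Matrix (Fin n) (Fin n) ℂ :=
  chartMatrix g.inner e z

open MeasureTheory

/-- The volume `ω^n / n!`, which is `2^n det (g_{jk})` times Lebesgue measure, on the domain of a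
chart. -/
def chartVolume [MeasurableSpace X] (g : KahlerMetric n X) (e : Chart n X) : Measure X :=
  ((volume.restrict e.1.target).withDensity
    fun z => ENNReal.ofReal (2 ^ n * (g.coeff e z).det.re)).map e.1.symm

theorem exists_partition (n : ℕ) (X : Type) [TopologicalSpace X] [ChartedSpace (Fin n → ℂ) X]
    [T2Space X] [CompactSpace X] :
    ∃ ρ : PartitionOfUnity X X, ρ.IsSubordinate fun x => (chartAt (Fin n → ℂ) x).source :=
  PartitionOfUnity.exists_isSubordinate isClosed_univ _
    (fun x => (chartAt (Fin n → ℂ) x).open_source)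
    fun x _ => Set.mem_iUnion.2 ⟨x, mem_chart_source _ x⟩

/-- The volume measure `ω^n / n!` on `X`, glued from the charts with a partition of unity. -/
def vol [MeasurableSpace X] [T2Space X] [CompactSpace X] (g : KahlerMetric n X) : Measure X :=
  Measure.sum fun x : X =>
    (g.chartVolume ⟨chartAt (Fin n → ℂ) x, chart_mem_atlas _ x⟩).withDensity
      fun y => ENNReal.ofReal ((exists_partition n X).choose x y)

end KahlerMetric

/-! ### Local frames -/

/-- `s` is a frame of `E` over `V`: over every smaller open set each section of `E` is a unique
combination of the `s i`, i.e. `s` defines an isomorphism `O^r ≅ E` over `V`. -/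
def IsFrame (E : OModule n X) {r : ℕ} {V : Opens X} (s : Fin r → Sec E V) : Prop :=
  ∀ (W : Opens X) (h : W ≤ V) (t : Sec E W), ∃! a : Fin r → Hol n W, t = ∑ i, a i • res E h (s i)

/-- The coordinates of a section in a frame. -/
def IsFrame.coord {E : OModule n X} {r : ℕ} {V : Opens X} {s : Fin r → Sec E V}
    (hs : IsFrame E s) (t : Sec E V) : Fin r → Hol n V :=
  (hs V le_rfl t).choose

/-- `E` is locally free over `U`. -/
def LocallyFreeOn (E : OModule n X) (U : Opens X) : Prop :=
  ∀ x ∈ U, ∃ V : Opens X, x ∈ V ∧ V ≤ U ∧ ∃ (r : ℕ) (s : Fin r → Sec E V), IsFrame E s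

/-- `E` is locally free of rank `r` over `U`. -/
def LocallyFreeOfRankOn (E : OModule n X) (r : ℕ) (U : Opens X) : Prop :=
  ∀ x ∈ U, ∃ V : Opens X, x ∈ V ∧ V ≤ U ∧ ∃ s : Fin r → Sec E V, IsFrame E s

/-- A holomorphic frame of `E` near `x ∈ U`, over an open set contained in the domain of a chart. -/
structure LocalFrame (E : OModule n X) (U : Opens X) (x : X) where
  chart : Chart n X
  dom : Opens X
  mem_dom : x ∈ dom
  dom_le : dom ≤ U
  dom_le_chart : dom ≤ chart.dom
  rank : ℕ
  sec : Fin rank → Sec E dom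
  isFrame : IsFrame E sec

/-! ### Hermitian metrics and curvature -/

/-- A smooth Hermitian metric on the holomorphic vector bundle `E|_U` (for `E` locally free over
`U`), given by the functions `h(s, t)` for local sections `s`, `t`; the function `inner V hV s t`
is only relevant on `V`. -/
structure HermitianMetric (E : OModule n X) (U : Opens X) where
  inner : ∀ V : Opens X, V ≤ U → Sec E V → Sec E V → X → ℂ
  add_left : ∀ (V : Opens X) (hV : V ≤ U) (s s' t : Sec E V), ∀ x ∈ V,
    inner V hV (s + s') t x = inner V hV s t x + inner V hV s' t x
  smul_left : ∀ (V : Opens X) (hV : V ≤ U) (f : Hol n V) (s t : Sec E V) (x : X) (hx : x ∈ V),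
    inner V hV (f • s) t x = f.eval x hx * inner V hV s t x
  conj_symm : ∀ (V : Opens X) (hV : V ≤ U) (s t : Sec E V), ∀ x ∈ V,
    inner V hV t s x = star (inner V hV s t x)
  res_eq : ∀ (V W : Opens X) (hV : V ≤ U) (h : W ≤ V) (s t : Sec E V), ∀ x ∈ W,
    inner W (h.trans hV) (res E h s) (res E h t) x = inner V hV s t x
  smooth : ∀ (V : Opens X) (hV : V ≤ U) (s t : Sec E V) (e : Chart n X),
    ContDiffOn ℝ ∞ (fun z => inner V hV s t (e.1.symm z)) (e.1.target ∩ e.1.symm ⁻¹' V)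
  posDef : ∀ (V : Opens X) (hV : V ≤ U) (r : ℕ) (s : Fin r → Sec E V), IsFrame E s → ∀ x ∈ V,
    (Matrix.of fun i j => inner V hV (s i) (s j) x).PosDef

section matrices
variable {r : ℕ}

/-- The adjoint of an endomorphism with matrix `A` (acting on columns) for the Hermitian form with
Gram matrix `H i j = h(e_i, e_j)`. -/
def adjointMatrix (H A : Matrix (Fin r) (Fin r) ℂ) : Matrix (Fin r) (Fin r) ℂ :=
  H.transpose⁻¹ * A.conjTranspose * H.transpose

/-- The norm `|A| = (tr (A A^*))^{1/2}` of an endomorphism of a Hermitian vector space. -/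
def endNorm (H A : Matrix (Fin r) (Fin r) ℂ) : ℝ :=
  Real.sqrt (A * adjointMatrix H A).trace.re

/-- The coefficient `R_{jk}` of the Chern curvature `R = ∑ R_{jk} dz^j ∧ dz̄^k`, as a matrix acting
on columns, where `H` is the Gram matrix of a holomorphic frame: `R = ∂̄ (∂H · H⁻¹)ᵀ`. -/
def chernCurvature (H : (Fin n → ℂ) → Matrix (Fin r) (Fin r) ℂ) (j k : Fin n) (z : Fin n → ℂ) :
    Matrix (Fin r) (Fin r) ℂ :=
  -(Matrix.of fun a b => dzbar k
    (fun w => ((Matrix.of fun c d => dz j (fun u => H u c d) w) * (H w)⁻¹) a b) z).transpose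

/-- The contraction `iΛ (∑ a_{jk} dz^j ∧ dz̄^k) = ∑ g^{jk} a_{jk}`, where `G = (g_{jk})`. -/
def contractWith (G : Matrix (Fin n) (Fin n) ℂ) (a : Fin n → Fin n → Matrix (Fin r) (Fin r) ℂ) :
    Matrix (Fin r) (Fin r) ℂ :=
  ∑ j, ∑ k, G⁻¹ k j • a j k

/-- The pointwise squared norm of the `End E`-valued form `∑ a_{jk} dz^j ∧ dz̄^k`. -/
def formNormSq (G : Matrix (Fin n) (Fin n) ℂ) (H : Matrix (Fin r) (Fin r) ℂ)
    (a : Fin n → Fin n → Matrix (Fin r) (Fin r) ℂ) : ℝ :=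
  (∑ j, ∑ k, ∑ l, ∑ m, G⁻¹ l j * G⁻¹ k m * (a j k * adjointMatrix H (a l m)).trace).re

end matrices

namespace LocalFrame
variable {E : OModule n X} {U : Opens X} {x : X}

/-- The matrix at `x` of the component `φ_α` of a Higgs field in the frame. -/
def fieldMatrix (T : LocalFrame E U x) (φ : E ⟶ tensor E (cotangentSheaf n X)) (α : Fin n) :
    Matrix (Fin T.rank) (Fin T.rank) ℂ :=
  Matrix.of fun i j =>
    (T.isFrame.coord (fieldComp φ T.chart α T.dom_le_chart (T.sec j)) i).eval x T.mem_dom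

/-- The Gram matrix of the frame, as a function of the coordinates. -/
def gram (T : LocalFrame E U x) (h : HermitianMetric E U) (z : Fin n → ℂ) :
    Matrix (Fin T.rank) (Fin T.rank) ℂ :=
  Matrix.of fun i j => h.inner T.dom T.dom_le (T.sec i) (T.sec j) (T.chart.1.symm z)

/-- The Gram matrix at `x`. -/
def gramAt (T : LocalFrame E U x) (h : HermitianMetric E U) : Matrix (Fin T.rank) (Fin T.rank) ℂ :=
  T.gram h (T.chart.1 x)

/-- The metric coefficients `g_{jk}` at `x` in the chart of the frame. -/
def metricAt (T : LocalFrame E U x) (g : KahlerMetric n X) : Matrix (Fin n) (Fin n) ℂ :=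
  g.coeff T.chart (T.chart.1 x)

/-- The Chern curvature of `h` at `x`. -/
def curvature (T : LocalFrame E U x) (h : HermitianMetric E U) (j k : Fin n) :
    Matrix (Fin T.rank) (Fin T.rank) ℂ :=
  chernCurvature (T.gram h) j k (T.chart.1 x)

/-- `|R_h|²` at `x`. -/
def curvatureNormSq (T : LocalFrame E U x) (g : KahlerMetric n X) (h : HermitianMetric E U) : ℝ :=
  formNormSq (T.metricAt g) (T.gramAt h) (T.curvature h)

/-- The mean curvature `K_h = iΛ R_h` at `x`. -/
def meanCurvature (T : LocalFrame E U x) (g : KahlerMetric n X) (h : HermitianMetric E U) :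
    Matrix (Fin T.rank) (Fin T.rank) ℂ :=
  contractWith (T.metricAt g) (T.curvature h)

/-- The Hitchin–Simpson mean curvature `K_h + iΛ [φ, φ̄_h]` at `x`, where
`[φ, φ̄_h] = ∑ [φ_j, φ_k^*] dz^j ∧ dz̄^k`. -/
def hitchinSimpsonMeanCurvature (T : LocalFrame E U x) (g : KahlerMetric n X)
    (h : HermitianMetric E U) (φ : E ⟶ tensor E (cotangentSheaf n X)) :
    Matrix (Fin T.rank) (Fin T.rank) ℂ :=
  T.meanCurvature g h + contractWith (T.metricAt g) fun j k =>
    T.fieldMatrix φ j * adjointMatrix (T.gramAt h) (T.fieldMatrix φ k) -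
      adjointMatrix (T.gramAt h) (T.fieldMatrix φ k) * T.fieldMatrix φ j

end LocalFrame

/-! ### Degree and slope -/

/-- A determinant line bundle of a sheaf `E` that is locally free of rank `r` outside an analytic
subset of codimension at least two: a holomorphic line bundle `L` on `X` together with an
isomorphism `Λ^r E ≅ L` outside such a subset, given as an alternating map that sends frames to
frames. -/
structure DetBundle (E : OModule n X) (r : ℕ) where
  dom : Opens X
  isBigOpen : IsBigOpen n dom
  locallyFree : LocallyFreeOfRankOn E r dom
  bundle : OModule n X
  isLineBundle : LocallyFreeOfRankOn bundle 1 ⊤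
  det : ∀ V : Opens X, V ≤ dom → Sec E V [⋀^Fin r]→ₗ[Hol n V] Sec bundle V
  res_det : ∀ (V W : Opens X) (hV : V ≤ dom) (h : W ≤ V) (s : Fin r → Sec E V),
    res bundle h (det V hV s) = det W (h.trans hV) fun i => res E h (s i)
  det_frame : ∀ (V : Opens X) (hV : V ≤ dom) (s : Fin r → Sec E V), IsFrame E s →
    IsFrame bundle fun _ : Fin 1 => det V hV s

section degree
open MeasureTheory
variable [MeasurableSpace X] [T2Space X] [CompactSpace X]

/-- `E` has rank `r` and degree `d = ∫ c₁(det E) ∧ ω^{n-1}`. Here `c₁` is represented by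
`(i/2π) R` for the Chern curvature `R` of a Hermitian metric on `det E`, and
`iR ∧ ω^{n-1} = (n-1)! K ω^n / n!` with `K = iΛR`. -/
def HasRankDegree (g : KahlerMetric n X) (E : OModule n X) (r : ℕ) (d : ℝ) : Prop :=
  ∃ (D : DetBundle E r) (h : HermitianMetric D.bundle ⊤) (K : X → ℝ),
    (∀ (x : X) (T : LocalFrame D.bundle ⊤ x), (T.meanCurvature g h).trace = (K x : ℂ)) ∧
    Integrable K g.vol ∧ d = (n - 1).factorial / (2 * Real.pi) * ∫ x, K x ∂g.vol

/-- `E` has positive rank and slope `μ = deg E / rk E`. -/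
def HasSlope (g : KahlerMetric n X) (E : OModule n X) (μ : ℝ) : Prop :=
  ∃ (r : ℕ) (d : ℝ), 0 < r ∧ HasRankDegree g E r d ∧ μ = d / r

/-- The constant `c = 2πμ / ((n-1)! vol X)` attached to the slope `μ`. -/
def hymConstant (g : KahlerMetric n X) (μ : ℝ) : ℝ :=
  2 * Real.pi * μ / ((n - 1).factorial * g.vol.real Set.univ)

/-- An admissible structure on `E`: a Hermitian metric on `E|_U`, where `U` is the complement of an
analytic subset of codimension at least two and `E` is locally free on `U`, with square-integrable
Chern curvature and integrable mean curvature. -/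
structure AdmissibleStructure (g : KahlerMetric n X) (E : OModule n X) where
  dom : Opens X
  isBigOpen : IsBigOpen n dom
  locallyFree : LocallyFreeOn E dom
  metric : HermitianMetric E dom
  curvature_sq_integrable : ∃ f : X → ℝ,
    (∀ (x : X) (T : LocalFrame E dom x), f x = T.curvatureNormSq g metric) ∧
    IntegrableOn f dom g.vol
  mean_integrable : ∃ f : X → ℝ,
    (∀ (x : X) (T : LocalFrame E dom x),
      f x = endNorm (T.gramAt metric) (T.meanCurvature g metric)) ∧
    IntegrableOn f dom g.vol

/-- For every `ε > 0` there is an admissible structure with `sup_U |𝒦 - cI| < ε`, where `c` is the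
constant attached to the slope `μ`. -/
def HasApproxHYM (g : KahlerMetric n X) (E : HiggsModule n X) (μ : ℝ) : Prop :=
  ∀ ε : ℝ, 0 < ε → ∃ h : AdmissibleStructure g E.sheaf, ∃ δ < ε,
    ∀ (x : X) (T : LocalFrame E.sheaf h.dom x),
      endNorm (T.gramAt h.metric)
        (T.hitchinSimpsonMeanCurvature g h.metric E.field - ((hymConstant g μ : ℝ) : ℂ) • 1) ≤ δ

end degree

end HYM

end

/-! Away from an analytic subset of codimension at least two both sheaves carry metrics `h₁`, `h₂`
whose Hitchin–Simpson mean curvatures are uniformly close to `c₁ I` and `c₂ I`. The tensor product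
gets the metric `h₁ ⊗ h₂` and the Whitney sum gets `h₁ ⊕ h₂`, over the intersection of the two
domains; the complement is again analytic of codimension at least two (`IsBigOpen.inf`).

In a frame of products `s i ⊗ t j` the Gram matrix is a Kronecker product. Hence the Chern
connection, the curvature (`curvatureOf_kronecker`) and the Higgs components (`fieldAt_tensorField`)
all have the form `A ⊗ 1 + 1 ⊗ B`, and so has the bracket of the field with its adjoint, because the
mixed terms commute and cancel (`bracket_kronecker`). So the deviation of the mean curvature from
`(c₁ + c₂) I` is the deviation of `h₁` tensored with 1 plus 1 tensored with that of `h₂`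
(`deviationAt_tensorMetric`). Since `|A ⊗ 1 + 1 ⊗ B|² ≤ 2 r₂ |A|² + 2 r₁ |B|²`, it is as small as
desired; the same inequality dominates the curvature and the mean curvature and gives admissibility.
For the sum everything is block diagonal, with the same constant `c` in both blocks when the slopes
agree (`deviationAt_sumMetric`).

The constant attached to a slope is linear in the slope, so it remains to see that slopes add under
tensor product and that equal slopes persist in sums. This rests on `det (E ⊗ F) = (det E)^{r₂} ⊗
(det F)^{r₁}` and `det (E ⊕ F) = det E ⊗ det F`, built in `exists_detBundle_tensor` and
`exists_detBundle_sum`, together with the additivity of the curvature of line bundles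
(`HasMeanCurvature.tensor`).

Two points need care. First, the bounds are asserted in every local frame and every chart, so each
invariant must be shown independent of both. A holomorphic change of frame conjugates the curvature
(`curvatureOf_conj`), a change of chart acts on its indices by the Jacobian (`curvatureOf_comp`),
and the metric coefficients transform compatibly; the norms are then unchanged. Second, `E ⊗ F` is a
sheafification, so its sections are only locally sums of products. That products of frames are
frames (`isFrameOver_tensor`) comes from descending coordinate functions through `Pairing.lift`, and
the tensor metric is defined pointwise through such frames. -/

noncomputable section
namespace HYM

/-! ### Linear algebra of Hermitian forms -/

section linearAlgebra
open Matrix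
open scoped Kronecker

variable {ι κ : Type} [Fintype ι] [DecidableEq ι] [Fintype κ] [DecidableEq κ] {n : ℕ}

/-- The adjoint of `A` for the Hermitian form with Gram matrix `H`, over any finite index type. -/
def formAdjoint (H A : Matrix ι ι ℂ) : Matrix ι ι ℂ := Hᵀ⁻¹ * Aᴴ * Hᵀ

/-- The pairing `tr (A B^*)` of endomorphisms. -/
def endPair (H A B : Matrix ι ι ℂ) : ℂ := (A * formAdjoint H B).trace

/-- `endPair` of the coefficients of an endomorphism-valued form. -/
def formPair (H : Matrix ι ι ℂ) (a : Fin n → Fin n → Matrix ι ι ℂ) :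
    Matrix (Fin n × Fin n) (Fin n × Fin n) ℂ :=
  Matrix.of fun p q => endPair H (a p.1 p.2) (a q.1 q.2)

/-- `formNormSq` over any finite index type. -/
def formNormSqOf (G : Matrix (Fin n) (Fin n) ℂ) (H : Matrix ι ι ℂ)
    (a : Fin n → Fin n → Matrix ι ι ℂ) : ℝ :=
  ((G⁻¹ ⊗ₖ G⁻¹ᵀ) * formPair H a).trace.re

/-- `contractWith` over any finite index type. -/
def contraction (G : Matrix (Fin n) (Fin n) ℂ) (a : Fin n → Fin n → Matrix ι ι ℂ) :
    Matrix ι ι ℂ :=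
  ∑ j, ∑ k, G⁻¹ k j • a j k

/-- The coefficients of `[φ, φ^*]` for `φ = ∑ A_j dz^j`. -/
def bracket (H : Matrix ι ι ℂ) (A : Fin n → Matrix ι ι ℂ) (j k : Fin n) : Matrix ι ι ℂ :=
  A j * formAdjoint H (A k) - formAdjoint H (A k) * A j

/-- The four index sums are the trace of a product of two matrices indexed by pairs. In this form
positivity is that of the trace of a product of semidefinite matrices, and a change of coordinates
is a congruence. -/
theorem formNormSq_eq {r : ℕ} (G : Matrix (Fin n) (Fin n) ℂ) (H : Matrix (Fin r) (Fin r) ℂ)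
    (a : Fin n → Fin n → Matrix (Fin r) (Fin r) ℂ) :
    formNormSq G H a = formNormSqOf G H a := by
  have : ∀ j k l m, (G⁻¹ l j * G⁻¹ k m * (a j k * adjointMatrix H (a l m)).trace) =
      (G⁻¹ ⊗ₖ G⁻¹ᵀ) (l, m) (j, k) * formPair H a (j, k) (l, m) := fun j k l m => by
    simp only [kronecker_apply, transpose_apply, formPair, of_apply]
    rfl
  simp only [formNormSq, formNormSqOf, this]
  congr 1
  rw [Matrix.trace]
  simp only [diag_apply, mul_apply, Fintype.sum_prod_type]
  rw [Finset.sum_congr rfl fun j _ => Finset.sum_comm, Finset.sum_comm]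
  refine Finset.sum_congr rfl fun l _ => ?_
  rw [Finset.sum_congr rfl fun j _ => Finset.sum_congr rfl fun k _ => rfl]
  rw [Finset.sum_comm]
  rw [Finset.sum_congr rfl fun k _ => Finset.sum_comm]
  rw [Finset.sum_comm]
  exact Finset.sum_congr rfl fun m _ => Finset.sum_comm

theorem endNorm_eq {r : ℕ} (H A : Matrix (Fin r) (Fin r) ℂ) :
    endNorm H A = Real.sqrt (endPair H A A).re := rfl

theorem formAdjoint_add (H A B : Matrix ι ι ℂ) :
    formAdjoint H (A + B) = formAdjoint H A + formAdjoint H B := by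
  simp [formAdjoint, mul_add, add_mul]

theorem formAdjoint_smul (H : Matrix ι ι ℂ) (c : ℂ) (A : Matrix ι ι ℂ) :
    formAdjoint H (c • A) = star c • formAdjoint H A := by
  simp [formAdjoint]

theorem endPair_add_left (H A B C : Matrix ι ι ℂ) :
    endPair H (A + B) C = endPair H A C + endPair H B C := by
  simp [endPair, add_mul]

theorem endPair_add_right (H A B C : Matrix ι ι ℂ) :
    endPair H A (B + C) = endPair H A B + endPair H A C := by
  simp [endPair, formAdjoint_add, mul_add]

theorem endPair_smul_left (H : Matrix ι ι ℂ) (c : ℂ) (A B : Matrix ι ι ℂ) :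
    endPair H (c • A) B = c * endPair H A B := by
  simp [endPair]

theorem endPair_smul_right (H : Matrix ι ι ℂ) (c : ℂ) (A B : Matrix ι ι ℂ) :
    endPair H A (c • B) = star c * endPair H A B := by
  simp [endPair, formAdjoint_smul]

theorem endPair_sum_left {σ : Type} (s : Finset σ) (H : Matrix ι ι ℂ) (A : σ → Matrix ι ι ℂ)
    (B : Matrix ι ι ℂ) : endPair H (∑ i ∈ s, A i) B = ∑ i ∈ s, endPair H (A i) B := by
  simp [endPair, Finset.sum_mul, trace_sum]

theorem endPair_sum_right {σ : Type} (s : Finset σ) (H A : Matrix ι ι ℂ) (B : σ → Matrix ι ι ℂ) :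
    endPair H A (∑ i ∈ s, B i) = ∑ i ∈ s, endPair H A (B i) := by
  classical
  induction s using Finset.induction_on with
  | empty => simp [endPair, formAdjoint]
  | insert i s hi ih => rw [Finset.sum_insert hi, Finset.sum_insert hi, endPair_add_right, ih]

theorem endPair_star {H : Matrix ι ι ℂ} (hH : H.PosDef) (A B : Matrix ι ι ℂ) :
    star (endPair H A B) = endPair H B A := by
  have h1 : Hᵀᴴ = Hᵀ := hH.transpose.isHermitian
  have h2 : (Hᵀ⁻¹)ᴴ = Hᵀ⁻¹ := by rw [conjTranspose_nonsing_inv, h1]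
  rw [endPair, endPair, ← trace_conjTranspose]
  simp only [formAdjoint, conjTranspose_mul, conjTranspose_conjTranspose, h1, h2]
  have e : Hᵀ * (B * Hᵀ⁻¹) * Aᴴ = Hᵀ * (B * Hᵀ⁻¹ * Aᴴ) := by simp only [Matrix.mul_assoc]
  rw [e, trace_mul_comm]
  simp only [Matrix.mul_assoc]

-- Writing `A = C^* C`, the trace becomes that of `C B C^*`, which is positive semidefinite.
open scoped MatrixOrder in
theorem trace_mul_nonneg {A B : Matrix ι ι ℂ} (hA : A.PosSemidef) (hB : B.PosSemidef) :
    0 ≤ (A * B).trace := by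
  obtain ⟨C, rfl⟩ := CStarAlgebra.nonneg_iff_eq_star_mul_self.mp hA.nonneg
  rw [star_eq_conjTranspose, Matrix.mul_assoc, trace_mul_comm]
  exact (hB.mul_mul_conjTranspose_same C).trace_nonneg

theorem endPair_self_nonneg {H : Matrix ι ι ℂ} (hH : H.PosDef) (A : Matrix ι ι ℂ) :
    0 ≤ endPair H A A := by
  have : endPair H A A = (A * Hᵀ⁻¹ * Aᴴ * Hᵀ).trace := by
    simp only [endPair, formAdjoint, Matrix.mul_assoc]
  rw [this]
  exact trace_mul_nonneg (hH.transpose.posSemidef.inv.mul_mul_conjTranspose_same A)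
    hH.transpose.posSemidef

/-- This is a Gram matrix for the semidefinite form `endPair`: its quadratic form at `x` is the
squared norm of the combination of the coefficients with weights `star (x p)`. -/
theorem formPair_posSemidef {H : Matrix ι ι ℂ} (hH : H.PosDef)
    (a : Fin n → Fin n → Matrix ι ι ℂ) : (formPair H a).PosSemidef := by
  refine PosSemidef.of_dotProduct_mulVec_nonneg ?_ fun x => ?_
  · ext p q
    simp only [formPair, conjTranspose_apply, of_apply]
    exact endPair_star hH _ _
  · have : star x ⬝ᵥ (formPair H a *ᵥ x) =
        endPair H (∑ p, star (x p) • a p.1 p.2) (∑ p, star (x p) • a p.1 p.2) := by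
      simp only [endPair_sum_left, endPair_sum_right, endPair_smul_left, endPair_smul_right,
        dotProduct, mulVec, Finset.mul_sum, star_star, Pi.star_apply, formPair, of_apply]
      rw [Finset.sum_comm]
      refine Finset.sum_congr rfl fun p _ => Finset.sum_congr rfl fun q _ => ?_
      ring
    rw [this]
    exact endPair_self_nonneg hH _

theorem formNormSqOf_nonneg {G : Matrix (Fin n) (Fin n) ℂ} (hG : G.PosDef) {H : Matrix ι ι ℂ}
    (hH : H.PosDef) (a : Fin n → Fin n → Matrix ι ι ℂ) : 0 ≤ formNormSqOf G H a :=
  (Complex.le_def.1 (trace_mul_nonneg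
    (hG.posSemidef.inv.kronecker hG.posSemidef.inv.transpose) (formPair_posSemidef hH a))).1

/-- Parallelogram law, with the term `|A - B|² ≥ 0` dropped. -/
theorem endPair_add_le {H : Matrix ι ι ℂ} (hH : H.PosDef) (A B : Matrix ι ι ℂ) :
    (endPair H (A + B) (A + B)).re ≤ 2 * (endPair H A A).re + 2 * (endPair H B B).re := by
  have h := (Complex.le_def.1 (endPair_self_nonneg hH (A + (-1 : ℂ) • B))).1
  simp only [endPair_add_left, endPair_add_right, endPair_smul_left, endPair_smul_right,
    star_neg, star_one, Complex.zero_re, Complex.add_re, neg_mul, one_mul, Complex.neg_re] at h ⊢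
  linarith

/-- Again the parallelogram law, read off at the level of the pairing matrices. -/
theorem formNormSqOf_add_le {G : Matrix (Fin n) (Fin n) ℂ} (hG : G.PosDef) {H : Matrix ι ι ℂ}
    (hH : H.PosDef) (a b : Fin n → Fin n → Matrix ι ι ℂ) :
    formNormSqOf G H (fun j k => a j k + b j k) ≤
      2 * formNormSqOf G H a + 2 * formNormSqOf G H b := by
  have h := formNormSqOf_nonneg hG hH (fun j k => a j k + (-1 : ℂ) • b j k)
  have e : formPair H (fun j k => a j k + b j k) =
      (2 : ℂ) • formPair H a + (2 : ℂ) • formPair H b -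
        formPair H (fun j k => a j k + (-1 : ℂ) • b j k) := by
    ext p q
    simp only [formPair, of_apply, Matrix.add_apply, Matrix.sub_apply, Matrix.smul_apply, endPair_add_left,
      endPair_add_right, endPair_smul_left, endPair_smul_right, star_neg, star_one, smul_eq_mul]
    ring
  have e2 := congrArg (fun M => ((G⁻¹ ⊗ₖ G⁻¹ᵀ) * M).trace.re) e
  simp only [mul_sub, mul_add, trace_sub, trace_add, Complex.sub_re, Complex.add_re,
    trace_smul, smul_eq_mul, Complex.mul_re, Complex.re_ofNat, Complex.im_ofNat, zero_mul,
    sub_zero, Matrix.mul_smul] at e2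
  simp only [formNormSqOf] at h ⊢
  linarith

/-! ### Change of frame: `P` expresses the new frame in the old one, `Q` is its inverse. -/

section changeOfFrame
variable {P : Matrix ι κ ℂ} {Q : Matrix κ ι ℂ}

/-- The adjoint is intrinsic, so its matrix is conjugated like that of any endomorphism. Here `Pᴴᵀ`
is the entrywise conjugate of `P`. The two index types may differ, which lets frames indexed by
products or sums be compared with frames indexed by `Fin r`. -/
theorem formAdjoint_conj (hPQ : P * Q = 1) (hQP : Q * P = 1) {H : Matrix ι ι ℂ}
    (hH : IsUnit H.det) (A : Matrix ι ι ℂ) :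
    formAdjoint (Pᵀ * H * Pᴴᵀ) (Q * A * P) = Q * formAdjoint H A * P := by
  have hHt : IsUnit Hᵀ.det := by rwa [det_transpose]
  have hPQ' : Qᴴ * Pᴴ = 1 := by rw [← conjTranspose_mul, hPQ, conjTranspose_one]
  have hQP' : Pᴴ * Qᴴ = 1 := by rw [← conjTranspose_mul, hQP, conjTranspose_one]
  have e : (Pᵀ * H * Pᴴᵀ)ᵀ = Pᴴ * Hᵀ * P := by
    simp only [transpose_mul, transpose_transpose, Matrix.mul_assoc]
  have inv : (Pᴴ * Hᵀ * P)⁻¹ = Q * Hᵀ⁻¹ * Qᴴ := by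
    apply inv_eq_right_inv
    calc Pᴴ * Hᵀ * P * (Q * Hᵀ⁻¹ * Qᴴ) = Pᴴ * (Hᵀ * (P * Q) * Hᵀ⁻¹) * Qᴴ := by
          simp only [Matrix.mul_assoc]
      _ = 1 := by rw [hPQ, Matrix.mul_one, mul_nonsing_inv _ hHt, Matrix.mul_one, hQP']
  rw [formAdjoint, e, inv, formAdjoint]
  calc Q * Hᵀ⁻¹ * Qᴴ * (Q * A * P)ᴴ * (Pᴴ * Hᵀ * P)
      = Q * Hᵀ⁻¹ * (Qᴴ * Pᴴ) * Aᴴ * (Qᴴ * Pᴴ) * Hᵀ * P := by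
        simp only [conjTranspose_mul, Matrix.mul_assoc]
    _ = _ := by rw [hPQ']; simp only [Matrix.mul_one, Matrix.mul_assoc]

theorem conj_mul_conj (hPQ : P * Q = 1) (A B : Matrix ι ι ℂ) :
    Q * A * P * (Q * B * P) = Q * (A * B) * P := by
  calc Q * A * P * (Q * B * P) = Q * A * (P * Q) * B * P := by simp only [Matrix.mul_assoc]
    _ = _ := by rw [hPQ]; simp only [Matrix.mul_one, Matrix.mul_assoc]

theorem trace_conj (hPQ : P * Q = 1) (A : Matrix ι ι ℂ) : (Q * A * P).trace = A.trace := by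
  rw [trace_mul_comm, ← Matrix.mul_assoc, hPQ, Matrix.one_mul]

theorem endPair_conj (hPQ : P * Q = 1) (hQP : Q * P = 1) {H : Matrix ι ι ℂ}
    (hH : IsUnit H.det) (A B : Matrix ι ι ℂ) :
    endPair (Pᵀ * H * Pᴴᵀ) (Q * A * P) (Q * B * P) = endPair H A B := by
  rw [endPair, formAdjoint_conj hPQ hQP hH, conj_mul_conj hPQ, trace_conj hPQ, endPair]

theorem formNormSqOf_conj (hPQ : P * Q = 1) (hQP : Q * P = 1) {H : Matrix ι ι ℂ}
    (hH : IsUnit H.det) (G : Matrix (Fin n) (Fin n) ℂ) (a : Fin n → Fin n → Matrix ι ι ℂ) :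
    formNormSqOf G (Pᵀ * H * Pᴴᵀ) (fun j k => Q * a j k * P) = formNormSqOf G H a := by
  have : formPair (Pᵀ * H * Pᴴᵀ) (fun j k => Q * a j k * P) = formPair H a := by
    ext p q
    exact endPair_conj hPQ hQP hH _ _
  rw [formNormSqOf, this, formNormSqOf]

theorem contraction_conj (P : Matrix ι κ ℂ) (Q : Matrix κ ι ℂ) (G : Matrix (Fin n) (Fin n) ℂ)
    (a : Fin n → Fin n → Matrix ι ι ℂ) :
    contraction G (fun j k => Q * a j k * P) = Q * contraction G a * P := by
  simp [contraction, Matrix.mul_sum, Matrix.sum_mul]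

theorem bracket_conj (hPQ : P * Q = 1) (hQP : Q * P = 1) {H : Matrix ι ι ℂ}
    (hH : IsUnit H.det) (A : Fin n → Matrix ι ι ℂ) (j k : Fin n) :
    bracket (Pᵀ * H * Pᴴᵀ) (fun i => Q * A i * P) j k = Q * bracket H A j k * P := by
  rw [bracket, formAdjoint_conj hPQ hQP hH, conj_mul_conj hPQ, conj_mul_conj hPQ, bracket,
    Matrix.mul_sub, Matrix.sub_mul]

end changeOfFrame

/-- The coefficients of a form in new coordinates, where `J` is the Jacobian matrix. -/
def changeCoord {M : Type} [AddCommMonoid M] [Module ℂ M] (J : Matrix (Fin n) (Fin n) ℂ)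
    (a : Fin n → Fin n → M) (j k : Fin n) : M :=
  ∑ l, ∑ m, (J l j * star (J m k)) • a l m

/-- The inverse metric is contravariant: solving for the old inverse in terms of the new one is what
cancels the Jacobian factors in contractions. -/
theorem inv_changeCoord {J : Matrix (Fin n) (Fin n) ℂ} (hJ : IsUnit J.det)
    {G : Matrix (Fin n) (Fin n) ℂ} (hG : IsUnit G.det) :
    Jᴴᵀ * (Jᵀ * G * Jᴴᵀ)⁻¹ * Jᵀ = G⁻¹ := by
  have h1 : IsUnit Jᵀ.det := by rwa [det_transpose]
  have h2 : IsUnit Jᴴᵀ.det := by rw [det_transpose, det_conjTranspose]; exact hJ.star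
  rw [Matrix.mul_inv_rev, Matrix.mul_inv_rev]
  calc Jᴴᵀ * (Jᴴᵀ⁻¹ * (G⁻¹ * Jᵀ⁻¹)) * Jᵀ = (Jᴴᵀ * Jᴴᵀ⁻¹) * G⁻¹ * (Jᵀ⁻¹ * Jᵀ) := by
        simp only [Matrix.mul_assoc]
    _ = G⁻¹ := by rw [mul_nonsing_inv _ h2, nonsing_inv_mul _ h1, Matrix.one_mul, Matrix.mul_one]

theorem contraction_changeCoord {J : Matrix (Fin n) (Fin n) ℂ} (hJ : IsUnit J.det)
    {G : Matrix (Fin n) (Fin n) ℂ} (hG : IsUnit G.det) (a : Fin n → Fin n → Matrix ι ι ℂ) :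
    contraction (Jᵀ * G * Jᴴᵀ) (changeCoord J a) = contraction G a := by
  rw [contraction, contraction, ← inv_changeCoord hJ hG]
  set K := (Jᵀ * G * Jᴴᵀ)⁻¹
  simp only [changeCoord, Finset.smul_sum, smul_smul, mul_apply, Finset.sum_smul, Finset.sum_mul,
    transpose_apply, conjTranspose_apply]
  calc ∑ j, ∑ k, ∑ l, ∑ m, (K k j * (J l j * star (J m k))) • a l m
      = ∑ j, ∑ l, ∑ k, ∑ m, (K k j * (J l j * star (J m k))) • a l m :=
        Finset.sum_congr rfl fun j _ => Finset.sum_comm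
    _ = ∑ l, ∑ j, ∑ k, ∑ m, (K k j * (J l j * star (J m k))) • a l m := Finset.sum_comm
    _ = ∑ l, ∑ j, ∑ m, ∑ k, (K k j * (J l j * star (J m k))) • a l m :=
        Finset.sum_congr rfl fun l _ => Finset.sum_congr rfl fun j _ => Finset.sum_comm
    _ = ∑ l, ∑ m, ∑ j, ∑ k, (K k j * (J l j * star (J m k))) • a l m :=
        Finset.sum_congr rfl fun l _ => Finset.sum_comm
    _ = _ := by
        refine Finset.sum_congr rfl fun l _ => Finset.sum_congr rfl fun m _ =>
          Finset.sum_congr rfl fun j _ => Finset.sum_congr rfl fun k _ => ?_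
        congr 1
        ring

/-- On pairs of form indices the Jacobian acts as `J ⊗ J̄`, so the pairing matrix changes by a
congruence. Cycling the trace moves those factors onto `G⁻¹ ⊗ G⁻¹ᵀ`, where each tensor factor is
absorbed by `inv_changeCoord`. -/
theorem formNormSqOf_changeCoord {J : Matrix (Fin n) (Fin n) ℂ} (hJ : IsUnit J.det)
    {G : Matrix (Fin n) (Fin n) ℂ} (hG : IsUnit G.det) (H : Matrix ι ι ℂ)
    (a : Fin n → Fin n → Matrix ι ι ℂ) :
    formNormSqOf (Jᵀ * G * Jᴴᵀ) H (changeCoord J a) = formNormSqOf G H a := by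
  have e : formPair H (changeCoord J a) = (J ⊗ₖ Jᴴᵀ)ᵀ * formPair H a * (J ⊗ₖ Jᴴᵀ)ᴴᵀ := by
    ext p q
    have : ∀ p : Fin n × Fin n, changeCoord J a p.1 p.2 =
        ∑ s : Fin n × Fin n, (J ⊗ₖ Jᴴᵀ) s p • a s.1 s.2 := fun p => by
      simp only [changeCoord, Fintype.sum_prod_type]
      rfl
    simp only [formPair, of_apply, this, endPair_sum_left, endPair_sum_right, endPair_smul_left,
      endPair_smul_right, mul_apply, transpose_apply, conjTranspose_apply, Finset.sum_mul, Finset.mul_sum]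
    refine Finset.sum_congr rfl fun s _ => Finset.sum_congr rfl fun t _ => ?_
    ring
  rw [formNormSqOf, formNormSqOf, e]
  congr 1
  rw [← Matrix.mul_assoc, trace_mul_comm, ← Matrix.mul_assoc, ← Matrix.mul_assoc]
  congr 2
  have h1 : (J ⊗ₖ Jᴴᵀ)ᴴᵀ = Jᴴᵀ ⊗ₖ J := by
    ext p q
    simp
  have h2 : (J ⊗ₖ Jᴴᵀ)ᵀ = Jᵀ ⊗ₖ Jᴴ := by
    ext p q
    simp
  rw [h1, h2, ← mul_kronecker_mul, ← mul_kronecker_mul, inv_changeCoord hJ hG]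
  congr 1
  rw [← inv_changeCoord hJ hG]
  simp only [transpose_mul, transpose_transpose, Matrix.mul_assoc]

/-! ### Tensor products of Hermitian spaces -/

section kronecker
variable {H₁ : Matrix ι ι ℂ} {H₂ : Matrix κ κ ℂ}

theorem formAdjoint_kronecker (A : Matrix ι ι ℂ)
    (B : Matrix κ κ ℂ) :
    formAdjoint (H₁ ⊗ₖ H₂) (A ⊗ₖ B) = formAdjoint H₁ A ⊗ₖ formAdjoint H₂ B := by
  have e : (H₁ ⊗ₖ H₂)ᵀ = H₁ᵀ ⊗ₖ H₂ᵀ := rfl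
  rw [formAdjoint, e, Matrix.inv_kronecker, conjTranspose_kronecker, ← mul_kronecker_mul,
    ← mul_kronecker_mul]
  rfl

theorem formAdjoint_one (h₁ : IsUnit H₁.det) : formAdjoint H₁ 1 = 1 := by
  rw [formAdjoint, conjTranspose_one, Matrix.mul_one, nonsing_inv_mul]
  rwa [det_transpose]

/-- The factor is the trace of the identity on the other space; it is the source of the ranks in all
later tensor bounds. -/
theorem endPair_kronecker_one (h₁ : IsUnit H₁.det) (h₂ : IsUnit H₂.det) (A B : Matrix ι ι ℂ) :
    endPair (H₁ ⊗ₖ H₂) (A ⊗ₖ 1) (B ⊗ₖ 1) = Fintype.card κ * endPair H₁ A B := by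
  rw [endPair, formAdjoint_kronecker, formAdjoint_one h₂, ← mul_kronecker_mul,
    trace_kronecker, Matrix.one_mul, trace_one, mul_comm]
  rfl

theorem endPair_one_kronecker (h₁ : IsUnit H₁.det) (h₂ : IsUnit H₂.det) (A B : Matrix κ κ ℂ) :
    endPair (H₁ ⊗ₖ H₂) (1 ⊗ₖ A) (1 ⊗ₖ B) = Fintype.card ι * endPair H₂ A B := by
  rw [endPair, formAdjoint_kronecker, formAdjoint_one h₁, ← mul_kronecker_mul,
    trace_kronecker, Matrix.one_mul, trace_one]
  rfl

theorem formNormSqOf_kronecker_one (h₁ : IsUnit H₁.det) (h₂ : IsUnit H₂.det)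
    (G : Matrix (Fin n) (Fin n) ℂ) (a : Fin n → Fin n → Matrix ι ι ℂ) :
    formNormSqOf G (H₁ ⊗ₖ H₂) (fun j k => a j k ⊗ₖ (1 : Matrix κ κ ℂ)) =
      Fintype.card κ * formNormSqOf G H₁ a := by
  have : formPair (H₁ ⊗ₖ H₂) (fun j k => a j k ⊗ₖ (1 : Matrix κ κ ℂ)) =
      (Fintype.card κ : ℂ) • formPair H₁ a := by
    ext p q
    exact endPair_kronecker_one h₁ h₂ _ _
  rw [formNormSqOf, this, Matrix.mul_smul, trace_smul, formNormSqOf, smul_eq_mul]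
  simp

theorem formNormSqOf_one_kronecker (h₁ : IsUnit H₁.det) (h₂ : IsUnit H₂.det)
    (G : Matrix (Fin n) (Fin n) ℂ) (a : Fin n → Fin n → Matrix κ κ ℂ) :
    formNormSqOf G (H₁ ⊗ₖ H₂) (fun j k => (1 : Matrix ι ι ℂ) ⊗ₖ a j k) =
      Fintype.card ι * formNormSqOf G H₂ a := by
  have : formPair (H₁ ⊗ₖ H₂) (fun j k => (1 : Matrix ι ι ℂ) ⊗ₖ a j k) =
      (Fintype.card ι : ℂ) • formPair H₂ a := by
    ext p q
    exact endPair_one_kronecker h₁ h₂ _ _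
  rw [formNormSqOf, this, Matrix.mul_smul, trace_smul, formNormSqOf, smul_eq_mul]
  simp

theorem contraction_kronecker (G : Matrix (Fin n) (Fin n) ℂ) (a : Fin n → Fin n → Matrix ι ι ℂ)
    (b : Fin n → Fin n → Matrix κ κ ℂ) :
    contraction G (fun j k => a j k ⊗ₖ (1 : Matrix κ κ ℂ) + (1 : Matrix ι ι ℂ) ⊗ₖ b j k) =
      contraction G a ⊗ₖ (1 : Matrix κ κ ℂ) + (1 : Matrix ι ι ℂ) ⊗ₖ contraction G b := by
  ext ⟨p, p'⟩ ⟨q, q'⟩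
  simp only [contraction, Matrix.sum_apply, Matrix.smul_apply, Matrix.add_apply, kronecker_apply,
    smul_eq_mul, Finset.sum_mul, Finset.mul_sum]
  simp only [← Finset.sum_add_distrib]
  refine Finset.sum_congr rfl fun j _ => Finset.sum_congr rfl fun k _ => ?_
  ring

/-- Endomorphisms of the form `A ⊗ 1` and `1 ⊗ B` commute, so the mixed terms of the commutator
cancel. -/
theorem bracket_kronecker (h₁ : IsUnit H₁.det) (h₂ : IsUnit H₂.det) (A : Fin n → Matrix ι ι ℂ)
    (B : Fin n → Matrix κ κ ℂ) (j k : Fin n) :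
    bracket (H₁ ⊗ₖ H₂)
        (fun i => A i ⊗ₖ (1 : Matrix κ κ ℂ) + (1 : Matrix ι ι ℂ) ⊗ₖ B i) j k =
      bracket H₁ A j k ⊗ₖ (1 : Matrix κ κ ℂ) + (1 : Matrix ι ι ℂ) ⊗ₖ bracket H₂ B j k := by
  have hsub₁ : ∀ M N : Matrix ι ι ℂ,
      (M - N) ⊗ₖ (1 : Matrix κ κ ℂ) = M ⊗ₖ (1 : Matrix κ κ ℂ) - N ⊗ₖ (1 : Matrix κ κ ℂ) :=
    fun M N => by ext; simp [sub_mul]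
  have hsub₂ : ∀ M N : Matrix κ κ ℂ,
      (1 : Matrix ι ι ℂ) ⊗ₖ (M - N) = (1 : Matrix ι ι ℂ) ⊗ₖ M - (1 : Matrix ι ι ℂ) ⊗ₖ N :=
    fun M N => by ext; simp [mul_sub]
  simp only [bracket, formAdjoint_add, formAdjoint_kronecker, formAdjoint_one h₁,
    formAdjoint_one h₂, mul_add, add_mul, ← mul_kronecker_mul, Matrix.one_mul, Matrix.mul_one,
    hsub₁, hsub₂]
  abel

end kronecker

/-! ### Orthogonal sums of Hermitian spaces -/

section fromBlocks
variable {H₁ : Matrix ι ι ℂ} {H₂ : Matrix κ κ ℂ}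

theorem inv_fromBlocks_diagonal (h₁ : IsUnit H₁.det) (h₂ : IsUnit H₂.det) :
    (fromBlocks H₁ 0 0 H₂)⁻¹ = fromBlocks H₁⁻¹ 0 0 H₂⁻¹ := by
  apply inv_eq_right_inv
  rw [fromBlocks_multiply, mul_nonsing_inv _ h₁, mul_nonsing_inv _ h₂]
  simp

theorem formAdjoint_fromBlocks (h₁ : IsUnit H₁.det) (h₂ : IsUnit H₂.det) (A : Matrix ι ι ℂ)
    (B : Matrix κ κ ℂ) :
    formAdjoint (fromBlocks H₁ 0 0 H₂) (fromBlocks A 0 0 B) =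
      fromBlocks (formAdjoint H₁ A) 0 0 (formAdjoint H₂ B) := by
  have h₁' : IsUnit H₁ᵀ.det := by rwa [det_transpose]
  have h₂' : IsUnit H₂ᵀ.det := by rwa [det_transpose]
  rw [formAdjoint, fromBlocks_transpose, fromBlocks_conjTranspose, transpose_zero,
    transpose_zero, inv_fromBlocks_diagonal h₁' h₂']
  simp [fromBlocks_multiply, formAdjoint]

theorem endPair_fromBlocks (h₁ : IsUnit H₁.det) (h₂ : IsUnit H₂.det) (A A' : Matrix ι ι ℂ)
    (B B' : Matrix κ κ ℂ) :
    endPair (fromBlocks H₁ 0 0 H₂) (fromBlocks A 0 0 B) (fromBlocks A' 0 0 B') =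
      endPair H₁ A A' + endPair H₂ B B' := by
  rw [endPair, formAdjoint_fromBlocks h₁ h₂, fromBlocks_multiply]
  simp [Matrix.trace, endPair]

theorem formNormSqOf_fromBlocks (h₁ : IsUnit H₁.det) (h₂ : IsUnit H₂.det)
    (G : Matrix (Fin n) (Fin n) ℂ) (a : Fin n → Fin n → Matrix ι ι ℂ)
    (b : Fin n → Fin n → Matrix κ κ ℂ) :
    formNormSqOf G (fromBlocks H₁ 0 0 H₂) (fun j k => fromBlocks (a j k) 0 0 (b j k)) =
      formNormSqOf G H₁ a + formNormSqOf G H₂ b := by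
  have : formPair (fromBlocks H₁ 0 0 H₂) (fun j k => fromBlocks (a j k) 0 0 (b j k)) =
      formPair H₁ a + formPair H₂ b := by
    ext p q
    exact endPair_fromBlocks h₁ h₂ _ _ _ _
  rw [formNormSqOf, this, Matrix.mul_add, trace_add, Complex.add_re, formNormSqOf, formNormSqOf]

theorem contraction_fromBlocks (G : Matrix (Fin n) (Fin n) ℂ) (a : Fin n → Fin n → Matrix ι ι ℂ)
    (b : Fin n → Fin n → Matrix κ κ ℂ) :
    contraction G (fun j k => fromBlocks (a j k) 0 0 (b j k)) =
      fromBlocks (contraction G a) 0 0 (contraction G b) := by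
  ext (i | i) (j | j) <;> simp [contraction, Matrix.sum_apply]

theorem bracket_fromBlocks (h₁ : IsUnit H₁.det) (h₂ : IsUnit H₂.det) (A : Fin n → Matrix ι ι ℂ)
    (B : Fin n → Matrix κ κ ℂ) (j k : Fin n) :
    bracket (fromBlocks H₁ 0 0 H₂) (fun i => fromBlocks (A i) 0 0 (B i)) j k =
      fromBlocks (bracket H₁ A j k) 0 0 (bracket H₂ B j k) := by
  have hsub : ∀ (M N : Matrix ι ι ℂ) (M' N' : Matrix κ κ ℂ),
      fromBlocks M 0 0 M' - fromBlocks N 0 0 N' = fromBlocks (M - N) 0 0 (M' - N') :=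
    fun M N M' N' => by ext (i | i) (j | j) <;> simp
  simp [bracket, formAdjoint_fromBlocks h₁ h₂, fromBlocks_multiply, hsub]

/-- The Schur complement criterion gives semidefiniteness; the determinant, a product of two nonzero
ones, makes it definite. -/
theorem posDef_fromBlocks_diagonal (h₁ : H₁.PosDef) (h₂ : H₂.PosDef) :
    (fromBlocks H₁ 0 0 H₂).PosDef := by
  have hs : (fromBlocks H₁ 0 0 H₂).PosSemidef := by
    haveI : Invertible H₁ := h₁.isUnit.invertible
    have := (Matrix.PosDef.fromBlocks₁₁ (A := H₁) (0 : Matrix ι κ ℂ) H₂ h₁).2 (by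
      simpa using h₂.posSemidef)
    simpa using this
  rw [hs.posDef_iff_det_ne_zero, det_fromBlocks_zero₂₁]
  exact mul_ne_zero ((h₁.posSemidef.posDef_iff_det_ne_zero).1 h₁)
    ((h₂.posSemidef.posDef_iff_det_ne_zero).1 h₂)

end fromBlocks

theorem _root_.Matrix.PosDef.isUnit_det {H : Matrix ι ι ℂ} (h : H.PosDef) : IsUnit H.det :=
  (isUnit_iff_isUnit_det H).1 h.isUnit

end linearAlgebra

/-! ### Wirtinger calculus -/

section wirtinger
open Matrix Filter Topology
open scoped Kronecker

variable {n : ℕ} {f g : (Fin n → ℂ) → ℂ} {z : Fin n → ℂ}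

theorem dz_congr (j : Fin n) (h : f =ᶠ[𝓝 z] g) : dz j f z = dz j g z := by
  rw [dz, dz, h.fderiv_eq]

theorem dzbar_congr (j : Fin n) (h : f =ᶠ[𝓝 z] g) : dzbar j f z = dzbar j g z := by
  rw [dzbar, dzbar, h.fderiv_eq]

theorem _root_.ContDiffAt.differentiableAt_of_smooth {𝕜 E F : Type} [NontriviallyNormedField 𝕜]
    [NormedAddCommGroup E] [NormedSpace 𝕜 E] [NormedAddCommGroup F] [NormedSpace 𝕜 F] {f : E → F}
    {x : E} (h : ContDiffAt 𝕜 ∞ f x) : DifferentiableAt 𝕜 f x :=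
  h.differentiableAt (by simp)

theorem dzbar_add (j : Fin n) (hf : ContDiffAt ℝ ∞ f z) (hg : ContDiffAt ℝ ∞ g z) :
    dzbar j (fun w => f w + g w) z = dzbar j f z + dzbar j g z := by
  simp only [dzbar, fderiv_fun_add hf.differentiableAt_of_smooth hg.differentiableAt_of_smooth,
    ContinuousLinearMap.add_apply]
  ring

theorem dz_mul (j : Fin n) (hf : ContDiffAt ℝ ∞ f z) (hg : ContDiffAt ℝ ∞ g z) :
    dz j (fun w => f w * g w) z = dz j f z * g z + f z * dz j g z := by
  simp only [dz, fderiv_fun_mul hf.differentiableAt_of_smooth hg.differentiableAt_of_smooth,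
    ContinuousLinearMap.add_apply, ContinuousLinearMap.smul_apply, smul_eq_mul]
  ring

theorem dzbar_mul (j : Fin n) (hf : ContDiffAt ℝ ∞ f z) (hg : ContDiffAt ℝ ∞ g z) :
    dzbar j (fun w => f w * g w) z = dzbar j f z * g z + f z * dzbar j g z := by
  simp only [dzbar, fderiv_fun_mul hf.differentiableAt_of_smooth hg.differentiableAt_of_smooth,
    ContinuousLinearMap.add_apply, ContinuousLinearMap.smul_apply, smul_eq_mul]
  ring

theorem dz_const (j : Fin n) (c : ℂ) : dz j (fun _ => c) z = 0 := by
  simp [dz]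

theorem dzbar_const (j : Fin n) (c : ℂ) : dzbar j (fun _ => c) z = 0 := by
  simp [dzbar]

theorem dz_sum {σ : Type} (s : Finset σ) (j : Fin n) {F : σ → (Fin n → ℂ) → ℂ}
    (h : ∀ i ∈ s, ContDiffAt ℝ ∞ (F i) z) :
    dz j (fun w => ∑ i ∈ s, F i w) z = ∑ i ∈ s, dz j (F i) z := by
  simp only [dz, fderiv_fun_sum fun i hi => (h i hi).differentiableAt_of_smooth,
    ContinuousLinearMap.sum_apply, Finset.mul_sum, ← Finset.sum_sub_distrib]

theorem dzbar_sum {σ : Type} (s : Finset σ) (j : Fin n) {F : σ → (Fin n → ℂ) → ℂ}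
    (h : ∀ i ∈ s, ContDiffAt ℝ ∞ (F i) z) :
    dzbar j (fun w => ∑ i ∈ s, F i w) z = ∑ i ∈ s, dzbar j (F i) z := by
  simp only [dzbar, fderiv_fun_sum fun i hi => (h i hi).differentiableAt_of_smooth,
    ContinuousLinearMap.sum_apply, Finset.mul_sum, ← Finset.sum_add_distrib]

theorem contDiffAt_star (h : ContDiffAt ℝ ∞ f z) : ContDiffAt ℝ ∞ (fun w => star (f w)) z :=
  (Complex.conjCLE.contDiff.contDiffAt (x := f z)).comp z h

theorem dz_star (j : Fin n) (h : ContDiffAt ℝ ∞ f z) :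
    dz j (fun w => star (f w)) z = star (dzbar j f z) := by
  have : fderiv ℝ (fun w => star (f w)) z = (Complex.conjCLE : ℂ →L[ℝ] ℂ).comp (fderiv ℝ f z) :=
    ((Complex.conjCLE : ℂ →L[ℝ] ℂ).hasFDerivAt.comp z
      h.differentiableAt_of_smooth.hasFDerivAt).fderiv
  simp only [dz, dzbar, this]
  simp [Complex.conj_I]
  ring

theorem contDiffAt_dz (j : Fin n) (h : ContDiffAt ℝ ∞ f z) : ContDiffAt ℝ ∞ (dz j f) z := by
  have h1 : ContDiffAt ℝ ∞ (fderiv ℝ f) z := h.fderiv_right (by simp)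
  exact contDiffAt_const.mul ((h1.clm_apply contDiffAt_const).sub
    (contDiffAt_const.mul (h1.clm_apply contDiffAt_const)))

theorem contDiffAt_dzbar (j : Fin n) (h : ContDiffAt ℝ ∞ f z) : ContDiffAt ℝ ∞ (dzbar j f) z := by
  have h1 : ContDiffAt ℝ ∞ (fderiv ℝ f) z := h.fderiv_right (by simp)
  exact contDiffAt_const.mul ((h1.clm_apply contDiffAt_const).add
    (contDiffAt_const.mul (h1.clm_apply contDiffAt_const)))

theorem single_I (j : Fin n) :
    (Pi.single j Complex.I : Fin n → ℂ) = Complex.I • (Pi.single j 1 : Fin n → ℂ) := by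
  rw [← Pi.single_smul, smul_eq_mul, mul_one]

theorem fderiv_real_eq {E F : Type} [NormedAddCommGroup E] [NormedSpace ℂ E]
    [NormedAddCommGroup F] [NormedSpace ℂ F] {f : E → F} {z : E} (h : DifferentiableAt ℂ f z)
    (v : E) : fderiv ℝ f z v = fderiv ℂ f z v := by
  rw [h.fderiv_restrictScalars ℝ]
  rfl

theorem dzbar_eq_zero (j : Fin n) (h : DifferentiableAt ℂ f z) : dzbar j f z = 0 := by
  rw [dzbar, fderiv_real_eq h, fderiv_real_eq h, single_I, map_smul, smul_eq_mul, ← mul_assoc,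
    Complex.I_mul_I]
  ring

theorem dz_eq_fderiv (j : Fin n) (h : DifferentiableAt ℂ f z) :
    dz j f z = fderiv ℂ f z (Pi.single j 1) := by
  rw [dz, fderiv_real_eq h, fderiv_real_eq h, single_I, map_smul, smul_eq_mul, ← mul_assoc,
    Complex.I_mul_I]
  ring

/-- Order `∞` at a point provides a neighbourhood only for each finite order, so the order is first
lowered to one. -/
theorem eventually_contDiffAt {𝕜 E F : Type} [NontriviallyNormedField 𝕜]
    [NormedAddCommGroup E] [NormedSpace 𝕜 E] [NormedAddCommGroup F] [NormedSpace 𝕜 F]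
    {f : E → F} {z : E} (h : ContDiffAt 𝕜 ∞ f z) : ∀ᶠ w in 𝓝 z, DifferentiableAt 𝕜 f w := by
  have := (h.of_le (m := 1) (by exact_mod_cast le_top)).eventually (by simp)
  exact this.mono fun w hw => hw.differentiableAt (by simp)

/-- Near `z` the Wirtinger derivative of a holomorphic function is its complex partial derivative.
-/
theorem dz_holomorphic (j : Fin n) (h : ContDiffAt ℂ ∞ f z) : ContDiffAt ℂ ∞ (dz j f) z := by
  have h1 : ContDiffAt ℂ ∞ (fun w => fderiv ℂ f w (Pi.single j 1)) z :=
    (h.fderiv_right (by simp)).clm_apply contDiffAt_const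
  exact h1.congr_of_eventuallyEq ((eventually_contDiffAt h).mono fun w hw => dz_eq_fderiv j hw)

/-- A real linear map splits into a complex linear and a conjugate linear part. With `L` the real
derivative, the coefficients are the two Wirtinger derivatives, and the chain rule below follows. -/
theorem real_linear_eq (L : (Fin n → ℂ) →L[ℝ] ℂ) (u : Fin n → ℂ) :
    L u = ∑ l, ((1 / 2) * (L (Pi.single l 1) - Complex.I * L (Pi.single l Complex.I)) * u l +
      (1 / 2) * (L (Pi.single l 1) + Complex.I * L (Pi.single l Complex.I)) * star (u l)) := by
  have h : u = ∑ l, ((u l).re • (Pi.single l 1 : Fin n → ℂ) +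
      (u l).im • (Pi.single l Complex.I : Fin n → ℂ)) := by
    ext i
    simp only [Finset.sum_apply, Pi.add_apply, Pi.smul_apply]
    rw [Finset.sum_eq_single i]
    · simp [Complex.re_add_im]
    · intro b _ hb
      simp [Pi.single_eq_of_ne hb.symm]
    · simp
  conv_lhs => rw [h]
  rw [map_sum]
  refine Finset.sum_congr rfl fun l _ => ?_
  rw [map_add, map_smul, map_smul, Complex.real_smul, Complex.real_smul]
  have h1 : u l = (u l).re + (u l).im * Complex.I := (Complex.re_add_im _).symm
  have h2 : star (u l) = (u l).re - (u l).im * Complex.I := by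
    apply Complex.ext <;> simp
  rw [h2]
  conv_rhs => rw [h1]
  simp only [Complex.add_re, Complex.ofReal_re, Complex.mul_re, Complex.I_re, mul_zero,
    Complex.ofReal_im, Complex.I_im, mul_one, sub_self, add_zero, Complex.add_im,
    Complex.mul_im, zero_add]
  linear_combination (u l).im * L (Pi.single l Complex.I) * Complex.I_mul_I

/-- The Jacobian matrix `∂ψ_l/∂z_j`. -/
def jacobian (ψ : (Fin n → ℂ) → (Fin n → ℂ)) (z : Fin n → ℂ) : Matrix (Fin n) (Fin n) ℂ :=
  Matrix.of fun l j => fderiv ℂ ψ z (Pi.single j 1) l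

theorem fderiv_comp_apply_single {ψ : (Fin n → ℂ) → (Fin n → ℂ)} (hψ : DifferentiableAt ℂ ψ z)
    (hf : DifferentiableAt ℝ f (ψ z)) (j : Fin n) :
    fderiv ℝ (fun w => f (ψ w)) z (Pi.single j 1) =
        ∑ l, (dz l f (ψ z) * jacobian ψ z l j + dzbar l f (ψ z) * star (jacobian ψ z l j)) ∧
      fderiv ℝ (fun w => f (ψ w)) z (Pi.single j Complex.I) =
        ∑ l, (dz l f (ψ z) * (Complex.I * jacobian ψ z l j) +
          dzbar l f (ψ z) * star (Complex.I * jacobian ψ z l j)) := by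
  have h : ∀ v, fderiv ℝ (fun w => f (ψ w)) z v = fderiv ℝ f (ψ z) (fderiv ℂ ψ z v) := fun v => by
    rw [← fderiv_real_eq hψ]
    exact congrArg (fun L => L v) (fderiv_comp z hf (hψ.restrictScalars ℝ))
  refine ⟨?_, ?_⟩
  · rw [h, real_linear_eq]
    rfl
  · rw [h, real_linear_eq, single_I, map_smul]
    rfl

/-- Since `ψ` is holomorphic, the terms containing its `∂̄`-derivatives are absent; in `dzbar_comp`
the Jacobian enters conjugated. -/
theorem dz_comp {ψ : (Fin n → ℂ) → (Fin n → ℂ)} (hψ : DifferentiableAt ℂ ψ z)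
    (hf : DifferentiableAt ℝ f (ψ z)) (j : Fin n) :
    dz j (fun w => f (ψ w)) z = ∑ l, jacobian ψ z l j * dz l f (ψ z) := by
  obtain ⟨h1, h2⟩ := fderiv_comp_apply_single hψ hf j
  rw [dz, h1, h2, Finset.mul_sum, ← Finset.sum_sub_distrib, Finset.mul_sum]
  refine Finset.sum_congr rfl fun l _ => ?_
  rw [star_mul', Complex.star_def, Complex.conj_I]
  linear_combination (-(1 / 2) * dz l f (ψ z) * jacobian ψ z l j +
    (1 / 2) * dzbar l f (ψ z) * (starRingEnd ℂ) (jacobian ψ z l j)) * Complex.I_mul_I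

theorem dzbar_comp {ψ : (Fin n → ℂ) → (Fin n → ℂ)} (hψ : DifferentiableAt ℂ ψ z)
    (hf : DifferentiableAt ℝ f (ψ z)) (j : Fin n) :
    dzbar j (fun w => f (ψ w)) z = ∑ l, star (jacobian ψ z l j) * dzbar l f (ψ z) := by
  obtain ⟨h1, h2⟩ := fderiv_comp_apply_single hψ hf j
  rw [dzbar, h1, h2, Finset.mul_sum, ← Finset.sum_add_distrib, Finset.mul_sum]
  refine Finset.sum_congr rfl fun l _ => ?_
  rw [star_mul', Complex.star_def, Complex.conj_I]
  linear_combination ((1 / 2) * dz l f (ψ z) * jacobian ψ z l j -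
    (1 / 2) * dzbar l f (ψ z) * (starRingEnd ℂ) (jacobian ψ z l j)) * Complex.I_mul_I

/-! ### Matrix-valued functions -/

section matrixFunctions
variable {ι κ τ : Type}

/-- All entries are smooth at `z`. -/
def SmoothMatrixAt (M : (Fin n → ℂ) → Matrix ι κ ℂ) (z : Fin n → ℂ) : Prop :=
  ∀ a b, ContDiffAt ℝ ∞ (fun w => M w a b) z

/-- All entries are holomorphic at `z`. -/
def HolMatrixAt (M : (Fin n → ℂ) → Matrix ι κ ℂ) (z : Fin n → ℂ) : Prop :=
  ∀ a b, ContDiffAt ℂ ∞ (fun w => M w a b) z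

/-- The entrywise derivative `∂/∂z_j`. -/
def dzMatrix (j : Fin n) (M : (Fin n → ℂ) → Matrix ι κ ℂ) (z : Fin n → ℂ) : Matrix ι κ ℂ :=
  Matrix.of fun a b => dz j (fun w => M w a b) z

/-- The entrywise derivative `∂/∂z̄_j`. -/
def dzbarMatrix (j : Fin n) (M : (Fin n → ℂ) → Matrix ι κ ℂ) (z : Fin n → ℂ) : Matrix ι κ ℂ :=
  Matrix.of fun a b => dzbar j (fun w => M w a b) z

variable {M : (Fin n → ℂ) → Matrix ι κ ℂ} {N : (Fin n → ℂ) → Matrix κ τ ℂ}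

theorem HolMatrixAt.smooth (h : HolMatrixAt M z) : SmoothMatrixAt M z :=
  fun a b => (h a b).restrict_scalars ℝ

theorem SmoothMatrixAt.transpose (h : SmoothMatrixAt M z) : SmoothMatrixAt (fun w => (M w)ᵀ) z :=
  fun a b => h b a

theorem SmoothMatrixAt.conjTranspose (h : SmoothMatrixAt M z) :
    SmoothMatrixAt (fun w => (M w)ᴴ) z :=
  fun a b => contDiffAt_star (h b a)

theorem SmoothMatrixAt.mul [Fintype κ] (hM : SmoothMatrixAt M z) (hN : SmoothMatrixAt N z) :
    SmoothMatrixAt (fun w => M w * N w) z := fun a b => by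
  simp only [mul_apply]
  exact ContDiffAt.sum fun i _ => (hM a i).mul (hN i b)

theorem SmoothMatrixAt.kronecker {ι' κ' : Type} {M' : (Fin n → ℂ) → Matrix ι' κ' ℂ}
    (hM : SmoothMatrixAt M z) (hM' : SmoothMatrixAt M' z) :
    SmoothMatrixAt (fun w => M w ⊗ₖ M' w) z :=
  fun a b => (hM a.1 b.1).mul (hM' a.2 b.2)

theorem SmoothMatrixAt.const (C : Matrix ι κ ℂ) : SmoothMatrixAt (fun _ => C) z :=
  fun _ _ => contDiffAt_const

theorem HolMatrixAt.transpose (h : HolMatrixAt M z) : HolMatrixAt (fun w => (M w)ᵀ) z :=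
  fun a b => h b a

theorem HolMatrixAt.mul [Fintype κ] (hM : HolMatrixAt M z) (hN : HolMatrixAt N z) :
    HolMatrixAt (fun w => M w * N w) z := fun a b => by
  simp only [mul_apply]
  exact ContDiffAt.sum fun i _ => (hM a i).mul (hN i b)

theorem HolMatrixAt.dz (h : HolMatrixAt M z) (j : Fin n) : HolMatrixAt (dzMatrix j M) z :=
  fun a b => dz_holomorphic j (h a b)

theorem SmoothMatrixAt.dz (h : SmoothMatrixAt M z) (j : Fin n) : SmoothMatrixAt (dzMatrix j M) z :=
  fun a b => contDiffAt_dz j (h a b)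

theorem SmoothMatrixAt.dzbar (h : SmoothMatrixAt M z) (j : Fin n) :
    SmoothMatrixAt (dzbarMatrix j M) z :=
  fun a b => contDiffAt_dzbar j (h a b)

theorem HolMatrixAt.dzbar_eq_zero (h : HolMatrixAt M z) (j : Fin n) : dzbarMatrix j M z = 0 := by
  ext a b
  exact HYM.dzbar_eq_zero j (h a b).differentiableAt_of_smooth

theorem SmoothMatrixAt.det [Fintype ι] [DecidableEq ι] {H : (Fin n → ℂ) → Matrix ι ι ℂ}
    (h : SmoothMatrixAt H z) : ContDiffAt ℝ ∞ (fun w => (H w).det) z := by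
  simp only [det_apply]
  exact ContDiffAt.sum fun σ _ => (contDiffAt_prod fun i _ => h _ _).const_smul _

theorem SmoothMatrixAt.inv [Fintype ι] [DecidableEq ι] {H : (Fin n → ℂ) → Matrix ι ι ℂ}
    (h : SmoothMatrixAt H z) (hz : IsUnit (H z).det) : SmoothMatrixAt (fun w => (H w)⁻¹) z := by
  intro a b
  simp only [inv_def, Matrix.smul_apply, smul_eq_mul, Ring.inverse_eq_inv', adjugate_apply]
  refine (h.det.inv hz.ne_zero).mul (SmoothMatrixAt.det fun c d => ?_)
  simp only [updateRow_apply]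
  split_ifs
  · exact contDiffAt_const
  · exact h c d

theorem SmoothMatrixAt.congr {M' : (Fin n → ℂ) → Matrix ι κ ℂ} (h : SmoothMatrixAt M z)
    (e : M' =ᶠ[𝓝 z] M) : SmoothMatrixAt M' z :=
  fun a b => (h a b).congr_of_eventuallyEq (e.mono fun w hw => congrFun (congrFun hw a) b)

theorem dzMatrix_congr {M' : (Fin n → ℂ) → Matrix ι κ ℂ} (j : Fin n) (e : M =ᶠ[𝓝 z] M') :
    dzMatrix j M z = dzMatrix j M' z := by
  ext a b
  exact dz_congr j (e.mono fun w hw => congrFun (congrFun hw a) b)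

theorem dzbarMatrix_congr {M' : (Fin n → ℂ) → Matrix ι κ ℂ} (j : Fin n) (e : M =ᶠ[𝓝 z] M') :
    dzbarMatrix j M z = dzbarMatrix j M' z := by
  ext a b
  exact dzbar_congr j (e.mono fun w hw => congrFun (congrFun hw a) b)

theorem dzMatrix_mul [Fintype κ] (j : Fin n) (hM : SmoothMatrixAt M z) (hN : SmoothMatrixAt N z) :
    dzMatrix j (fun w => M w * N w) z = dzMatrix j M z * N z + M z * dzMatrix j N z := by
  ext a b
  simp only [dzMatrix, Matrix.add_apply, mul_apply, of_apply]
  rw [dz_sum _ _ fun i _ => (hM a i).mul (hN i b), ← Finset.sum_add_distrib]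
  exact Finset.sum_congr rfl fun i _ => dz_mul j (hM a i) (hN i b)

theorem dzbarMatrix_mul [Fintype κ] (j : Fin n) (hM : SmoothMatrixAt M z)
    (hN : SmoothMatrixAt N z) :
    dzbarMatrix j (fun w => M w * N w) z = dzbarMatrix j M z * N z + M z * dzbarMatrix j N z := by
  ext a b
  simp only [dzbarMatrix, Matrix.add_apply, mul_apply, of_apply]
  rw [dzbar_sum _ _ fun i _ => (hM a i).mul (hN i b), ← Finset.sum_add_distrib]
  exact Finset.sum_congr rfl fun i _ => dzbar_mul j (hM a i) (hN i b)

theorem dzbarMatrix_add {M' : (Fin n → ℂ) → Matrix ι κ ℂ} (j : Fin n) (hM : SmoothMatrixAt M z)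
    (hM' : SmoothMatrixAt M' z) :
    dzbarMatrix j (fun w => M w + M' w) z = dzbarMatrix j M z + dzbarMatrix j M' z := by
  ext a b
  exact dzbar_add j (hM a b) (hM' a b)

/-- The entrywise conjugate of a holomorphic matrix is antiholomorphic. -/
theorem dzMatrix_conjTranspose (j : Fin n) (hM : HolMatrixAt M z) :
    dzMatrix j (fun w => (M w)ᴴᵀ) z = 0 := by
  ext a b
  exact (dz_star j (hM.smooth a b)).trans (by
    rw [dzbar_eq_zero j (hM a b).differentiableAt_of_smooth, star_zero]
    rfl)

end matrixFunctions

/-! ### Curvature -/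

section curvature
variable {ι κ : Type} [Fintype ι] [DecidableEq ι] [Fintype κ] [DecidableEq κ]

/-- The connection matrix `∂_j H · H⁻¹`. -/
def connection (H : (Fin n → ℂ) → Matrix ι ι ℂ) (j : Fin n) (z : Fin n → ℂ) : Matrix ι ι ℂ :=
  dzMatrix j H z * (H z)⁻¹

/-- `chernCurvature` over any finite index type. -/
def curvatureOf (H : (Fin n → ℂ) → Matrix ι ι ℂ) (j k : Fin n) (z : Fin n → ℂ) : Matrix ι ι ℂ :=
  -(dzbarMatrix k (connection H j) z)ᵀ

variable {H : (Fin n → ℂ) → Matrix ι ι ℂ}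

theorem SmoothMatrixAt.connection (h : SmoothMatrixAt H z) (hz : IsUnit (H z).det) (j : Fin n) :
    SmoothMatrixAt (connection H j) z :=
  (h.dz j).mul (h.inv hz)

theorem SmoothMatrixAt.curvatureOf (h : SmoothMatrixAt H z) (hz : IsUnit (H z).det)
    (j k : Fin n) : SmoothMatrixAt (curvatureOf H j k) z :=
  fun a b => (((h.connection hz j).dzbar k).transpose a b).neg

theorem curvatureOf_congr {H' : (Fin n → ℂ) → Matrix ι ι ℂ} (e : H =ᶠ[𝓝 z] H') (j k : Fin n) :
    curvatureOf H j k z = curvatureOf H' j k z := by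
  rw [curvatureOf, curvatureOf, dzbarMatrix_congr]
  filter_upwards [e.eventually_nhds] with w hw
  rw [connection, connection, dzMatrix_congr j hw, hw.self_of_nhds]

/-- Under a holomorphic change of frame the connection acquires an inhomogeneous term `∂Pᵀ · Qᵀ`,
which is holomorphic and hence killed by `∂̄`; what remains is conjugation. The hypotheses are
required near `z` because the formula for the connection gets differentiated once more. -/
theorem curvatureOf_conj {P : (Fin n → ℂ) → Matrix ι κ ℂ} {Q : (Fin n → ℂ) → Matrix κ ι ℂ}
    (hP : ∀ᶠ w in 𝓝 z, HolMatrixAt P w) (hQ : HolMatrixAt Q z)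
    (hPQ : ∀ᶠ w in 𝓝 z, P w * Q w = 1) (hQP : ∀ᶠ w in 𝓝 z, Q w * P w = 1)
    (hH : ∀ᶠ w in 𝓝 z, SmoothMatrixAt H w) (hu : ∀ᶠ w in 𝓝 z, IsUnit (H w).det) (j k : Fin n) :
    curvatureOf (fun w => (P w)ᵀ * H w * (P w)ᴴᵀ) j k z = Q z * curvatureOf H j k z * P z := by
  -- The gauge transformation law of the connection; the derivative does not see the antiholomorphic
  -- right factor.
  have e : connection (fun w => (P w)ᵀ * H w * (P w)ᴴᵀ) j =ᶠ[𝓝 z]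
      fun w => (dzMatrix j P w)ᵀ * (Q w)ᵀ + (P w)ᵀ * connection H j w * (Q w)ᵀ := by
    filter_upwards [hP, hPQ, hQP, hH, hu] with w hP hPQ hQP hH hu
    have h1 : (P w)ᴴᵀ * (Q w)ᴴᵀ = 1 := by
      rw [← transpose_mul, ← conjTranspose_mul, hPQ]
      simp
    have h2 : (Q w)ᵀ * (P w)ᵀ = 1 := by rw [← transpose_mul, hPQ, transpose_one]
    have h3 : (P w)ᵀ * (Q w)ᵀ = 1 := by rw [← transpose_mul, hQP, transpose_one]
    have inv : ((P w)ᵀ * H w * (P w)ᴴᵀ)⁻¹ = (Q w)ᴴᵀ * (H w)⁻¹ * (Q w)ᵀ := by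
      apply inv_eq_right_inv
      calc (P w)ᵀ * H w * (P w)ᴴᵀ * ((Q w)ᴴᵀ * (H w)⁻¹ * (Q w)ᵀ)
          = (P w)ᵀ * (H w * ((P w)ᴴᵀ * (Q w)ᴴᵀ) * (H w)⁻¹) * (Q w)ᵀ := by
            simp only [Matrix.mul_assoc]
        _ = 1 := by rw [h1, Matrix.mul_one, mul_nonsing_inv _ hu, Matrix.mul_one, h3]
    have d : dzMatrix j (fun w => (P w)ᵀ * H w * (P w)ᴴᵀ) w =
        ((dzMatrix j P w)ᵀ * H w + (P w)ᵀ * dzMatrix j H w) * (P w)ᴴᵀ := by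
      rw [dzMatrix_mul j (hP.smooth.transpose.mul hH) hP.smooth.conjTranspose.transpose,
        dzMatrix_mul j hP.smooth.transpose hH, dzMatrix_conjTranspose j hP, Matrix.mul_zero,
        add_zero]
      rfl
    rw [connection, d, inv, connection]
    calc ((dzMatrix j P w)ᵀ * H w + (P w)ᵀ * dzMatrix j H w) * (P w)ᴴᵀ *
          ((Q w)ᴴᵀ * (H w)⁻¹ * (Q w)ᵀ)
        = ((dzMatrix j P w)ᵀ * H w + (P w)ᵀ * dzMatrix j H w) * ((P w)ᴴᵀ * (Q w)ᴴᵀ) *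
          (H w)⁻¹ * (Q w)ᵀ := by simp only [Matrix.mul_assoc]
      _ = (dzMatrix j P w)ᵀ * (H w * (H w)⁻¹) * (Q w)ᵀ +
          (P w)ᵀ * dzMatrix j H w * (H w)⁻¹ * (Q w)ᵀ := by
          rw [h1, Matrix.mul_one]
          simp only [Matrix.add_mul, Matrix.mul_assoc]
      _ = _ := by
          rw [mul_nonsing_inv _ hu, Matrix.mul_one]
          simp only [Matrix.mul_assoc]
  have hPz := hP.self_of_nhds
  have hθ := hH.self_of_nhds.connection hu.self_of_nhds j
  have hA : HolMatrixAt (fun w => (dzMatrix j P w)ᵀ * (Q w)ᵀ) z :=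
    (hPz.dz j).transpose.mul hQ.transpose
  rw [curvatureOf, dzbarMatrix_congr k e, dzbarMatrix_add k hA.smooth
    ((hPz.smooth.transpose.mul hθ).mul hQ.smooth.transpose), hA.dzbar_eq_zero,
    dzbarMatrix_mul k (hPz.smooth.transpose.mul hθ) hQ.smooth.transpose,
    hQ.transpose.dzbar_eq_zero, dzbarMatrix_mul k hPz.smooth.transpose hθ,
    hPz.transpose.dzbar_eq_zero, curvatureOf]
  simp only [Matrix.zero_mul, Matrix.mul_zero, zero_add, add_zero, transpose_mul,
    transpose_transpose, Matrix.mul_neg, Matrix.neg_mul, Matrix.mul_assoc]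

/-- The connection pulls back with a factor of the Jacobian. That factor is holomorphic, so `∂̄`
acts only on the connection and contributes one conjugate Jacobian. -/
theorem curvatureOf_comp {ψ : (Fin n → ℂ) → (Fin n → ℂ)} (hψ : ContDiffAt ℂ ∞ ψ z)
    (hH : ∀ᶠ w in 𝓝 (ψ z), SmoothMatrixAt H w) (hu : IsUnit (H (ψ z)).det) (j k : Fin n) :
    curvatureOf (fun w => H (ψ w)) j k z =
      changeCoord (jacobian ψ z) (fun l m => curvatureOf H l m (ψ z)) j k := by
  have hd := eventually_contDiffAt hψ
  have hJ : ∀ l j, ContDiffAt ℂ ∞ (fun w => jacobian ψ w l j) z := fun l j =>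
    contDiffAt_pi.1 ((hψ.fderiv_right (m := ∞) (by simp)).clm_apply contDiffAt_const) l
  have hc : ∀ l a b, ContDiffAt ℝ ∞ (fun w => connection H l (ψ w) a b) z := fun l a b =>
    ContDiffAt.comp z (g := fun w => connection H l w a b)
      (hH.self_of_nhds.connection hu l a b) (hψ.restrict_scalars ℝ)
  ext a b
  have e : (fun w => connection (fun w => H (ψ w)) j w b a) =ᶠ[𝓝 z]
      fun w => ∑ l, jacobian ψ w l j * connection H l (ψ w) b a := by
    filter_upwards [hd, hψ.continuousAt.eventually hH] with w hw hHw
    simp only [connection, mul_apply, Finset.mul_sum]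
    rw [Finset.sum_comm]
    refine Finset.sum_congr rfl fun c _ => ?_
    simp only [dzMatrix, of_apply]
    rw [dz_comp (f := fun u => H u b c) hw (hHw b c).differentiableAt_of_smooth, Finset.sum_mul]
    exact Finset.sum_congr rfl fun l _ => by ring
  simp only [curvatureOf, Matrix.neg_apply, transpose_apply, dzbarMatrix, of_apply, changeCoord,
    Matrix.sum_apply, Matrix.smul_apply]
  rw [dzbar_congr k e, dzbar_sum _ _ fun l _ => ((hJ l j).restrict_scalars ℝ).mul (hc l b a),
    ← Finset.sum_neg_distrib]
  refine Finset.sum_congr rfl fun l _ => ?_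
  rw [dzbar_mul k ((hJ l j).restrict_scalars ℝ) (hc l b a),
    dzbar_eq_zero k (hJ l j).differentiableAt_of_smooth, zero_mul, zero_add,
    dzbar_comp (f := fun w => connection H l w b a) hd.self_of_nhds
      (hH.self_of_nhds.connection hu l b a).differentiableAt_of_smooth, Finset.mul_sum,
    ← Finset.sum_neg_distrib]
  refine Finset.sum_congr rfl fun m _ => ?_
  rw [smul_eq_mul]
  ring

variable {K : (Fin n → ℂ) → Matrix κ κ ℂ}

/-- By the Leibniz rule the connection of `H ⊗ K` is `θ_H ⊗ 1 + 1 ⊗ θ_K`, and `∂̄` acts on each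
summand separately since the identity matrices are constant. -/
theorem curvatureOf_kronecker (hH : ∀ᶠ w in 𝓝 z, SmoothMatrixAt H w)
    (hK : ∀ᶠ w in 𝓝 z, SmoothMatrixAt K w) (hHu : ∀ᶠ w in 𝓝 z, IsUnit (H w).det)
    (hKu : ∀ᶠ w in 𝓝 z, IsUnit (K w).det) (j k : Fin n) :
    curvatureOf (fun w => H w ⊗ₖ K w) j k z =
      curvatureOf H j k z ⊗ₖ (1 : Matrix κ κ ℂ) + (1 : Matrix ι ι ℂ) ⊗ₖ curvatureOf K j k z := by
  have e : connection (fun w => H w ⊗ₖ K w) j =ᶠ[𝓝 z] fun w =>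
      connection H j w ⊗ₖ (1 : Matrix κ κ ℂ) + (1 : Matrix ι ι ℂ) ⊗ₖ connection K j w := by
    filter_upwards [hH, hK, hHu, hKu] with w hH hK hHu hKu
    have d : dzMatrix j (fun w => H w ⊗ₖ K w) w = dzMatrix j H w ⊗ₖ K w + H w ⊗ₖ dzMatrix j K w := by
      ext a b
      exact dz_mul j (hH a.1 b.1) (hK a.2 b.2)
    rw [connection, d, Matrix.inv_kronecker, add_mul, ← mul_kronecker_mul, ← mul_kronecker_mul,
      mul_nonsing_inv _ hHu, mul_nonsing_inv _ hKu, connection, connection]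
  have h1 := hH.self_of_nhds.connection hHu.self_of_nhds j
  have h2 := hK.self_of_nhds.connection hKu.self_of_nhds j
  rw [curvatureOf, dzbarMatrix_congr k e, dzbarMatrix_add k (h1.kronecker (.const _))
    ((SmoothMatrixAt.const _).kronecker h2)]
  ext ⟨a, a'⟩ ⟨b, b'⟩
  have e1 : dzbarMatrix k (fun w => connection H j w ⊗ₖ (1 : Matrix κ κ ℂ)) z (b, b') (a, a') =
      dzbarMatrix k (connection H j) z b a * (1 : Matrix κ κ ℂ) b' a' := by
    refine (dzbar_mul k (h1 b a) contDiffAt_const).trans ?_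
    rw [dzbar_const, mul_zero, add_zero]
    rfl
  have e2 : dzbarMatrix k (fun w => (1 : Matrix ι ι ℂ) ⊗ₖ connection K j w) z (b, b') (a, a') =
      (1 : Matrix ι ι ℂ) b a * dzbarMatrix k (connection K j) z b' a' := by
    refine (dzbar_mul k contDiffAt_const (h2 b' a')).trans ?_
    rw [dzbar_const, zero_mul, zero_add]
    rfl
  simp only [Matrix.neg_apply, transpose_apply, Matrix.add_apply, e1, e2, curvatureOf,
    kronecker_apply, one_apply, eq_comm (a := b), eq_comm (a := b')]
  ring

/-- Differentiation is entrywise and the off-diagonal blocks are constant, so no smoothness is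
required here. -/
theorem curvatureOf_fromBlocks (hHu : ∀ᶠ w in 𝓝 z, IsUnit (H w).det)
    (hKu : ∀ᶠ w in 𝓝 z, IsUnit (K w).det) (j k : Fin n) :
    curvatureOf (fun w => fromBlocks (H w) 0 0 (K w)) j k z =
      fromBlocks (curvatureOf H j k z) 0 0 (curvatureOf K j k z) := by
  have e : connection (fun w => fromBlocks (H w) 0 0 (K w)) j =ᶠ[𝓝 z] fun w =>
      fromBlocks (connection H j w) 0 0 (connection K j w) := by
    filter_upwards [hHu, hKu] with w hHu hKu
    have d : dzMatrix j (fun w => fromBlocks (H w) 0 0 (K w)) w =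
        fromBlocks (dzMatrix j H w) 0 0 (dzMatrix j K w) := by
      ext (a | a) (b | b)
      · rfl
      · exact dz_const j 0
      · exact dz_const j 0
      · rfl
    rw [connection, d, inv_fromBlocks_diagonal hHu hKu, fromBlocks_multiply]
    simp [connection]
  rw [curvatureOf, dzbarMatrix_congr k e]
  ext (a | a) (b | b)
  · rfl
  · exact neg_eq_zero.2 (dzbar_const k 0)
  · exact neg_eq_zero.2 (dzbar_const k 0)
  · rfl

end curvature

/-! ### Smoothness of the curvature invariants in coordinates -/

section continuity
variable {ι : Type} [Fintype ι] [DecidableEq ι] {G : (Fin n → ℂ) → Matrix (Fin n) (Fin n) ℂ}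
  {H : (Fin n → ℂ) → Matrix ι ι ℂ}

theorem SmoothMatrixAt.trace {A : (Fin n → ℂ) → Matrix ι ι ℂ} (h : SmoothMatrixAt A z) :
    ContDiffAt ℝ ∞ (fun w => (A w).trace) z :=
  ContDiffAt.sum fun i _ => h i i

theorem contDiffAt_endPair (hH : SmoothMatrixAt H z) (hu : IsUnit (H z).det)
    {A B : (Fin n → ℂ) → Matrix ι ι ℂ} (hA : SmoothMatrixAt A z) (hB : SmoothMatrixAt B z) :
    ContDiffAt ℝ ∞ (fun w => endPair (H w) (A w) (B w)) z :=
  (hA.mul (((hH.transpose.inv (by rwa [det_transpose])).mul hB.conjTranspose).mul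
    hH.transpose)).trace

theorem contDiffAt_formNormSqOf (hG : SmoothMatrixAt G z) (hGu : IsUnit (G z).det)
    (hH : SmoothMatrixAt H z) (hu : IsUnit (H z).det)
    {a : Fin n → Fin n → (Fin n → ℂ) → Matrix ι ι ℂ} (ha : ∀ j k, SmoothMatrixAt (a j k) z) :
    ContDiffAt ℝ ∞ (fun w => formNormSqOf (G w) (H w) fun j k => a j k w) z := by
  have h1 : SmoothMatrixAt (fun w => (G w)⁻¹ ⊗ₖ ((G w)⁻¹)ᵀ) z :=
    (hG.inv hGu).kronecker (hG.inv hGu).transpose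
  have h2 : SmoothMatrixAt (fun w => formPair (H w) fun j k => a j k w) z :=
    fun p q => contDiffAt_endPair hH hu (ha p.1 p.2) (ha q.1 q.2)
  have h3 := (h1.mul h2).trace
  have h4 : ContDiffAt ℝ ∞ (fun c : ℂ => c.re)
      (((G z)⁻¹ ⊗ₖ ((G z)⁻¹)ᵀ) * formPair (H z) fun j k => a j k z).trace :=
    Complex.reCLM.contDiff.contDiffAt
  exact ContDiffAt.comp z h4 h3

theorem smoothMatrixAt_contraction (hG : SmoothMatrixAt G z) (hGu : IsUnit (G z).det)
    {a : Fin n → Fin n → (Fin n → ℂ) → Matrix ι ι ℂ} (ha : ∀ j k, SmoothMatrixAt (a j k) z) :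
    SmoothMatrixAt (fun w => contraction (G w) fun j k => a j k w) z := fun p q => by
  simp only [contraction, Matrix.sum_apply, Matrix.smul_apply]
  exact ContDiffAt.sum fun j _ => ContDiffAt.sum fun k _ => (hG.inv hGu k j).smul (ha j k p q)

end continuity

end wirtinger

/-! ### Frames over arbitrary finite index types -/

section frames
variable {n : ℕ} {X : Type} [TopologicalSpace X] [ChartedSpace (Fin n → ℂ) X]

/-- The value at a point as a ring homomorphism. -/
def Hol.evalHom {V : Opens X} (x : X) (hx : x ∈ V) : Hol n V →+* ℂ where
  toFun f := f.eval x hx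
  map_one' := rfl
  map_mul' _ _ := rfl
  map_zero' := rfl
  map_add' _ _ := rfl

theorem Hol.evalHom_apply {V : Opens X} (x : X) (hx : x ∈ V) (f : Hol n V) :
    Hol.evalHom x hx f = f.eval x hx := rfl

/-- Restriction as a ring homomorphism. -/
def Hol.resHom {V W : Opens X} (h : W ≤ V) : Hol n V →+* Hol n W where
  toFun f := f.res h
  map_one' := rfl
  map_mul' _ _ := rfl
  map_zero' := rfl
  map_add' _ _ := rfl

theorem Hol.eval_res {V W : Opens X} (h : W ≤ V) (f : Hol n V) (x : X) (hx : x ∈ W) :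
    (f.res h).eval x hx = f.eval x (h hx) := rfl

theorem Hol.nontrivial {V : Opens X} {x : X} (hx : x ∈ V) : Nontrivial (Hol n V) :=
  (Hol.evalHom (n := n) x hx).domain_nontrivial

/-- Restriction of sections as an additive homomorphism. -/
def resHom (E : OModule n X) {V W : Opens X} (h : W ≤ V) : Sec E V →+ Sec E W :=
  AddMonoidHom.mk' (res E h) (res_add E h)

theorem res_sum_smul {ι : Type} [Fintype ι] (E : OModule n X) {V W : Opens X} (h : W ≤ V)
    (a : ι → Hol n V) (s : ι → Sec E V) :
    res E h (∑ i, a i • s i) = ∑ i, (a i).res h • res E h (s i) :=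
  (map_sum (resHom E h) _ _).trans (Finset.sum_congr rfl fun i _ => res_smul E h (a i) (s i))

/-- `IsFrame` over any finite index type. -/
def IsFrameOver (E : OModule n X) {ι : Type} [Fintype ι] {V : Opens X} (s : ι → Sec E V) : Prop :=
  ∀ (W : Opens X) (h : W ≤ V) (t : Sec E W), ∃! a : ι → Hol n W, t = ∑ i, a i • res E h (s i)

theorem isFrame_iff {E : OModule n X} {r : ℕ} {V : Opens X} {s : Fin r → Sec E V} :
    IsFrame E s ↔ IsFrameOver E s := Iff.rfl

namespace IsFrameOver
variable {E F : OModule n X} {ι κ : Type} [Fintype ι] [Fintype κ] {V W : Opens X}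
  {s : ι → Sec E V} {t : κ → Sec F V}

theorem res (hs : IsFrameOver E s) (h : W ≤ V) : IsFrameOver E fun i => HYM.res E h (s i) := by
  intro W' h' t
  simpa only [res_res] using hs W' (h'.trans h) t

theorem reindex (hs : IsFrameOver E s) (e : κ ≃ ι) : IsFrameOver E (s ∘ e) := by
  intro W h t
  obtain ⟨a, ha, hu⟩ := hs W h t
  refine ⟨a ∘ e, ha.trans (e.sum_comp fun i => a i • HYM.res E h (s i)).symm, fun b hb => ?_⟩
  have := hu (b ∘ e.symm) (hb.trans (by
    rw [← e.sum_comp]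
    simp))
  rw [← this]
  ext i
  simp

/-- The basis of the module of sections defined by a frame. -/
def basis (hs : IsFrameOver E s) : Module.Basis ι (Hol n V) (Sec E V) :=
  Module.Basis.mk (v := s)
    (Fintype.linearIndependent_iff.2 fun a ha => by
      have h0 := (hs V le_rfl 0).unique (y₁ := a) (y₂ := 0)
        (by simpa only [res_self] using ha.symm) (by simp)
      exact congrFun h0)
    (fun t _ => by
      obtain ⟨a, ha, -⟩ := hs V le_rfl t
      simp only [res_self] at ha
      rw [ha]
      exact Submodule.sum_mem _ fun i _ =>
        Submodule.smul_mem _ _ (Submodule.subset_span ⟨i, rfl⟩))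

theorem basis_apply (hs : IsFrameOver E s) (i : ι) : hs.basis i = s i :=
  Module.Basis.mk_apply _ _ i

theorem coe_basis (hs : IsFrameOver E s) : ⇑hs.basis = s := funext hs.basis_apply

theorem sum_repr (hs : IsFrameOver E s) (t : Sec E V) : ∑ i, hs.basis.repr t i • s i = t := by
  simpa only [basis_apply] using hs.basis.sum_repr t

theorem repr_eq (hs : IsFrameOver E s) {t : Sec E V} {a : ι → Hol n V}
    (h : t = ∑ i, a i • s i) (i : ι) : hs.basis.repr t i = a i := by
  have h1 : t = ∑ i, a i • hs.basis i := by simpa only [basis_apply] using h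
  rw [h1, hs.basis.repr_sum_self]

theorem repr_res (hs : IsFrameOver E s) (h : W ≤ V) {s' : ι → Sec E W} (hs' : IsFrameOver E s')
    (e : ∀ i, s' i = HYM.res E h (s i)) (t : Sec E V) (i : ι) :
    hs'.basis.repr (HYM.res E h t) i = (hs.basis.repr t i).res h := by
  apply hs'.repr_eq
  simp only [e]
  rw [← res_sum_smul, hs.sum_repr]

theorem coord_eq {r : ℕ} {s : Fin r → Sec E V} (hs : IsFrame E s) (t : Sec E V) (i : Fin r) :
    hs.coord t i = (IsFrameOver.basis hs).repr t i := by
  refine (IsFrameOver.repr_eq hs ?_ i).symm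
  have := (hs V le_rfl t).choose_spec.1
  simp only [res_self] at this
  exact this

/-- A point of `V` makes the ring of functions nonzero, and then two bases of a module have the same
size. -/
theorem card_eq (hs : IsFrameOver E s) {t : κ → Sec E V} (ht : IsFrameOver E t) {x : X}
    (hx : x ∈ V) : Fintype.card ι = Fintype.card κ := by
  haveI := Hol.nontrivial (n := n) hx
  exact Fintype.card_congr (hs.basis.indexEquiv ht.basis)

/-- Local coordinates of a section are unique, so they glue to holomorphic functions over the whole
open set. -/
theorem of_locally {s : ι → Sec E V} (h : ∀ x ∈ V, ∃ (W : Opens X) (hW : W ≤ V), x ∈ W ∧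
    IsFrameOver E fun i => HYM.res E hW (s i)) : IsFrameOver E s := by
  intro W hWV t
  have loc : ∀ x : W, ∃ (W' : Opens X) (hW' : W' ≤ W), x.1 ∈ W' ∧
      IsFrameOver E fun i => HYM.res E (hW'.trans hWV) (s i) := by
    intro x
    obtain ⟨W', h', hx, hf⟩ := h x.1 (hWV x.2)
    refine ⟨W' ⊓ W, inf_le_right, ⟨hx, x.2⟩, ?_⟩
    simpa only [res_res] using hf.res (inf_le_left : W' ⊓ W ≤ W')
  choose D hD hxD hf using loc
  let a : ∀ x : W, ι → Hol n (D x) := fun x => (hf x).basis.repr (HYM.res E (hD x) t)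
  -- Over `D x ⊓ D y'` both coordinate vectors restrict to the coordinates of the same section in
  -- the same frame.
  have ha : ∀ x (y : X) (hx : y ∈ D x) (y' : W) (hy : y ∈ D y') (i : ι),
      (a x i).eval y hx = (a y' i).eval y hy := by
    intro x y hx y' hy i
    have hfr : IsFrameOver E fun i =>
        HYM.res E ((inf_le_left : D x ⊓ D y' ≤ D x).trans ((hD x).trans hWV)) (s i) := by
      simpa only [res_res] using (hf x).res (inf_le_left : D x ⊓ D y' ≤ D x)
    have e1 := (hf x).repr_res inf_le_left hfr (fun i => by rw [res_res]) (HYM.res E (hD x) t) i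
    have e2 := (hf y').repr_res inf_le_right hfr (fun i => by rw [res_res])
      (HYM.res E (hD y') t) i
    rw [res_res] at e1 e2
    exact congrArg (fun f : Hol n (D x ⊓ D y') => f.eval y ⟨hx, hy⟩) (e1.symm.trans e2)
  have hb : ∀ i, ∃ g : Hol n W, ∀ (y : X) (hy : y ∈ W),
      g.eval y hy = (a ⟨y, hy⟩ i).eval y (hxD ⟨y, hy⟩) := fun i =>
    Hol.exists_of_locally (fun y : W => (a y i).eval y.1 (hxD y)) fun x =>
      ⟨D x, hxD x, hD x, a x i, fun y hy => ha x y hy ⟨y, hD x hy⟩ (hxD ⟨y, hD x hy⟩) i⟩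
  choose b hb using hb
  have hba : ∀ x i, (b i).res (hD x) = a x i := fun x i => Hol.ext _ _ fun y hy =>
    (hb i y (hD x hy)).trans (ha ⟨y, hD x hy⟩ y (hxD ⟨y, hD x hy⟩) x hy i)
  refine ⟨b, ?_, fun c hc => ?_⟩
  · refine sec_ext _ _ _ fun x hx => ⟨D ⟨x, hx⟩, hD ⟨x, hx⟩, hxD ⟨x, hx⟩, ?_⟩
    rw [res_sum_smul]
    simp only [hba, res_res]
    exact ((hf ⟨x, hx⟩).sum_repr _).symm
  · funext i
    refine Hol.ext _ _ fun y hy => ?_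
    have h1 : a ⟨y, hy⟩ i = (c i).res (hD ⟨y, hy⟩) := by
      apply (hf ⟨y, hy⟩).repr_eq (a := fun i => (c i).res (hD ⟨y, hy⟩))
      rw [hc, res_sum_smul]
      simp only [res_res]
    rw [hb i y hy, h1]
    rfl

end IsFrameOver

/-! ### Frames of tensor products -/

variable (n X) in
/-- `O` as a module over itself. -/
def unitModule : OModule n X := SheafOfModules.unit (structureSheaf n X)

section
variable {E F : OModule n X} {ι κ : Type} [Fintype ι] [Fintype κ] {V : Opens X}
  {s : ι → Sec E V} {t : κ → Sec F V}

/-- The product of two coordinates. -/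
def coordPairing (hs : IsFrameOver E s) (ht : IsFrameOver F t) (i : ι) (j : κ) :
    Pairing E F (unitModule n X) V where
  toFun W hW := (LinearMap.mk₂ (Hol n W)
    (fun u v => (hs.res hW).basis.repr u i * (ht.res hW).basis.repr v j)
    (fun _ _ _ => by rw [map_add, Finsupp.add_apply, add_mul])
    (fun _ _ _ => by rw [map_smul, Finsupp.smul_apply, smul_mul_assoc])
    (fun _ _ _ => by rw [map_add, Finsupp.add_apply, mul_add])
    (fun _ _ _ => by rw [map_smul, Finsupp.smul_apply, mul_smul_comm]) :
    Sec E W →ₗ[Hol n W] Sec F W →ₗ[Hol n W] Hol n W)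
  res_toFun U W hU h u v := by
    refine Eq.trans (b := ((hs.res hU).basis.repr u i).res h * ((ht.res hU).basis.repr v j).res h)
      rfl ?_
    rw [← (hs.res hU).repr_res h (hs.res (h.trans hU)) (fun i => by rw [res_res]) u i,
      ← (ht.res hU).repr_res h (ht.res (h.trans hU)) (fun i => by rw [res_res]) v j]
    rfl

/-- `tmul` as a bilinear map. -/
def tmulBilin (E F : OModule n X) (V : Opens X) :
    Sec E V →ₗ[Hol n V] Sec F V →ₗ[Hol n V] Sec (tensor E F) V :=
  LinearMap.mk₂ (Hol n V) tmul add_tmul smul_tmul tmul_add tmul_smul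

theorem tmul_sum_sum {σ τ : Type} (S : Finset σ) (T : Finset τ) (a : σ → Hol n V)
    (b : τ → Hol n V) (u : σ → Sec E V) (v : τ → Sec F V) :
    tmul (∑ i ∈ S, a i • u i) (∑ j ∈ T, b j • v j) =
      ∑ i ∈ S, ∑ j ∈ T, (a i * b j) • tmul (u i) (v j) := by
  change tmulBilin E F V _ _ = _
  rw [LinearMap.map_sum₂]
  refine Finset.sum_congr rfl fun i _ => ?_
  rw [map_sum]
  refine Finset.sum_congr rfl fun j _ => ?_
  rw [map_smul, LinearMap.map_smul₂, smul_smul, mul_comm]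
  rfl

theorem coordPairing_lift_tmul (hs : IsFrameOver E s) (ht : IsFrameOver F t) (i : ι) (j : κ)
    {W : Opens X} (hW : W ≤ V) (u : Sec E W) (v : Sec F W) :
    (coordPairing hs ht i j).lift hW (tmul u v) =
      (hs.res hW).basis.repr u i * (ht.res hW).basis.repr v j :=
  Pairing.lift_tmul _ _ _ _

/-- The coordinate functions are the lifts of the pairings `coordPairing`, which are defined on
every section of the sheafified tensor product. The expansion formula is checked on pure tensors and
spreads by `tensor_hom_ext`; uniqueness follows by applying a lift to an arbitrary expansion, since
the lifts are dual to the products of frame sections. -/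
theorem isFrameOver_tensor (hs : IsFrameOver E s) (ht : IsFrameOver F t) :
    IsFrameOver (tensor E F) fun p : ι × κ => tmul (s p.1) (t p.2) := by
  classical
  intro W hW u
  refine ⟨fun p => (coordPairing hs ht p.1 p.2).lift hW u, ?_, fun a ha => ?_⟩
  · refine tensor_hom_ext (U := V) (fun _ _ u => u)
      (fun W h u => ∑ p : ι × κ, (show Hol n W from (coordPairing hs ht p.1 p.2).lift h u) •
        res (tensor E F) h (tmul (s p.1) (t p.2)))
      (fun _ _ _ _ _ => rfl) (fun W W' h h' u => ?_) (fun _ _ _ _ => rfl) (fun W h u v => ?_)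
      (fun W h u v => ?_) hW u
    · rw [res_sum_smul]
      refine Finset.sum_congr rfl fun p _ => ?_
      rw [res_res]
      congr 1
      exact (coordPairing hs ht p.1 p.2).res_lift h h' u
    · rw [← Finset.sum_add_distrib]
      refine Finset.sum_congr rfl fun p _ => ?_
      rw [map_add]
      exact add_smul (R := Hol n W) _ _ _
    · simp only [coordPairing_lift_tmul, res_tmul]
      refine Eq.trans ?_ (Fintype.sum_prod_type _).symm
      refine Eq.trans ?_ (tmul_sum_sum Finset.univ Finset.univ
        (fun i => (hs.res h).basis.repr u i) (fun j => (ht.res h).basis.repr v j)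
        (fun i => res E h (s i)) (fun j => res F h (t j)))
      rw [(hs.res h).sum_repr, (ht.res h).sum_repr]
  · funext q
    rw [ha, map_sum]
    -- Duality of the coordinate functionals with the frame: all terms of the sum except `p = q`
    -- vanish.
    have : ∀ p : ι × κ, (coordPairing hs ht q.1 q.2).lift hW
        (a p • res (tensor E F) hW (tmul (s p.1) (t p.2))) =
        (show Hol n W from a p * ((if p.1 = q.1 then 1 else 0) * (if p.2 = q.2 then 1 else 0))) := by
      intro p
      rw [map_smul, res_tmul, coordPairing_lift_tmul]
      have e1 := (hs.res hW).basis.repr_self_apply p.1 q.1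
      have e2 := (ht.res hW).basis.repr_self_apply p.2 q.2
      rw [IsFrameOver.basis_apply] at e1 e2
      rw [e1, e2]
      rfl
    rw [Finset.sum_congr rfl fun p _ => this p]
    symm
    refine Eq.trans (Finset.sum_eq_single (M := Hol n W) q ?_ ?_) ?_
    · intro p _ hp
      by_cases h1 : p.1 = q.1
      · have h2 : p.2 ≠ q.2 := fun h2 => hp (Prod.ext h1 h2)
        simp [h2]
      · simp [h1]
    · simp
    · simp

open Limits in
theorem isFrameOver_biprod (hs : IsFrameOver E s) (ht : IsFrameOver F t) :
    IsFrameOver (E ⊞ F) (Sum.elim (fun i => onSec biprod.inl V (s i))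
      (fun j => onSec biprod.inr V (t j))) := by
  intro W hW u
  have h11 : ∀ u, onSec (biprod.fst : E ⊞ F ⟶ _) W (onSec biprod.inl W u) = u :=
    fun u => congrArg (fun f => onSec f W u) (biprod.inl_fst (X := E) (Y := F))
  have h12 : ∀ u, onSec (biprod.snd : E ⊞ F ⟶ _) W (onSec biprod.inl W u) = 0 :=
    fun u => congrArg (fun f => onSec f W u) (biprod.inl_snd (X := E) (Y := F))
  have h21 : ∀ u, onSec (biprod.fst : E ⊞ F ⟶ _) W (onSec biprod.inr W u) = 0 :=
    fun u => congrArg (fun f => onSec f W u) (biprod.inr_fst (X := E) (Y := F))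
  have h22 : ∀ u, onSec (biprod.snd : E ⊞ F ⟶ _) W (onSec biprod.inr W u) = u :=
    fun u => congrArg (fun f => onSec f W u) (biprod.inr_snd (X := E) (Y := F))
  have htot : onSec biprod.inl W (onSec (biprod.fst : E ⊞ F ⟶ _) W u) +
      onSec biprod.inr W (onSec (biprod.snd : E ⊞ F ⟶ _) W u) = u :=
    congrArg (fun f => onSec f W u) (biprod.total (X := E) (Y := F))
  refine ⟨Sum.elim (fun i => (hs.res hW).basis.repr (onSec biprod.fst W u) i)
    (fun j => (ht.res hW).basis.repr (onSec biprod.snd W u) j), ?_, fun a ha => ?_⟩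
  · simp only [Fintype.sum_sum_type, Sum.elim_inl, Sum.elim_inr, onSec_res, ← map_smul, ← map_sum]
    rw [(hs.res hW).sum_repr, (ht.res hW).sum_repr, htot]
  · simp only [Fintype.sum_sum_type, Sum.elim_inl, Sum.elim_inr, onSec_res, ← map_smul,
      ← map_sum] at ha
    have e1 : onSec biprod.fst W u = ∑ i, a (Sum.inl i) • res E hW (s i) := by
      rw [ha, map_add, h11, h21, add_zero]
    have e2 : onSec biprod.snd W u = ∑ j, a (Sum.inr j) • res F hW (t j) := by
      rw [ha, map_add, h12, h22, zero_add]
    funext q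
    rcases q with i | j
    · exact ((hs.res hW).repr_eq e1 i).symm
    · exact ((ht.res hW).repr_eq e2 j).symm

end

/-! ### Change of frame -/

section changeOfFrame
variable {E : OModule n X} {ι κ : Type} [Fintype ι] [DecidableEq ι] [Fintype κ] [DecidableEq κ]
  {V : Opens X} {s : ι → Sec E V} {t : κ → Sec E V}

/-- The value at `x` of the matrix expressing the frame `t` in the frame `s`; zero outside `V`. -/
def IsFrameOver.transition (hs : IsFrameOver E s) (t : κ → Sec E V) (x : X) : Matrix ι κ ℂ :=
  open Classical in if hx : x ∈ V then (hs.basis.toMatrix t).map (Hol.evalHom x hx) else 0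

theorem IsFrameOver.transition_apply (hs : IsFrameOver E s) (t : κ → Sec E V) {x : X} (hx : x ∈ V)
    (i : ι) (k : κ) : hs.transition t x i k = (hs.basis.repr (t k) i).eval x hx := by
  rw [transition, dif_pos hx]
  rfl

theorem IsFrameOver.transition_mul (hs : IsFrameOver E s) (ht : IsFrameOver E t) {x : X}
    (hx : x ∈ V) : hs.transition t x * ht.transition s x = 1 := by
  rw [transition, transition, dif_pos hx, dif_pos hx, ← Matrix.map_mul]
  have := hs.basis.toMatrix_mul_toMatrix_flip ht.basis
  rw [hs.coe_basis, ht.coe_basis] at this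
  rw [this, Matrix.map_one _ (map_zero _) (map_one _)]

end changeOfFrame

end frames

/-! ### Holomorphic functions in charts -/

section charts
open Filter Topology
variable {n : ℕ} {X : Type} [TopologicalSpace X] [ChartedSpace (Fin n → ℂ) X]

/-- Extension of a holomorphic function by zero. -/
def Hol.extend {V : Opens X} (f : Hol n V) (x : X) : ℂ :=
  open Classical in if hx : x ∈ V then f.eval x hx else 0

theorem Hol.extend_of_mem {V : Opens X} (f : Hol n V) {x : X} (hx : x ∈ V) :
    f.extend x = f.eval x hx := dif_pos hx

variable [IsManifold 𝓘(ℂ, Fin n → ℂ) ∞ X]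

/-- Extension by zero turns `f` into a function of unrestricted coordinates, to which the Wirtinger
calculus applies; near the point considered it agrees with `f`. -/
theorem Hol.contDiffAt_extend {V : Opens X} (f : Hol n V) (e : Chart n X) {z : Fin n → ℂ}
    (hz : z ∈ e.1.target) (hV : e.1.symm z ∈ V) :
    ContDiffAt ℂ ∞ (fun w => f.extend (e.1.symm w)) z := by
  have hf : ContMDiff 𝓘(ℂ, Fin n → ℂ) 𝓘(ℂ) ∞
      (show C^∞⟮𝓘(ℂ, Fin n → ℂ), V; 𝓘(ℂ), ℂ⟯ from f) := ContMDiffMap.contMDiff _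
  have h1 : ContMDiffAt 𝓘(ℂ, Fin n → ℂ) 𝓘(ℂ) ∞ f.extend (e.1.symm z) := by
    refine (contMDiffAt_subtype_iff (x := (⟨e.1.symm z, hV⟩ : V))).1 ?_
    refine (hf ⟨e.1.symm z, hV⟩).congr_of_eventuallyEq (Eventually.of_forall fun y => ?_)
    exact f.extend_of_mem y.2
  have h2 : ContMDiffAt 𝓘(ℂ, Fin n → ℂ) 𝓘(ℂ, Fin n → ℂ) ∞ e.1.symm z :=
    (contMDiffOn_symm_of_mem_maximalAtlas
      (IsManifold.subset_maximalAtlas e.2)).contMDiffAt (e.1.open_target.mem_nhds hz)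
  exact contMDiffAt_iff_contDiffAt.1 (ContMDiffAt.comp z h1 h2)

theorem contDiffAt_chartChange (e e' : Chart n X) {z : Fin n → ℂ} (hz : z ∈ e'.1.target)
    (hV : e'.1.symm z ∈ e.1.source) :
    ContDiffAt ℂ ∞ (fun w => e.1 (e'.1.symm w)) z := by
  have h2 : ContMDiffAt 𝓘(ℂ, Fin n → ℂ) 𝓘(ℂ, Fin n → ℂ) ∞ e'.1.symm z :=
    (contMDiffOn_symm_of_mem_maximalAtlas
      (IsManifold.subset_maximalAtlas e'.2)).contMDiffAt (e'.1.open_target.mem_nhds hz)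
  have h1 : ContMDiffAt 𝓘(ℂ, Fin n → ℂ) 𝓘(ℂ, Fin n → ℂ) ∞ e.1 (e'.1.symm z) :=
    (contMDiffOn_of_mem_maximalAtlas
      (IsManifold.subset_maximalAtlas e.2)).contMDiffAt (e.1.open_source.mem_nhds hV)
  exact contMDiffAt_iff_contDiffAt.1 (ContMDiffAt.comp z h1 h2)

theorem mdifferentiable_chart (e : Chart n X) :
    e.1.MDifferentiable 𝓘(ℂ, Fin n → ℂ) 𝓘(ℂ, Fin n → ℂ) :=
  haveI : IsManifold 𝓘(ℂ, Fin n → ℂ) 1 X := IsManifold.of_le (n := ∞) (by simp)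
  mdifferentiable_of_mem_atlas e.2

/-- Chain rule for `e'.symm = e.symm ∘ ψ` near the point, where `ψ` is the change of charts. -/
theorem coordVec_change (e e' : Chart n X) {x : X} (hx : x ∈ e.1.source) (hx' : x ∈ e'.1.source)
    (j : Fin n) : e'.coordVec j x =
      ∑ l, jacobian (fun w => e.1 (e'.1.symm w)) (e'.1 x) l j • e.coordVec l x := by
  set ψ : (Fin n → ℂ) → (Fin n → ℂ) := fun w => e.1 (e'.1.symm w) with hψ
  have hz : e'.1 x ∈ e'.1.target := e'.1.map_source hx'
  have hsx : e'.1.symm (e'.1 x) = x := e'.1.left_inv hx'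
  have hψx : ψ (e'.1 x) = e.1 x := congrArg e.1 hsx
  have hd : DifferentiableAt ℂ ψ (e'.1 x) :=
    (contDiffAt_chartChange e e' hz (by rwa [hsx])).differentiableAt_of_smooth
  have he : e'.1.symm =ᶠ[𝓝 (e'.1 x)] e.1.symm ∘ ψ := by
    have : e'.1.symm ⁻¹' e.1.source ∈ 𝓝 (e'.1 x) :=
      (e'.1.continuousAt_symm hz).preimage_mem_nhds
        (e.1.open_source.mem_nhds (by rwa [hsx]))
    filter_upwards [this] with w hw
    exact (e.1.left_inv hw).symm
  have hm : MDifferentiableAt 𝓘(ℂ, Fin n → ℂ) 𝓘(ℂ, Fin n → ℂ) e.1.symm (ψ (e'.1 x)) :=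
    (mdifferentiable_chart e).mdifferentiableAt_symm (by rw [hψx]; exact e.1.map_source hx)
  have hc := mfderiv_comp (I := 𝓘(ℂ, Fin n → ℂ)) (I' := 𝓘(ℂ, Fin n → ℂ))
    (I'' := 𝓘(ℂ, Fin n → ℂ)) (e'.1 x) hm hd.mdifferentiableAt
  have hs : (fderiv ℂ ψ (e'.1 x) (Pi.single j 1) : Fin n → ℂ) =
      ∑ l, jacobian ψ (e'.1 x) l j • (Pi.single l (1 : ℂ) : Fin n → ℂ) := by
    ext i
    simp [jacobian, Finset.sum_apply, Pi.single_apply]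
  have key : (mfderiv 𝓘(ℂ, Fin n → ℂ) 𝓘(ℂ, Fin n → ℂ) e'.1.symm (e'.1 x) (Pi.single j (1 : ℂ)) :
      Fin n → ℂ) = (mfderiv 𝓘(ℂ, Fin n → ℂ) 𝓘(ℂ, Fin n → ℂ) e.1.symm (ψ (e'.1 x))
        (fderiv ℂ ψ (e'.1 x) (Pi.single j 1)) : Fin n → ℂ) := by
    have h1 := he.mfderiv_eq (I := 𝓘(ℂ, Fin n → ℂ)) (I' := 𝓘(ℂ, Fin n → ℂ))
    rw [hc, mfderiv_eq_fderiv] at h1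
    exact congrArg (fun L : (Fin n → ℂ) →L[ℂ] (Fin n → ℂ) => L (Pi.single j (1 : ℂ))) h1
  refine key.trans ?_
  rw [hs, hψx]
  exact (map_sum (show (Fin n → ℂ) →L[ℂ] (Fin n → ℂ) from
    mfderiv 𝓘(ℂ, Fin n → ℂ) 𝓘(ℂ, Fin n → ℂ) e.1.symm (e.1 x)) _ _).trans
    (Finset.sum_congr rfl fun l _ => map_smul _ _ _)

theorem coordVec_linearIndependent (e : Chart n X) {x : X} (hx : x ∈ e.1.source) :
    LinearIndependent ℂ fun j => e.coordVec j x := by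
  let L : (Fin n → ℂ) →L[ℂ] (Fin n → ℂ) :=
    mfderiv 𝓘(ℂ, Fin n → ℂ) 𝓘(ℂ, Fin n → ℂ) e.1.symm (e.1 x)
  have hinj : Function.Injective L :=
    (mdifferentiable_chart e).symm.mfderiv_injective (e.1.map_source hx)
  have := (Pi.basisFun ℂ (Fin n)).linearIndependent.map' L.toLinearMap
    (LinearMap.ker_eq_bot.2 hinj)
  convert! this using 1
  funext j
  simp only [Function.comp, Pi.basisFun_apply]
  rfl

end charts

/-! ### Gram matrices, curvature and Higgs fields in frames -/

section metrics
open Matrix Filter Topology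
variable {n : ℕ} {X : Type} [TopologicalSpace X] [ChartedSpace (Fin n → ℂ) X]
variable {E : OModule n X} {ι κ : Type} [Fintype ι] [DecidableEq ι] [Fintype κ] [DecidableEq κ]
  {U V W : Opens X} {s : ι → Sec E V} {t : κ → Sec E V}

/-! ### Sesquilinear forms on sections at a point -/

section sesquilinear
variable {x : X} (hx : x ∈ V) (B : Sec E V → Sec E V → ℂ)
  (hadd : ∀ a b c, B (a + b) c = B a c + B b c)
  (hsmul : ∀ (f : Hol n V) a b, B (f • a) b = f.eval x hx * B a b)
  (hconj : ∀ a b, B b a = star (B a b))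
include hadd hsmul hconj

theorem sesquilinear_sum {σ τ : Type} (S : Finset σ) (T : Finset τ) (a : σ → Hol n V)
    (b : τ → Hol n V) (u : σ → Sec E V) (v : τ → Sec E V) :
    B (∑ i ∈ S, a i • u i) (∑ j ∈ T, b j • v j) =
      ∑ i ∈ S, ∑ j ∈ T, (a i).eval x hx * star ((b j).eval x hx) * B (u i) (v j) := by
  have h0 : ∀ c, B 0 c = 0 := fun c => by simpa using hadd 0 0 c
  have left : ∀ {σ : Type} (S : Finset σ) (a : σ → Hol n V) (u : σ → Sec E V) (c : Sec E V),
      B (∑ i ∈ S, a i • u i) c = ∑ i ∈ S, (a i).eval x hx * B (u i) c := by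
    intro σ S a u c
    classical
    induction S using Finset.induction_on with
    | empty => simpa using h0 c
    | insert i S hi ih => rw [Finset.sum_insert hi, Finset.sum_insert hi, hadd, hsmul, ih]
  rw [left]
  refine Finset.sum_congr rfl fun i _ => ?_
  rw [hconj, left, star_sum, Finset.mul_sum]
  refine Finset.sum_congr rfl fun j _ => ?_
  rw [star_mul', ← hconj, mul_assoc]

/-- Stated for a bare form `B` rather than a `HermitianMetric`, because the positivity of the tensor
and sum metrics is proved by means of it before those metrics exist. -/
theorem sesquilinear_change (hs : IsFrameOver E s) (t : κ → Sec E V) :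
    (Matrix.of fun k l => B (t k) (t l)) = (hs.transition t x)ᵀ *
      (Matrix.of fun i j => B (s i) (s j)) * (hs.transition t x)ᴴᵀ := by
  ext k l
  rw [of_apply]
  conv_lhs => rw [← hs.sum_repr (t k), ← hs.sum_repr (t l)]
  rw [sesquilinear_sum hx B hadd hsmul hconj]
  simp only [mul_apply, transpose_apply, conjTranspose_apply, of_apply, Finset.sum_mul,
    hs.transition_apply t hx]
  rw [Finset.sum_comm]
  refine Finset.sum_congr rfl fun i _ => Finset.sum_congr rfl fun j _ => ?_
  ring

end sesquilinear

/-- The Gram matrix of sections at a point. -/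
def gram (h : HermitianMetric E U) (hV : V ≤ U) (s : ι → Sec E V) (x : X) : Matrix ι ι ℂ :=
  Matrix.of fun i j => h.inner V hV (s i) (s j) x

variable (h : HermitianMetric E U) (hV : V ≤ U)

theorem gram_res (hW : W ≤ V) (s : ι → Sec E V) {x : X} (hx : x ∈ W) :
    gram h (hW.trans hV) (fun i => res E hW (s i)) x = gram h hV s x := by
  ext i j
  exact h.res_eq V W hV hW _ _ x hx

theorem gram_change (hs : IsFrameOver E s) (t : κ → Sec E V) {x : X} (hx : x ∈ V) :
    gram h hV t x = (hs.transition t x)ᵀ * gram h hV s x * (hs.transition t x)ᴴᵀ :=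
  sesquilinear_change hx (fun a b => h.inner V hV a b x) (fun a b c => h.add_left V hV a b c x hx)
    (fun f a b => h.smul_left V hV f a b x hx) (fun a b => h.conj_symm V hV a b x hx) hs t

theorem gram_posDef (hs : IsFrameOver E s) {x : X} (hx : x ∈ V) : (gram h hV s x).PosDef := by
  have e := (Fintype.equivFin ι).symm
  have := h.posDef V hV _ (s ∘ e) (hs.reindex e) x hx
  have h2 := this.submatrix e.symm.injective
  convert! h2 using 1
  ext i j
  simp [gram]

theorem eventually_mem_chart (e : Chart n X) {z : Fin n → ℂ} (hz : z ∈ e.1.target)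
    (hzV : e.1.symm z ∈ V) : ∀ᶠ w in 𝓝 z, w ∈ e.1.target ∧ e.1.symm w ∈ V :=
  Filter.Eventually.and (e.1.open_target.mem_nhds hz)
    ((e.1.continuousAt_symm hz).preimage_mem_nhds (V.2.mem_nhds hzV))

theorem gram_smooth (s : ι → Sec E V) (e : Chart n X) {z : Fin n → ℂ} (hz : z ∈ e.1.target)
    (hzV : e.1.symm z ∈ V) : SmoothMatrixAt (fun w => gram h hV s (e.1.symm w)) z :=
  fun i j => (h.smooth V hV (s i) (s j) e).contDiffAt (eventually_mem_chart e hz hzV)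

/-- The curvature coefficients at `x` in a frame and a chart. -/
def curvatureAt (s : ι → Sec E V) (e : Chart n X) (j k : Fin n) (x : X) : Matrix ι ι ℂ :=
  curvatureOf (fun z => gram h hV s (e.1.symm z)) j k (e.1 x)

theorem curvatureAt_res (hW : W ≤ V) (s : ι → Sec E V) (e : Chart n X) (j k : Fin n) {x : X}
    (hx : x ∈ W) (hxe : x ∈ e.1.source) :
    curvatureAt h (hW.trans hV) (fun i => res E hW (s i)) e j k x =
      curvatureAt h hV s e j k x := by
  apply curvatureOf_congr
  filter_upwards [eventually_mem_chart (V := W) e (e.1.map_source hxe)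
    (by rwa [e.1.left_inv hxe])] with w hw
  exact gram_res h hV hW s hw.2

/-- The matrix at `x` of the component `φ_α` of a Higgs field. -/
def fieldAt (hs : IsFrameOver E s) (φ : E ⟶ tensor E (cotangentSheaf n X)) (e : Chart n X)
    (hVe : V ≤ e.dom) (α : Fin n) (x : X) : Matrix ι ι ℂ :=
  Matrix.of fun i j => (hs.basis.repr (fieldComp φ e α hVe (s j)) i).extend x

theorem fieldAt_res (hs : IsFrameOver E s) (hW : W ≤ V)
    (φ : E ⟶ tensor E (cotangentSheaf n X)) (e : Chart n X)
    (hVe : V ≤ e.dom) (α : Fin n) {x : X} (hx : x ∈ W) :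
    fieldAt (hs.res hW) φ e (hW.trans hVe) α x = fieldAt hs φ e hVe α x := by
  ext i j
  simp only [fieldAt, of_apply]
  rw [← res_fieldComp φ e α hVe hW, hs.repr_res hW (hs.res hW) (fun _ => rfl),
    Hol.extend_of_mem _ hx, Hol.extend_of_mem _ (hW hx), Hol.eval_res]

/-- Each `φ_α` is linear over holomorphic functions, so it is an honest endomorphism and the usual
change of basis holds before evaluating at the point. -/
theorem fieldAt_change (hs : IsFrameOver E s) (ht : IsFrameOver E t)
    (φ : E ⟶ tensor E (cotangentSheaf n X)) (e : Chart n X) (hVe : V ≤ e.dom) (α : Fin n) {x : X}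
    (hx : x ∈ V) :
    fieldAt ht φ e hVe α x = ht.transition s x * fieldAt hs φ e hVe α x * hs.transition t x := by
  have h1 : ∀ {σ : Type} [Fintype σ] [DecidableEq σ] {u : σ → Sec E V} (hu : IsFrameOver E u),
      fieldAt hu φ e hVe α x =
        (LinearMap.toMatrix hu.basis hu.basis (fieldComp φ e α hVe)).map (Hol.evalHom x hx) := by
    intro σ _ _ u hu
    ext i j
    simp only [fieldAt, of_apply, map_apply, LinearMap.toMatrix_apply, hu.basis_apply]
    exact Hol.extend_of_mem _ hx
  rw [h1, h1, IsFrameOver.transition, IsFrameOver.transition, dif_pos hx, dif_pos hx,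
    ← Matrix.map_mul, ← Matrix.map_mul]
  have := basis_toMatrix_mul_linearMap_toMatrix_mul_basis_toMatrix ht.basis hs.basis ht.basis
    hs.basis (fieldComp φ e α hVe)
  rw [hs.coe_basis, ht.coe_basis] at this
  rw [this]

/-! ### Independence of frame and chart on a complex manifold -/

section manifold
variable [IsManifold 𝓘(ℂ, Fin n → ℂ) ∞ X]

theorem transition_hol (hs : IsFrameOver E s) (t : κ → Sec E V) (e : Chart n X) {z : Fin n → ℂ}
    (hz : z ∈ e.1.target) (hzV : e.1.symm z ∈ V) :
    HolMatrixAt (fun w => hs.transition t (e.1.symm w)) z := by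
  intro i k
  refine ((hs.basis.repr (t k) i).contDiffAt_extend e hz hzV).congr_of_eventuallyEq ?_
  filter_upwards [eventually_mem_chart e hz hzV] with w hw
  rw [hs.transition_apply t hw.2, Hol.extend_of_mem _ hw.2]

theorem curvatureAt_change (hs : IsFrameOver E s) (ht : IsFrameOver E t) (e : Chart n X)
    (j k : Fin n) {x : X} (hx : x ∈ V) (hxe : x ∈ e.1.source) :
    curvatureAt h hV t e j k x =
      ht.transition s x * curvatureAt h hV s e j k x * hs.transition t x := by
  have hz := e.1.map_source hxe
  have hzx := e.1.left_inv hxe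
  have ev := eventually_mem_chart e hz (by rwa [hzx] : e.1.symm (e.1 x) ∈ V)
  have := curvatureOf_conj (z := e.1 x) (H := fun z => gram h hV s (e.1.symm z))
    (P := fun z => hs.transition t (e.1.symm z)) (Q := fun z => ht.transition s (e.1.symm z))
    (ev.mono fun w hw => transition_hol hs t e hw.1 hw.2)
    (transition_hol ht s e hz (by rwa [hzx]))
    (ev.mono fun w hw => hs.transition_mul ht hw.2)
    (ev.mono fun w hw => ht.transition_mul hs hw.2)
    (ev.mono fun w hw => gram_smooth h hV s e hw.1 hw.2)
    (ev.mono fun w hw => (gram_posDef h hV hs hw.2).isUnit_det) j k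
  rw [hzx] at this
  rw [curvatureAt, curvatureAt, ← this]
  exact curvatureOf_congr (ev.mono fun w hw => gram_change h hV hs t hw.2) j k

theorem curvatureAt_chart (hs : IsFrameOver E s) (e e' : Chart n X) (j k : Fin n) {x : X}
    (hx : x ∈ V) (hxe : x ∈ e.1.source) (hxe' : x ∈ e'.1.source) :
    curvatureAt h hV s e' j k x =
      changeCoord (jacobian (fun w => e.1 (e'.1.symm w)) (e'.1 x))
        (fun l m => curvatureAt h hV s e l m x) j k := by
  have hz := e.1.map_source hxe
  have hzx := e.1.left_inv hxe
  have hz' := e'.1.map_source hxe'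
  have hzx' := e'.1.left_inv hxe'
  have hψ : e.1 (e'.1.symm (e'.1 x)) = e.1 x := by rw [hzx']
  have ev := eventually_mem_chart e hz (by rwa [hzx] : e.1.symm (e.1 x) ∈ V)
  have ev' := eventually_mem_chart (V := e.dom) e' hz' (by rw [hzx']; exact hxe)
  have := curvatureOf_comp (z := e'.1 x) (ψ := fun w => e.1 (e'.1.symm w))
    (H := fun z => gram h hV s (e.1.symm z))
    (contDiffAt_chartChange e e' hz' (by rwa [hzx']))
    (by rw [hψ]; exact ev.mono fun w hw => gram_smooth h hV s e hw.1 hw.2)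
    (by rw [hψ, hzx]; exact (gram_posDef h hV hs hx).isUnit_det) j k
  rw [hψ] at this
  rw [curvatureAt]
  simp only [curvatureAt]
  rw [← this]
  refine curvatureOf_congr (ev'.mono fun w hw => ?_) j k
  change gram h hV s (e'.1.symm w) = gram h hV s (e.1.symm (e.1 (e'.1.symm w)))
  rw [e.1.left_inv hw.2]

/-- The coordinate vectors are linearly independent, so positivity of `g` passes to the coefficient
matrix. The coefficients are conjugated in `hsum` because `g` is linear in its first argument while
the matrix form conjugates the first vector. -/
theorem KahlerMetric.coeff_posDef (g : KahlerMetric n X) (e : Chart n X) {z : Fin n → ℂ}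
    (hz : z ∈ e.1.target) : (g.coeff e z).PosDef := by
  set x := e.1.symm z
  have hx : x ∈ e.1.source := e.1.map_target hz
  have hsum : ∀ c : Fin n → ℂ, star c ⬝ᵥ (g.coeff e z *ᵥ c) =
      g.inner x (∑ j, star (c j) • e.coordVec j x) (∑ j, star (c j) • e.coordVec j x) := by
    intro c
    simp only [map_sum, map_smul, LinearMap.sum_apply, LinearMap.smul_apply, map_smulₛₗ,
      dotProduct, mulVec, KahlerMetric.coeff, chartMatrix, of_apply, Finset.mul_sum, smul_eq_mul]
    rw [Finset.sum_comm]
    refine Finset.sum_congr rfl fun i _ => Finset.sum_congr rfl fun j _ => ?_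
    simp
    ring
  refine PosDef.of_dotProduct_mulVec_pos ?_ fun c hc => ?_
  · ext j k
    exact (g.conj_symm x _ _).symm
  · rw [hsum]
    set v := ∑ j, star (c j) • e.coordVec j x
    have hv : v ≠ 0 := fun h0 => hc (by
      have := Fintype.linearIndependent_iff.1 (coordVec_linearIndependent e hx) _ h0
      funext j
      exact star_eq_zero.1 (this j))
    have him : (g.inner x v v).im = 0 := by
      have := congrArg Complex.im (g.conj_symm x v v)
      simp at this
      linarith
    exact Complex.lt_def.2 ⟨g.pos x v hv, him.symm⟩

theorem KahlerMetric.coeff_chart (g : KahlerMetric n X) (e e' : Chart n X) {x : X}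
    (hxe : x ∈ e.1.source) (hxe' : x ∈ e'.1.source) :
    g.coeff e' (e'.1 x) = (jacobian (fun w => e.1 (e'.1.symm w)) (e'.1 x))ᵀ * g.coeff e (e.1 x) *
      (jacobian (fun w => e.1 (e'.1.symm w)) (e'.1 x))ᴴᵀ := by
  ext j k
  simp only [KahlerMetric.coeff, chartMatrix, of_apply, mul_apply, transpose_apply,
    conjTranspose_apply]
  rw [e.1.left_inv hxe, e'.1.left_inv hxe', coordVec_change e e' hxe hxe' j,
    coordVec_change e e' hxe hxe' k]
  simp only [map_sum, map_smul, LinearMap.sum_apply, LinearMap.smul_apply, map_smulₛₗ,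
    smul_eq_mul, Finset.sum_mul, Finset.mul_sum]
  refine Finset.sum_congr rfl fun i _ => Finset.sum_congr rfl fun j _ => ?_
  simp
  ring

theorem KahlerMetric.coeff_smooth (g : KahlerMetric n X) (e : Chart n X) {z : Fin n → ℂ}
    (hz : z ∈ e.1.target) : SmoothMatrixAt (g.coeff e) z :=
  fun j k => (g.smooth e j k).contDiffAt (e.1.open_target.mem_nhds hz)

/-- The determinant of the metric in the chart `e'` is nonzero and has `det J` as a factor by
`coeff_chart`. -/
theorem jacobian_isUnit (g : KahlerMetric n X) (e e' : Chart n X) {x : X}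
    (hxe : x ∈ e.1.source) (hxe' : x ∈ e'.1.source) :
    IsUnit (jacobian (fun w => e.1 (e'.1.symm w)) (e'.1 x)).det := by
  have h1 := (g.coeff_posDef e' (e'.1.map_source hxe')).isUnit_det
  rw [g.coeff_chart e e' hxe hxe', det_mul, det_mul, det_transpose] at h1
  exact (IsUnit.mul_iff.1 (IsUnit.mul_iff.1 h1).1).1

/-- The mean curvature at `x` in a frame and a chart. -/
def meanAt (g : KahlerMetric n X) (s : ι → Sec E V) (e : Chart n X) (x : X) : Matrix ι ι ℂ :=
  contraction (g.coeff e (e.1 x)) fun j k => curvatureAt h hV s e j k x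

/-- The squared norm of the curvature at `x` in a frame and a chart. -/
def normSqAt (g : KahlerMetric n X) (s : ι → Sec E V) (e : Chart n X) (x : X) : ℝ :=
  formNormSqOf (g.coeff e (e.1 x)) (gram h hV s x) fun j k => curvatureAt h hV s e j k x

theorem meanAt_chart (g : KahlerMetric n X) (hs : IsFrameOver E s) (e e' : Chart n X) {x : X}
    (hx : x ∈ V) (hxe : x ∈ e.1.source) (hxe' : x ∈ e'.1.source) :
    meanAt h hV g s e' x = meanAt h hV g s e x := by
  rw [meanAt, meanAt, g.coeff_chart e e' hxe hxe',
    ← contraction_changeCoord (jacobian_isUnit g e e' hxe hxe')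
      (g.coeff_posDef e (e.1.map_source hxe)).isUnit_det]
  congr 1
  funext j k
  exact curvatureAt_chart h hV hs e e' j k hx hxe hxe'

theorem normSqAt_chart (g : KahlerMetric n X) (hs : IsFrameOver E s) (e e' : Chart n X) {x : X}
    (hx : x ∈ V) (hxe : x ∈ e.1.source) (hxe' : x ∈ e'.1.source) :
    normSqAt h hV g s e' x = normSqAt h hV g s e x := by
  rw [normSqAt, normSqAt, g.coeff_chart e e' hxe hxe',
    ← formNormSqOf_changeCoord (jacobian_isUnit g e e' hxe hxe')
      (g.coeff_posDef e (e.1.map_source hxe)).isUnit_det]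
  congr 1
  funext j k
  exact curvatureAt_chart h hV hs e e' j k hx hxe hxe'

theorem normSqAt_change (g : KahlerMetric n X) (hs : IsFrameOver E s) (ht : IsFrameOver E t)
    (e : Chart n X) {x : X} (hx : x ∈ V) (hxe : x ∈ e.1.source) :
    normSqAt h hV g t e x = normSqAt h hV g s e x := by
  rw [normSqAt, gram_change h hV hs t hx]
  simp only [curvatureAt_change h hV hs ht e _ _ hx hxe]
  exact formNormSqOf_conj (hs.transition_mul ht hx) (ht.transition_mul hs hx)
    (gram_posDef h hV hs hx).isUnit_det _ _

theorem meanAt_change (g : KahlerMetric n X) (hs : IsFrameOver E s) (ht : IsFrameOver E t)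
    (e : Chart n X) {x : X} (hx : x ∈ V) (hxe : x ∈ e.1.source) :
    meanAt h hV g t e x = ht.transition s x * meanAt h hV g s e x * hs.transition t x := by
  simp only [meanAt, curvatureAt_change h hV hs ht e _ _ hx hxe]
  exact contraction_conj _ _ _ _

theorem endPair_meanAt_change (g : KahlerMetric n X) (hs : IsFrameOver E s)
    (ht : IsFrameOver E t) (e : Chart n X) {x : X} (hx : x ∈ V) (hxe : x ∈ e.1.source) :
    endPair (gram h hV t x) (meanAt h hV g t e x) (meanAt h hV g t e x) =
      endPair (gram h hV s x) (meanAt h hV g s e x) (meanAt h hV g s e x) := by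
  rw [gram_change h hV hs t hx, meanAt_change h hV g hs ht e hx hxe]
  exact endPair_conj (hs.transition_mul ht hx) (ht.transition_mul hs hx)
    (gram_posDef h hV hs hx).isUnit_det _ _

/-- The Hitchin–Simpson mean curvature at `x` minus `c I` in a frame and a chart. -/
def deviationAt (g : KahlerMetric n X) (hs : IsFrameOver E s)
    (φ : E ⟶ tensor E (cotangentSheaf n X)) (c : ℂ) (e : Chart n X) (hVe : V ≤ e.dom) (x : X) :
    Matrix ι ι ℂ :=
  meanAt h hV g s e x + contraction (g.coeff e (e.1 x))
    (bracket (gram h hV s x) fun α => fieldAt hs φ e hVe α x) - c • 1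

/-- Every summand is the matrix of an endomorphism, the scalar term included since `Q P = 1`. The
chart stays fixed. -/
theorem deviationAt_change (g : KahlerMetric n X) (hs : IsFrameOver E s)
    (ht : IsFrameOver E t) (φ : E ⟶ tensor E (cotangentSheaf n X)) (c : ℂ) (e : Chart n X)
    (hVe : V ≤ e.dom) {x : X} (hx : x ∈ V) :
    deviationAt h hV g ht φ c e hVe x =
      ht.transition s x * deviationAt h hV g hs φ c e hVe x * hs.transition t x := by
  have e1 : (fun j k => bracket (gram h hV t x) (fun α => fieldAt ht φ e hVe α x) j k) =
      fun j k => ht.transition s x *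
        bracket (gram h hV s x) (fun α => fieldAt hs φ e hVe α x) j k * hs.transition t x := by
    funext j k
    rw [gram_change h hV hs t hx]
    simp only [fieldAt_change hs ht φ e hVe _ hx]
    exact bracket_conj (hs.transition_mul ht hx) (ht.transition_mul hs hx)
      (gram_posDef h hV hs hx).isUnit_det _ _ _
  have e2 : contraction (g.coeff e (e.1 x))
      (bracket (gram h hV t x) fun α => fieldAt ht φ e hVe α x) = ht.transition s x *
        contraction (g.coeff e (e.1 x))
          (bracket (gram h hV s x) fun α => fieldAt hs φ e hVe α x) * hs.transition t x :=
    (congrArg (contraction (g.coeff e (e.1 x))) e1).trans (contraction_conj _ _ _ _)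
  rw [deviationAt, e2, meanAt_change h hV g hs ht e hx (hVe hx), deviationAt]
  have e3 : (c • 1 : Matrix κ κ ℂ) =
      ht.transition s x * (c • (1 : Matrix ι ι ℂ)) * hs.transition t x := by
    rw [Matrix.mul_smul, Matrix.smul_mul, Matrix.mul_one, ht.transition_mul hs hx]
  rw [e3]
  simp only [Matrix.mul_add, Matrix.mul_sub, Matrix.add_mul, Matrix.sub_mul]

theorem endPair_deviationAt_change (g : KahlerMetric n X) (hs : IsFrameOver E s)
    (ht : IsFrameOver E t) (φ : E ⟶ tensor E (cotangentSheaf n X)) (c : ℂ) (e : Chart n X)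
    (hVe : V ≤ e.dom) {x : X} (hx : x ∈ V) :
    endPair (gram h hV t x) (deviationAt h hV g ht φ c e hVe x)
        (deviationAt h hV g ht φ c e hVe x) =
      endPair (gram h hV s x) (deviationAt h hV g hs φ c e hVe x)
        (deviationAt h hV g hs φ c e hVe x) := by
  rw [gram_change h hV hs t hx, deviationAt_change h hV g hs ht φ c e hVe hx]
  exact endPair_conj (hs.transition_mul ht hx) (ht.transition_mul hs hx)
    (gram_posDef h hV hs hx).isUnit_det _ _

theorem normSqAt_res (g : KahlerMetric n X) (hW : W ≤ V) (s : ι → Sec E V) (e : Chart n X) {x : X}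
    (hx : x ∈ W) (hxe : x ∈ e.1.source) :
    normSqAt h (hW.trans hV) g (fun i => res E hW (s i)) e x = normSqAt h hV g s e x := by
  rw [normSqAt, normSqAt, gram_res h hV hW s hx]
  simp only [curvatureAt_res h hV hW s e _ _ hx hxe]

theorem meanAt_res (g : KahlerMetric n X) (hW : W ≤ V) (s : ι → Sec E V) (e : Chart n X) {x : X}
    (hx : x ∈ W) (hxe : x ∈ e.1.source) :
    meanAt h (hW.trans hV) g (fun i => res E hW (s i)) e x = meanAt h hV g s e x := by
  simp only [meanAt, curvatureAt_res h hV hW s e _ _ hx hxe]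

theorem deviationAt_res (g : KahlerMetric n X) (hs : IsFrameOver E s) (hW : W ≤ V)
    (φ : E ⟶ tensor E (cotangentSheaf n X)) (c : ℂ) (e : Chart n X) (hVe : V ≤ e.dom) {x : X}
    (hx : x ∈ W) :
    deviationAt h (hW.trans hV) g (hs.res hW) φ c e (hW.trans hVe) x =
      deviationAt h hV g hs φ c e hVe x := by
  rw [deviationAt, deviationAt, meanAt_res h hV g hW s e hx (hVe (hW hx)), gram_res h hV hW s hx]
  simp only [fieldAt_res hs hW φ e hVe _ hx]

/-! ### Local frames -/

namespace LocalFrame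
variable {x : X}

theorem mem_source (T : LocalFrame E U x) : x ∈ T.chart.1.source := T.dom_le_chart T.mem_dom

theorem gramAt_eq (T : LocalFrame E U x) : T.gramAt h = HYM.gram h T.dom_le T.sec x := by
  have : T.gramAt h = HYM.gram h T.dom_le T.sec (T.chart.1.symm (T.chart.1 x)) := rfl
  rw [this, T.chart.1.left_inv T.mem_source]

theorem meanCurvature_eq (T : LocalFrame E U x) (g : KahlerMetric n X) :
    T.meanCurvature g h = meanAt h T.dom_le g T.sec T.chart x := rfl

theorem curvatureNormSq_eq (T : LocalFrame E U x) (g : KahlerMetric n X) :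
    T.curvatureNormSq g h = normSqAt h T.dom_le g T.sec T.chart x := by
  rw [curvatureNormSq, formNormSq_eq, gramAt_eq]
  rfl

theorem fieldMatrix_eq (T : LocalFrame E U x) (φ : E ⟶ tensor E (cotangentSheaf n X))
    (α : Fin n) : T.fieldMatrix φ α = fieldAt T.isFrame φ T.chart T.dom_le_chart α x := by
  ext i j
  simp only [fieldMatrix, fieldAt, of_apply]
  rw [IsFrameOver.coord_eq, Hol.extend_of_mem _ T.mem_dom]

theorem deviation_eq (T : LocalFrame E U x) (g : KahlerMetric n X)
    (φ : E ⟶ tensor E (cotangentSheaf n X)) (c : ℂ) :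
    T.hitchinSimpsonMeanCurvature g h φ - c • 1 =
      deviationAt h T.dom_le g T.isFrame φ c T.chart T.dom_le_chart x := by
  have : T.hitchinSimpsonMeanCurvature g h φ = T.meanCurvature g h +
      contraction (T.metricAt g) (bracket (T.gramAt h) fun α => T.fieldMatrix φ α) := rfl
  rw [this, gramAt_eq]
  simp only [fieldMatrix_eq]
  rfl

end LocalFrame

/-- The invariants of a metric at `x` computed in a local frame agree with those computed in any
frame near `x`. -/
theorem curvatureNormSq_eq_normSqAt {x : X} (T : LocalFrame E U x) (g : KahlerMetric n X)
    (hs : IsFrameOver E s) (e : Chart n X) (hx : x ∈ V) (hxe : x ∈ e.1.source) :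
    T.curvatureNormSq g h = normSqAt h hV g s e x := by
  have hW : x ∈ T.dom ⊓ V := ⟨T.mem_dom, hx⟩
  have hT := IsFrameOver.res (isFrame_iff.1 T.isFrame) (inf_le_left : T.dom ⊓ V ≤ T.dom)
  have hs' := hs.res (inf_le_right : T.dom ⊓ V ≤ V)
  rw [T.curvatureNormSq_eq h g, ← normSqAt_res h T.dom_le g inf_le_left T.sec T.chart hW
    T.mem_source, ← normSqAt_res h hV g (inf_le_right : T.dom ⊓ V ≤ V) s e hW hxe,
    normSqAt_chart h _ g hT e T.chart hW hxe T.mem_source]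
  exact normSqAt_change h _ g hs' hT e hW hxe

theorem endNorm_mean_eq {x : X} (T : LocalFrame E U x) (g : KahlerMetric n X)
    (hs : IsFrameOver E s) (e : Chart n X) (hx : x ∈ V) (hxe : x ∈ e.1.source) :
    endNorm (T.gramAt h) (T.meanCurvature g h) =
      Real.sqrt (endPair (gram h hV s x) (meanAt h hV g s e x) (meanAt h hV g s e x)).re := by
  have hW : x ∈ T.dom ⊓ V := ⟨T.mem_dom, hx⟩
  have hT := IsFrameOver.res (isFrame_iff.1 T.isFrame) (inf_le_left : T.dom ⊓ V ≤ T.dom)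
  have hs' := hs.res (inf_le_right : T.dom ⊓ V ≤ V)
  rw [endNorm_eq, T.gramAt_eq, T.meanCurvature_eq,
    ← meanAt_res h T.dom_le g inf_le_left T.sec T.chart hW T.mem_source,
    ← meanAt_res h hV g (inf_le_right : T.dom ⊓ V ≤ V) s e hW hxe,
    meanAt_chart h _ g hT e T.chart hW hxe T.mem_source,
    ← gram_res h T.dom_le inf_le_left T.sec hW, ← gram_res h hV inf_le_right s hW,
    endPair_meanAt_change h _ g hs' hT e hW hxe]

theorem trace_mean_eq {x : X} (T : LocalFrame E U x) (g : KahlerMetric n X)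
    (hs : IsFrameOver E s) (e : Chart n X) (hx : x ∈ V) (hxe : x ∈ e.1.source) :
    (T.meanCurvature g h).trace = (meanAt h hV g s e x).trace := by
  have hW : x ∈ T.dom ⊓ V := ⟨T.mem_dom, hx⟩
  have hT := IsFrameOver.res (isFrame_iff.1 T.isFrame) (inf_le_left : T.dom ⊓ V ≤ T.dom)
  have hs' := hs.res (inf_le_right : T.dom ⊓ V ≤ V)
  rw [T.meanCurvature_eq,
    ← meanAt_res h T.dom_le g inf_le_left T.sec T.chart hW T.mem_source,
    ← meanAt_res h hV g (inf_le_right : T.dom ⊓ V ≤ V) s e hW hxe,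
    meanAt_chart h _ g hT e T.chart hW hxe T.mem_source,
    meanAt_change h _ g hs' hT e hW hxe, trace_conj (hs'.transition_mul hT hW)]

/-- The comparison frame lives in the chart of `T`, so only the frame changes. The Higgs components
depend on the chart, and this choice avoids having to transform them. -/
theorem endNorm_deviation_eq {x : X} (T : LocalFrame E U x) (g : KahlerMetric n X)
    (φ : E ⟶ tensor E (cotangentSheaf n X)) (c : ℂ) (hVT : V ≤ T.chart.dom)
    (hs : IsFrameOver E s) (hx : x ∈ V) :
    endNorm (T.gramAt h) (T.hitchinSimpsonMeanCurvature g h φ - c • 1) =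
      Real.sqrt (endPair (gram h hV s x) (deviationAt h hV g hs φ c T.chart hVT x)
        (deviationAt h hV g hs φ c T.chart hVT x)).re := by
  have hW : x ∈ T.dom ⊓ V := ⟨T.mem_dom, hx⟩
  have hT := IsFrameOver.res (isFrame_iff.1 T.isFrame) (inf_le_left : T.dom ⊓ V ≤ T.dom)
  have hs' := hs.res (inf_le_right : T.dom ⊓ V ≤ V)
  rw [endNorm_eq, T.gramAt_eq, T.deviation_eq,
    ← deviationAt_res h T.dom_le g T.isFrame inf_le_left φ c T.chart T.dom_le_chart hW,
    ← deviationAt_res h hV g hs inf_le_right φ c T.chart hVT hW,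
    ← gram_res h T.dom_le inf_le_left T.sec hW, ← gram_res h hV inf_le_right s hW,
    endPair_deviationAt_change h _ g hs' hT φ c T.chart _ hW]

end manifold
end metrics

/-! ### Metrics on tensor products and Whitney sums -/

section posDef
open Matrix
variable {ι κ : Type} [Fintype ι] [DecidableEq ι] [Fintype κ] [DecidableEq κ]

/-- A congruence by an injective matrix; the left inverse `Q` gives the injectivity. -/
theorem posDef_change {P : Matrix ι κ ℂ} {Q : Matrix κ ι ℂ} (hQP : Q * P = 1)
    {H : Matrix ι ι ℂ} (hH : H.PosDef) : (Pᵀ * H * Pᴴᵀ).PosDef := by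
  have e : Pᵀ * H * Pᴴᵀ = Pᴴᵀᴴ * H * Pᴴᵀ := by
    congr 2
    ext i j
    simp
  rw [e]
  refine hH.conjTranspose_mul_mul_same fun a b hab => ?_
  have h1 : Qᴴᵀ * Pᴴᵀ = 1 := by
    rw [← transpose_mul, ← conjTranspose_mul, hQP]
    simp
  have := congrArg (Qᴴᵀ *ᵥ ·) hab
  simpa [h1] using this

end posDef

section tensorMetric
open Matrix Filter Topology
open scoped Kronecker
variable {n : ℕ} {X : Type} [TopologicalSpace X] [ChartedSpace (Fin n → ℂ) X]
variable {E F : OModule n X} {ι κ ι' κ' : Type} [Fintype ι] [DecidableEq ι] [Fintype κ]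
  [DecidableEq κ] [Fintype ι'] [DecidableEq ι'] [Fintype κ'] [DecidableEq κ']
  {U V W : Opens X}

theorem LocallyFreeOn.mono {U' : Opens X} (hE : LocallyFreeOn E U) (hU : U' ≤ U) :
    LocallyFreeOn E U' := by
  intro x hx
  obtain ⟨V, hxV, -, r, s, hs⟩ := hE x (hU hx)
  exact ⟨V ⊓ U', ⟨hxV, hx⟩, inf_le_right, r, _, IsFrameOver.res hs inf_le_left⟩

theorem exists_common_frames (hE : LocallyFreeOn E U) (hF : LocallyFreeOn F U) (hV : V ≤ U)
    {x : X} (hx : x ∈ V) : ∃ (W : Opens X) (_ : W ≤ V), x ∈ W ∧ ∃ (r r' : ℕ)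
      (s : Fin r → Sec E W) (t : Fin r' → Sec F W), IsFrameOver E s ∧ IsFrameOver F t := by
  obtain ⟨W₁, hx₁, -, r, s, hs⟩ := hE x (hV hx)
  obtain ⟨W₂, hx₂, -, r', t, ht⟩ := hF x (hV hx)
  exact ⟨W₁ ⊓ W₂ ⊓ V, inf_le_right, ⟨⟨hx₁, hx₂⟩, hx⟩, r, r', _, _,
    IsFrameOver.res hs (inf_le_left.trans inf_le_left),
    IsFrameOver.res ht (inf_le_left.trans inf_le_right)⟩

/-! ### The tensor metric computed in product frames -/

section tensorValue
variable {s : ι → Sec E W} {t : κ → Sec F W} {s' : ι' → Sec E W} {t' : κ' → Sec F W}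

/-- From this formula the transition matrix, the Higgs components and the determinant of product
frames all become Kronecker expressions. -/
theorem repr_tmul (hs : IsFrameOver E s) (ht : IsFrameOver F t) (u : Sec E W) (v : Sec F W)
    (p : ι × κ) : (isFrameOver_tensor hs ht).basis.repr (tmul u v) p =
      hs.basis.repr u p.1 * ht.basis.repr v p.2 := by
  refine (isFrameOver_tensor hs ht).repr_eq
    (a := fun p => hs.basis.repr u p.1 * ht.basis.repr v p.2) ?_ p
  rw [Fintype.sum_prod_type, ← tmul_sum_sum, hs.sum_repr, ht.sum_repr]

theorem transition_tensor (hs : IsFrameOver E s) (ht : IsFrameOver F t) (s' : ι' → Sec E W)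
    (t' : κ' → Sec F W) (x : X) :
    (isFrameOver_tensor hs ht).transition (fun p : ι' × κ' => tmul (s' p.1) (t' p.2)) x =
      hs.transition s' x ⊗ₖ ht.transition t' x := by
  ext p q
  by_cases hx : x ∈ W
  · rw [IsFrameOver.transition_apply _ _ hx, repr_tmul, kronecker_apply,
      IsFrameOver.transition_apply _ _ hx, IsFrameOver.transition_apply _ _ hx]
    rfl
  · simp [IsFrameOver.transition, hx]

/-- The values at `x` of the coordinates of a section. -/
def coordAt {E : OModule n X} {s : ι → Sec E W} (hs : IsFrameOver E s) (u : Sec E W) (x : X) :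
    ι → ℂ :=
  fun i => (hs.basis.repr u i).extend x

theorem coordAt_change {E : OModule n X} {s : ι → Sec E W} {s' : κ → Sec E W}
    (hs : IsFrameOver E s) (hs' : IsFrameOver E s') (u : Sec E W) {x : X} (hx : x ∈ W) :
    coordAt hs u x = hs.transition s' x *ᵥ coordAt hs' u x := by
  have := hs'.basis.toMatrix_mulVec_repr hs.basis u
  funext i
  rw [coordAt, Hol.extend_of_mem _ hx, ← congrFun this i, ← Hol.evalHom_apply, mulVec, dotProduct,
    map_sum]
  refine Finset.sum_congr rfl fun k _ => ?_
  have e : hs.basis.toMatrix hs'.basis i k = hs.basis.repr (s' k) i := by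
    rw [Module.Basis.toMatrix_apply, hs'.basis_apply]
  change _ = hs.transition s' x i k * coordAt hs' u x k
  rw [e, map_mul, hs.transition_apply s' hx, coordAt, Hol.extend_of_mem _ hx]
  rfl

theorem coordAt_res {E : OModule n X} {s : ι → Sec E V} (hs : IsFrameOver E s) (hW : W ≤ V)
    (u : Sec E V) {x : X} (hx : x ∈ W) {s' : ι → Sec E W} (hs' : IsFrameOver E s')
    (e : ∀ i, s' i = res E hW (s i)) : coordAt hs' (res E hW u) x = coordAt hs u x := by
  funext i
  rw [coordAt, coordAt, hs.repr_res hW hs' e, Hol.extend_of_mem _ hx, Hol.extend_of_mem _ (hW hx),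
    Hol.eval_res]

theorem coordAt_add {E : OModule n X} {s : ι → Sec E W} (hs : IsFrameOver E s) (u v : Sec E W)
    {x : X} (hx : x ∈ W) : coordAt hs (u + v) x = coordAt hs u x + coordAt hs v x := by
  funext i
  simp only [coordAt, map_add, Pi.add_apply, Finsupp.add_apply, Hol.extend_of_mem _ hx]
  rfl

theorem coordAt_smul {E : OModule n X} {s : ι → Sec E W} (hs : IsFrameOver E s) (f : Hol n W)
    (u : Sec E W) {x : X} (hx : x ∈ W) :
    coordAt hs (f • u) x = f.eval x hx • coordAt hs u x := by
  funext i
  simp only [coordAt, map_smul, Pi.smul_apply, Finsupp.smul_apply, Hol.extend_of_mem _ hx]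
  rfl

variable (h₁ : HermitianMetric E U) (h₂ : HermitianMetric F U)

/-- The tensor product of two metrics, computed in frames. -/
def tensorValue (hW : W ≤ U) (hs : IsFrameOver E s) (ht : IsFrameOver F t)
    (u v : Sec (tensor E F) W) (x : X) : ℂ :=
  coordAt (isFrameOver_tensor hs ht) u x ⬝ᵥ
    ((gram h₁ hW s x ⊗ₖ gram h₂ hW t x) *ᵥ star (coordAt (isFrameOver_tensor hs ht) v x))

theorem form_mulVec {P : Matrix ι κ ℂ} (M : Matrix ι ι ℂ) (a b : κ → ℂ) :
    (P *ᵥ a) ⬝ᵥ (M *ᵥ star (P *ᵥ b)) = a ⬝ᵥ ((Pᵀ * M * Pᴴᵀ) *ᵥ star b) := by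
  rw [star_mulVec, ← mulVec_transpose, ← vecMul_transpose P a, ← dotProduct_mulVec]
  simp only [mulVec_mulVec, Matrix.mul_assoc]

/-- The transition matrix of product frames is the Kronecker product of the transition matrices, so
the change of coordinates cancels against the change of the two Gram matrices. -/
theorem tensorValue_change (hW : W ≤ U) (hs : IsFrameOver E s) (ht : IsFrameOver F t)
    (hs' : IsFrameOver E s') (ht' : IsFrameOver F t') (u v : Sec (tensor E F) W) {x : X}
    (hx : x ∈ W) :
    tensorValue h₁ h₂ hW hs ht u v x = tensorValue h₁ h₂ hW hs' ht' u v x := by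
  rw [tensorValue, coordAt_change (isFrameOver_tensor hs ht) (isFrameOver_tensor hs' ht') u hx,
    coordAt_change (isFrameOver_tensor hs ht) (isFrameOver_tensor hs' ht') v hx, form_mulVec,
    transition_tensor hs ht s' t' x, tensorValue, gram_change h₁ hW hs s' hx,
    gram_change h₂ hW ht t' hx]
  have e : (hs.transition s' x ⊗ₖ ht.transition t' x)ᴴᵀ =
      (hs.transition s' x)ᴴᵀ ⊗ₖ (ht.transition t' x)ᴴᵀ := by
    ext
    simp
  rw [mul_kronecker_mul, mul_kronecker_mul, e, ← kroneckerMap_transpose]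

theorem tensorValue_res (hW : W ≤ U) (hV : V ≤ W) (hs : IsFrameOver E s) (ht : IsFrameOver F t)
    (u v : Sec (tensor E F) W) {x : X} (hx : x ∈ V) :
    tensorValue h₁ h₂ (hV.trans hW) (hs.res hV) (ht.res hV) (res _ hV u) (res _ hV v) x =
      tensorValue h₁ h₂ hW hs ht u v x := by
  have e : ∀ p : ι × κ, tmul (res E hV (s p.1)) (res F hV (t p.2)) =
      res _ hV (tmul (s p.1) (t p.2)) := fun p => (res_tmul hV _ _).symm
  rw [tensorValue, tensorValue, gram_res h₁ hW hV s hx, gram_res h₂ hW hV t hx,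
    coordAt_res (isFrameOver_tensor hs ht) hV u hx _ e,
    coordAt_res (isFrameOver_tensor hs ht) hV v hx _ e]

end tensorValue

variable (h₁ : HermitianMetric E U) (h₂ : HermitianMetric F U)
  (hE : LocallyFreeOn E U) (hF : LocallyFreeOn F U)

theorem tensorValue_indep {W W' : Opens X} {s : ι → Sec E W} {t : κ → Sec F W} {s' : ι' → Sec E W'}
    {t' : κ' → Sec F W'} (hV : V ≤ U) (hW : W ≤ V) (hW' : W' ≤ V) (hs : IsFrameOver E s)
    (ht : IsFrameOver F t) (hs' : IsFrameOver E s') (ht' : IsFrameOver F t')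
    (u v : Sec (tensor E F) V) {x : X} (hx : x ∈ W) (hx' : x ∈ W') :
    tensorValue h₁ h₂ (hW.trans hV) hs ht (res _ hW u) (res _ hW v) x =
      tensorValue h₁ h₂ (hW'.trans hV) hs' ht' (res _ hW' u) (res _ hW' v) x := by
  have hm : x ∈ W ⊓ W' := ⟨hx, hx'⟩
  rw [← tensorValue_res h₁ h₂ (hW.trans hV) (inf_le_left : W ⊓ W' ≤ W) hs ht _ _ hm,
    ← tensorValue_res h₁ h₂ (hW'.trans hV) (inf_le_right : W ⊓ W' ≤ W') hs' ht' _ _ hm,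
    tensorValue_change h₁ h₂ _ _ _ (hs'.res inf_le_right) (ht'.res inf_le_right) _ _ hm]
  simp only [res_res]

-- One number serves all product frames on all neighbourhoods of `x`: frames over different open
-- sets are compared on the intersection. It becomes the value of the metric at `x`.
include hE hF in
theorem exists_tensorValue (hV : V ≤ U) (u v : Sec (tensor E F) V) (x : X) (hx : x ∈ V) :
    ∃ c : ℂ, ∀ (W : Opens X) (hW : W ≤ V) (_ : x ∈ W) (r r' : ℕ) (s : Fin r → Sec E W)
      (t : Fin r' → Sec F W) (hs : IsFrameOver E s) (ht : IsFrameOver F t),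
      c = tensorValue h₁ h₂ (hW.trans hV) hs ht (res _ hW u) (res _ hW v) x := by
  obtain ⟨W, hW, hxW, r, r', s, t, hs, ht⟩ := exists_common_frames hE hF hV hx
  exact ⟨_, fun W' hW' hx' _ _ s' t' hs' ht' =>
    tensorValue_indep h₁ h₂ hV hW hW' hs ht hs' ht' u v hxW hx'⟩

/-- The value of the tensor product metric. -/
def tensorInner (hV : V ≤ U) (u v : Sec (tensor E F) V) (x : X) : ℂ :=
  open Classical in
  if hx : x ∈ V then (exists_tensorValue h₁ h₂ hE hF hV u v x hx).choose else 0

theorem tensorInner_eq {s : ι → Sec E W} {t : κ → Sec F W} (hV : V ≤ U)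
    (u v : Sec (tensor E F) V) (hW : W ≤ V) {x : X} (hx : x ∈ W) (hs : IsFrameOver E s)
    (ht : IsFrameOver F t) : tensorInner h₁ h₂ hE hF hV u v x =
      tensorValue h₁ h₂ (hW.trans hV) hs ht (res _ hW u) (res _ hW v) x := by
  obtain ⟨W', hW', hxW', r, r', s', t', hs', ht'⟩ := exists_common_frames hE hF hV (hW hx)
  rw [tensorInner, dif_pos (hW hx),
    (exists_tensorValue h₁ h₂ hE hF hV u v x (hW hx)).choose_spec W' hW' hxW' _ _ s' t' hs' ht']
  exact tensorValue_indep h₁ h₂ hV hW' hW hs' ht' hs ht u v hxW' hx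

theorem tensorInner_add_left (hV : V ≤ U) (u u' v : Sec (tensor E F) V) {x : X} (hx : x ∈ V) :
    tensorInner h₁ h₂ hE hF hV (u + u') v x =
      tensorInner h₁ h₂ hE hF hV u v x + tensorInner h₁ h₂ hE hF hV u' v x := by
  obtain ⟨W, hW, hxW, r, r', s, t, hs, ht⟩ := exists_common_frames hE hF hV hx
  simp only [tensorInner_eq h₁ h₂ hE hF hV _ _ hW hxW hs ht]
  rw [tensorValue, res_add, coordAt_add _ _ _ hxW, add_dotProduct]
  rfl

theorem tensorInner_smul_left (hV : V ≤ U) (f : Hol n V) (u v : Sec (tensor E F) V) {x : X}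
    (hx : x ∈ V) : tensorInner h₁ h₂ hE hF hV (f • u) v x =
      f.eval x hx * tensorInner h₁ h₂ hE hF hV u v x := by
  obtain ⟨W, hW, hxW, r, r', s, t, hs, ht⟩ := exists_common_frames hE hF hV hx
  simp only [tensorInner_eq h₁ h₂ hE hF hV _ _ hW hxW hs ht]
  rw [tensorValue, res_smul, coordAt_smul _ _ _ hxW, smul_dotProduct]
  rfl

theorem tensorInner_conj_symm (hV : V ≤ U) (u v : Sec (tensor E F) V) {x : X} (hx : x ∈ V) :
    tensorInner h₁ h₂ hE hF hV v u x = star (tensorInner h₁ h₂ hE hF hV u v x) := by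
  obtain ⟨W, hW, hxW, r, r', s, t, hs, ht⟩ := exists_common_frames hE hF hV hx
  simp only [tensorInner_eq h₁ h₂ hE hF hV _ _ hW hxW hs ht]
  have hH : (gram h₁ (hW.trans hV) s x ⊗ₖ gram h₂ (hW.trans hV) t x)ᴴ = _ :=
    ((gram_posDef h₁ (hW.trans hV) hs hxW).kronecker
      (gram_posDef h₂ (hW.trans hV) ht hxW)).isHermitian
  rw [tensorValue, tensorValue, ← star_dotProduct_star, star_mulVec, star_star, hH,
    dotProduct_mulVec, dotProduct_comm]

theorem tensorInner_res {V' : Opens X} (hV : V ≤ U) (hV' : V' ≤ V) (u v : Sec (tensor E F) V)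
    {x : X} (hx : x ∈ V') : tensorInner h₁ h₂ hE hF (hV'.trans hV) (res _ hV' u) (res _ hV' v) x =
      tensorInner h₁ h₂ hE hF hV u v x := by
  obtain ⟨W, hW, hxW, r, r', s, t, hs, ht⟩ := exists_common_frames hE hF (hV'.trans hV) hx
  rw [tensorInner_eq h₁ h₂ hE hF hV _ _ (hW.trans hV') hxW hs ht,
    tensorInner_eq h₁ h₂ hE hF _ _ _ hW hxW hs ht, res_res, res_res]

theorem tensorInner_tmul (hV : V ≤ U) {s : ι → Sec E V} {t : κ → Sec F V} (hs : IsFrameOver E s)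
    (ht : IsFrameOver F t) {x : X} (hx : x ∈ V) :
    (Matrix.of fun p q : ι × κ => tensorInner h₁ h₂ hE hF hV (tmul (s p.1) (t p.2))
      (tmul (s q.1) (t q.2)) x) = gram h₁ hV s x ⊗ₖ gram h₂ hV t x := by
  have hc : ∀ p : ι × κ, coordAt (isFrameOver_tensor hs ht) (tmul (s p.1) (t p.2)) x =
      Pi.single p 1 := by
    intro p
    funext q
    have := (isFrameOver_tensor hs ht).basis.repr_self_apply p q
    rw [IsFrameOver.basis_apply] at this
    rw [coordAt, Hol.extend_of_mem _ hx, this, Pi.single_apply]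
    by_cases h : p = q
    · subst h
      rw [if_pos rfl, if_pos rfl]
      rfl
    · rw [if_neg h, if_neg (Ne.symm h)]
      rfl
  ext p q
  rw [of_apply, tensorInner_eq h₁ h₂ hE hF hV _ _ le_rfl hx hs ht, res_self, res_self, tensorValue,
    hc, hc]
  simp

variable [IsManifold 𝓘(ℂ, Fin n → ℂ) ∞ X]

theorem tensorInner_smooth (hV : V ≤ U) (u v : Sec (tensor E F) V) (e : Chart n X) :
    ContDiffOn ℝ ∞ (fun z => tensorInner h₁ h₂ hE hF hV u v (e.1.symm z))
      (e.1.target ∩ e.1.symm ⁻¹' V) := by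
  intro z hz
  refine ContDiffAt.contDiffWithinAt ?_
  obtain ⟨W, hW, hxW, r, r', s, t, hs, ht⟩ := exists_common_frames hE hF hV hz.2
  have hcoord : ∀ (w : Sec (tensor E F) W) p,
      ContDiffAt ℝ ∞ (fun z => coordAt (isFrameOver_tensor hs ht) w (e.1.symm z) p) z :=
    fun w p => (Hol.contDiffAt_extend _ e hz.1 hxW).restrict_scalars ℝ
  have hg := (gram_smooth h₁ (hW.trans hV) s e hz.1 hxW).kronecker
    (gram_smooth h₂ (hW.trans hV) t e hz.1 hxW)
  have : ContDiffAt ℝ ∞ (fun z => tensorValue h₁ h₂ (hW.trans hV) hs ht (res _ hW u) (res _ hW v)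
      (e.1.symm z)) z := by
    simp only [tensorValue, dotProduct, mulVec]
    exact ContDiffAt.sum fun p _ => (hcoord _ p).mul (ContDiffAt.sum fun q _ =>
      (hg p q).mul (contDiffAt_star (hcoord _ q)))
  refine this.congr_of_eventuallyEq ?_
  filter_upwards [eventually_mem_chart e hz.1 hxW] with w hw
  exact tensorInner_eq h₁ h₂ hE hF hV u v hW hw.2 hs ht

/-- The tensor product of two Hermitian metrics. -/
def tensorMetric : HermitianMetric (tensor E F) U where
  inner V hV u v x := tensorInner h₁ h₂ hE hF hV u v x
  add_left V hV u u' v x hx := tensorInner_add_left h₁ h₂ hE hF hV u u' v hx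
  smul_left V hV f u v x hx := tensorInner_smul_left h₁ h₂ hE hF hV f u v hx
  conj_symm V hV u v x hx := tensorInner_conj_symm h₁ h₂ hE hF hV u v hx
  res_eq V W hV hW u v x hx := tensorInner_res h₁ h₂ hE hF hV hW u v hx
  smooth V hV u v e := tensorInner_smooth h₁ h₂ hE hF hV u v e
  posDef V hV r σ hσ x hx := by
    -- The frame `σ` need not consist of products. Near `x` its Gram matrix is congruent to that of
    -- a product frame, a Kronecker product of positive definite matrices.
    obtain ⟨W, hW, hxW, r, r', s, t, hs, ht⟩ := exists_common_frames hE hF hV hx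
    have hσ' := IsFrameOver.res (isFrame_iff.1 hσ) hW
    have hst := isFrameOver_tensor hs ht
    have e1 := sesquilinear_change hxW
      (fun a b => tensorInner h₁ h₂ hE hF (hW.trans hV) a b x)
      (fun a b c => tensorInner_add_left h₁ h₂ hE hF _ a b c hxW)
      (fun f a b => tensorInner_smul_left h₁ h₂ hE hF _ f a b hxW)
      (fun a b => tensorInner_conj_symm h₁ h₂ hE hF _ a b hxW) hst fun i => res _ hW (σ i)
    simp only [tensorInner_res h₁ h₂ hE hF hV hW _ _ hxW] at e1
    rw [e1, tensorInner_tmul h₁ h₂ hE hF _ hs ht hxW]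
    exact posDef_change (hσ'.transition_mul hst hxW)
      ((gram_posDef h₁ _ hs hxW).kronecker (gram_posDef h₂ _ ht hxW))

theorem gram_tensorMetric (hV : V ≤ U) {s : ι → Sec E V} {t : κ → Sec F V} (hs : IsFrameOver E s)
    (ht : IsFrameOver F t) {x : X} (hx : x ∈ V) :
    gram (tensorMetric h₁ h₂ hE hF) hV (fun p : ι × κ => tmul (s p.1) (t p.2)) x =
      gram h₁ hV s x ⊗ₖ gram h₂ hV t x :=
  tensorInner_tmul h₁ h₂ hE hF hV hs ht hx

end tensorMetric

/-! ### The metric on a Whitney sum -/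

section sumMetric
open Matrix Filter Topology Limits
variable {n : ℕ} {X : Type} [TopologicalSpace X] [ChartedSpace (Fin n → ℂ) X]
variable {E F : OModule n X} {ι κ : Type} [Fintype ι] [DecidableEq ι] [Fintype κ]
  [DecidableEq κ] {U V W : Opens X} (h₁ : HermitianMetric E U) (h₂ : HermitianMetric F U)
  (hE : LocallyFreeOn E U) (hF : LocallyFreeOn F U)

theorem repr_sum {s : ι → Sec E V} {t : κ → Sec F V} (hs : IsFrameOver E s) (ht : IsFrameOver F t) (u : Sec E V) (v : Sec F V)
    (p : ι ⊕ κ) : (isFrameOver_biprod hs ht).basis.repr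
      (onSec biprod.inl V u + onSec biprod.inr V v) p =
      Sum.elim (hs.basis.repr u) (ht.basis.repr v) p := by
  refine (isFrameOver_biprod hs ht).repr_eq
    (a := Sum.elim (hs.basis.repr u) (ht.basis.repr v)) ?_ p
  rw [Fintype.sum_sum_type]
  simp only [Sum.elim_inl, Sum.elim_inr, ← map_smul, ← map_sum, hs.sum_repr, ht.sum_repr]

/-- The value of the metric on a Whitney sum. -/
def sumInner (hV : V ≤ U) (u v : Sec (E ⊞ F) V) (x : X) : ℂ :=
  h₁.inner V hV (onSec biprod.fst V u) (onSec biprod.fst V v) x +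
    h₂.inner V hV (onSec biprod.snd V u) (onSec biprod.snd V v) x

theorem sumInner_add_left (hV : V ≤ U) (u u' v : Sec (E ⊞ F) V) {x : X} (hx : x ∈ V) :
    sumInner h₁ h₂ hV (u + u') v x = sumInner h₁ h₂ hV u v x + sumInner h₁ h₂ hV u' v x := by
  simp only [sumInner, map_add, h₁.add_left V hV _ _ _ x hx, h₂.add_left V hV _ _ _ x hx]
  ring

theorem sumInner_smul_left (hV : V ≤ U) (f : Hol n V) (u v : Sec (E ⊞ F) V) {x : X}
    (hx : x ∈ V) : sumInner h₁ h₂ hV (f • u) v x = f.eval x hx * sumInner h₁ h₂ hV u v x := by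
  simp only [sumInner, map_smul, h₁.smul_left V hV _ _ _ x hx, h₂.smul_left V hV _ _ _ x hx]
  ring

theorem sumInner_conj_symm (hV : V ≤ U) (u v : Sec (E ⊞ F) V) {x : X} (hx : x ∈ V) :
    sumInner h₁ h₂ hV v u x = star (sumInner h₁ h₂ hV u v x) := by
  rw [sumInner, h₁.conj_symm V hV _ _ x hx, h₂.conj_symm V hV _ _ x hx, ← star_add]
  rfl

theorem sumInner_res {V' : Opens X} (hV : V ≤ U) (hV' : V' ≤ V) (u v : Sec (E ⊞ F) V)
    {x : X} (hx : x ∈ V') : sumInner h₁ h₂ (hV'.trans hV) (res _ hV' u) (res _ hV' v) x =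
      sumInner h₁ h₂ hV u v x := by
  simp only [sumInner, ← onSec_res, h₁.res_eq V V' hV hV' _ _ x hx, h₂.res_eq V V' hV hV' _ _ x hx]

/-- The two summands are orthogonal, because each projection annihilates the other summand. -/
theorem sumInner_elim (hV : V ≤ U) (s : ι → Sec E V) (t : κ → Sec F V) {x : X} (hx : x ∈ V) :
    (Matrix.of fun p q : ι ⊕ κ => sumInner h₁ h₂ hV
      (Sum.elim (fun i => onSec biprod.inl V (s i)) (fun j => onSec biprod.inr V (t j)) p)
      (Sum.elim (fun i => onSec biprod.inl V (s i)) (fun j => onSec biprod.inr V (t j)) q) x) =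
      fromBlocks (gram h₁ hV s x) 0 0 (gram h₂ hV t x) := by
  have h11 : ∀ u, onSec (biprod.fst : E ⊞ F ⟶ _) V (onSec biprod.inl V u) = u :=
    fun u => congrArg (fun f => onSec f V u) (biprod.inl_fst (X := E) (Y := F))
  have h12 : ∀ u, onSec (biprod.snd : E ⊞ F ⟶ _) V (onSec biprod.inl V u) = 0 :=
    fun u => congrArg (fun f => onSec f V u) (biprod.inl_snd (X := E) (Y := F))
  have h21 : ∀ u, onSec (biprod.fst : E ⊞ F ⟶ _) V (onSec biprod.inr V u) = 0 :=
    fun u => congrArg (fun f => onSec f V u) (biprod.inr_fst (X := E) (Y := F))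
  have h22 : ∀ u, onSec (biprod.snd : E ⊞ F ⟶ _) V (onSec biprod.inr V u) = u :=
    fun u => congrArg (fun f => onSec f V u) (biprod.inr_snd (X := E) (Y := F))
  have z1 : ∀ v, h₁.inner V hV 0 v x = 0 := fun v => by
    simpa using h₁.add_left V hV 0 0 v x hx
  have z2 : ∀ v, h₂.inner V hV 0 v x = 0 := fun v => by
    simpa using h₂.add_left V hV 0 0 v x hx
  have z1' : ∀ v, h₁.inner V hV v 0 x = 0 := fun v => by
    rw [h₁.conj_symm V hV 0 v x hx, z1, star_zero]
  have z2' : ∀ v, h₂.inner V hV v 0 x = 0 := fun v => by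
    rw [h₂.conj_symm V hV 0 v x hx, z2, star_zero]
  ext (p | p) (q | q) <;>
    simp [sumInner, h11, h12, h21, h22, z1, z2, z1', z2', gram]

/-- The metric on a Whitney sum. -/
def sumMetric : HermitianMetric (E ⊞ F) U where
  inner V hV u v x := sumInner h₁ h₂ hV u v x
  add_left V hV u u' v x hx := sumInner_add_left h₁ h₂ hV u u' v hx
  smul_left V hV f u v x hx := sumInner_smul_left h₁ h₂ hV f u v hx
  conj_symm V hV u v x hx := sumInner_conj_symm h₁ h₂ hV u v hx
  res_eq V W hV hW u v x hx := sumInner_res h₁ h₂ hV hW u v hx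
  smooth V hV u v e := (h₁.smooth V hV _ _ e).add (h₂.smooth V hV _ _ e)
  posDef V hV r σ hσ x hx := by
    obtain ⟨W, hW, hxW, r, r', s, t, hs, ht⟩ := exists_common_frames hE hF hV hx
    have hσ' := IsFrameOver.res (isFrame_iff.1 hσ) hW
    have hst := isFrameOver_biprod hs ht
    have e1 := sesquilinear_change hxW (fun a b => sumInner h₁ h₂ (hW.trans hV) a b x)
      (fun a b c => sumInner_add_left h₁ h₂ _ a b c hxW)
      (fun f a b => sumInner_smul_left h₁ h₂ _ f a b hxW)
      (fun a b => sumInner_conj_symm h₁ h₂ _ a b hxW) hst fun i => res _ hW (σ i)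
    simp only [sumInner_res h₁ h₂ hV hW _ _ hxW] at e1
    rw [e1, sumInner_elim h₁ h₂ _ s t hxW]
    exact posDef_change (hσ'.transition_mul hst hxW)
      (posDef_fromBlocks_diagonal (gram_posDef h₁ _ hs hxW) (gram_posDef h₂ _ ht hxW))

theorem gram_sumMetric (hV : V ≤ U) (s : ι → Sec E V) (t : κ → Sec F V) {x : X} (hx : x ∈ V) :
    gram (sumMetric h₁ h₂ hE hF) hV
      (Sum.elim (fun i => onSec biprod.inl V (s i)) (fun j => onSec biprod.inr V (t j))) x =
      fromBlocks (gram h₁ hV s x) 0 0 (gram h₂ hV t x) :=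
  sumInner_elim h₁ h₂ hV s t hx

end sumMetric

/-! ### Curvature of tensor products and Whitney sums -/

section pointwise
open Matrix Filter Topology Limits
open scoped Kronecker
variable {n : ℕ} {X : Type} [TopologicalSpace X] [ChartedSpace (Fin n → ℂ) X]
  [IsManifold 𝓘(ℂ, Fin n → ℂ) ∞ X]
variable {E F : OModule n X} {ι κ : Type} [Fintype ι] [DecidableEq ι] [Fintype κ] [DecidableEq κ]
  {U V : Opens X} {s : ι → Sec E V} {t : κ → Sec F V}

/-- The sections `s i ⊗ t j`. -/
abbrev tensorFrame (s : ι → Sec E V) (t : κ → Sec F V) : ι × κ → Sec (tensor E F) V :=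
  fun p => tmul (s p.1) (t p.2)

/-- The sections `(s i, 0)` and `(0, t j)`. -/
abbrev sumFrame (s : ι → Sec E V) (t : κ → Sec F V) : ι ⊕ κ → Sec (E ⊞ F) V :=
  Sum.elim (fun i => onSec biprod.inl V (s i)) (fun j => onSec biprod.inr V (t j))

theorem fieldAt_apply {E : OModule n X} {s : ι → Sec E V} (hs : IsFrameOver E s)
    (φ : E ⟶ tensor E (cotangentSheaf n X)) (e : Chart n X) (hVe : V ≤ e.dom) (α : Fin n) {x : X}
    (hx : x ∈ V) (i j : ι) : fieldAt hs φ e hVe α x i j =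
      (hs.basis.repr (fieldComp φ e α hVe (s j)) i).eval x hx := by
  rw [fieldAt, of_apply, Hol.extend_of_mem _ hx]

variable (h₁ : HermitianMetric E U) (h₂ : HermitianMetric F U)
  (hE : LocallyFreeOn E U) (hF : LocallyFreeOn F U) (hV : V ≤ U) (g : KahlerMetric n X)

theorem curvatureAt_tensorMetric (hs : IsFrameOver E s) (ht : IsFrameOver F t) (e : Chart n X)
    (j k : Fin n) {x : X} (hx : x ∈ V) (hxe : x ∈ e.1.source) :
    curvatureAt (tensorMetric h₁ h₂ hE hF) hV (tensorFrame s t) e j k x =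
      curvatureAt h₁ hV s e j k x ⊗ₖ (1 : Matrix κ κ ℂ) +
        (1 : Matrix ι ι ℂ) ⊗ₖ curvatureAt h₂ hV t e j k x := by
  have hzx := e.1.left_inv hxe
  have ev := eventually_mem_chart (V := V) e (e.1.map_source hxe) (by rwa [hzx])
  refine Eq.trans (curvatureOf_congr (ev.mono fun w hw =>
    gram_tensorMetric h₁ h₂ hE hF hV hs ht hw.2) j k) ?_
  exact curvatureOf_kronecker (ev.mono fun w hw => gram_smooth h₁ hV s e hw.1 hw.2)
    (ev.mono fun w hw => gram_smooth h₂ hV t e hw.1 hw.2)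
    (ev.mono fun w hw => (gram_posDef h₁ hV hs hw.2).isUnit_det)
    (ev.mono fun w hw => (gram_posDef h₂ hV ht hw.2).isUnit_det) j k

theorem meanAt_tensorMetric (hs : IsFrameOver E s) (ht : IsFrameOver F t) (e : Chart n X)
    {x : X} (hx : x ∈ V) (hxe : x ∈ e.1.source) :
    meanAt (tensorMetric h₁ h₂ hE hF) hV g (tensorFrame s t) e x =
      meanAt h₁ hV g s e x ⊗ₖ (1 : Matrix κ κ ℂ) +
        (1 : Matrix ι ι ℂ) ⊗ₖ meanAt h₂ hV g t e x := by
  simp only [meanAt, curvatureAt_tensorMetric h₁ h₂ hE hF hV hs ht e _ _ hx hxe]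
  exact contraction_kronecker _ _ _

/-- The curvature is `R₁ ⊗ 1 + 1 ⊗ R₂`. The crude factor 2 is enough, as only domination by an
integrable function is needed. -/
theorem normSqAt_tensorMetric_le (hs : IsFrameOver E s) (ht : IsFrameOver F t) (e : Chart n X)
    {x : X} (hx : x ∈ V) (hxe : x ∈ e.1.source) :
    normSqAt (tensorMetric h₁ h₂ hE hF) hV g (tensorFrame s t) e x ≤
      2 * (Fintype.card κ * normSqAt h₁ hV g s e x) +
        2 * (Fintype.card ι * normSqAt h₂ hV g t e x) := by
  have p₁ := gram_posDef h₁ hV hs hx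
  have p₂ := gram_posDef h₂ hV ht hx
  simp only [normSqAt, curvatureAt_tensorMetric h₁ h₂ hE hF hV hs ht e _ _ hx hxe,
    gram_tensorMetric h₁ h₂ hE hF hV hs ht hx]
  refine (formNormSqOf_add_le (g.coeff_posDef e (e.1.map_source hxe)) (p₁.kronecker p₂) _ _).trans ?_
  rw [formNormSqOf_kronecker_one p₁.isUnit_det p₂.isUnit_det,
    formNormSqOf_one_kronecker p₁.isUnit_det p₂.isUnit_det]

theorem sqrt_add_le {a b : ℝ} (ha : 0 ≤ a) (hb : 0 ≤ b) :
    Real.sqrt (a + b) ≤ Real.sqrt a + Real.sqrt b := by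
  rw [Real.sqrt_le_iff]
  refine ⟨by positivity, ?_⟩
  nlinarith [Real.sq_sqrt ha, Real.sq_sqrt hb, Real.sqrt_nonneg a, Real.sqrt_nonneg b,
    mul_nonneg (Real.sqrt_nonneg a) (Real.sqrt_nonneg b)]

/-- Serves both the mean curvature and its deviation, which have the same shape. The constants
depend only on the two ranks. -/
theorem endPair_kronecker_add_le {H₁ A : Matrix ι ι ℂ} {H₂ B : Matrix κ κ ℂ} (p₁ : H₁.PosDef)
    (p₂ : H₂.PosDef) :
    Real.sqrt (endPair (H₁ ⊗ₖ H₂) (A ⊗ₖ (1 : Matrix κ κ ℂ) + (1 : Matrix ι ι ℂ) ⊗ₖ B)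
      (A ⊗ₖ (1 : Matrix κ κ ℂ) + (1 : Matrix ι ι ℂ) ⊗ₖ B)).re ≤
      Real.sqrt (2 * Fintype.card κ) * Real.sqrt (endPair H₁ A A).re +
        Real.sqrt (2 * Fintype.card ι) * Real.sqrt (endPair H₂ B B).re := by
  have h := endPair_add_le (p₁.kronecker p₂) (A ⊗ₖ (1 : Matrix κ κ ℂ))
    ((1 : Matrix ι ι ℂ) ⊗ₖ B)
  rw [endPair_kronecker_one p₁.isUnit_det p₂.isUnit_det,
    endPair_one_kronecker p₁.isUnit_det p₂.isUnit_det] at h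
  refine (Real.sqrt_le_sqrt h).trans ?_
  have a : 0 ≤ (endPair H₁ A A).re := (Complex.le_def.1 (endPair_self_nonneg p₁ A)).1
  have b : 0 ≤ (endPair H₂ B B).re := (Complex.le_def.1 (endPair_self_nonneg p₂ B)).1
  rw [← Real.sqrt_mul (by positivity), ← Real.sqrt_mul (by positivity)]
  refine le_trans (le_of_eq ?_) (sqrt_add_le (by positivity) (by positivity))
  congr 1
  simp only [Complex.mul_re, Complex.natCast_re, Complex.natCast_im]
  ring

theorem fieldAt_tensorField (hs : IsFrameOver E s) (ht : IsFrameOver F t)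
    (φ : E ⟶ tensor E (cotangentSheaf n X)) (ψ : F ⟶ tensor F (cotangentSheaf n X))
    (e : Chart n X) (hVe : V ≤ e.dom) (α : Fin n) {x : X} (hx : x ∈ V) :
    fieldAt (isFrameOver_tensor hs ht) (tensorField φ ψ) e hVe α x =
      fieldAt hs φ e hVe α x ⊗ₖ (1 : Matrix κ κ ℂ) +
        (1 : Matrix ι ι ℂ) ⊗ₖ fieldAt ht ψ e hVe α x := by
  -- The frame sections have the columns of the identity as coordinates in their own frame; this
  -- produces the factors 1 in the Kronecker products.
  have key : ∀ {τ : Type} [Fintype τ] [DecidableEq τ] {G : OModule n X} {u : τ → Sec G V}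
      (hu : IsFrameOver G u) (p q : τ),
      (hu.basis.repr (u q) p).eval x hx = (1 : Matrix τ τ ℂ) p q := by
    intro τ _ _ G u hu p q
    have := hu.basis.repr_self_apply q p
    rw [IsFrameOver.basis_apply] at this
    rw [this, one_apply]
    by_cases h : p = q
    · subst h
      rw [if_pos rfl, if_pos rfl]
      rfl
    · rw [if_neg h, if_neg (Ne.symm h)]
      rfl
  ext p q
  rw [fieldAt_apply _ _ _ _ _ hx, fieldComp_tensorField, map_add, Finsupp.add_apply, repr_tmul,
    repr_tmul, Matrix.add_apply, kronecker_apply, kronecker_apply, fieldAt_apply _ _ _ _ _ hx,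
    fieldAt_apply _ _ _ _ _ hx, ← key ht, ← key hs]
  rfl

/-- Mean curvature and bracket split as `A ⊗ 1 + 1 ⊗ B`, and the scalar part splits because the
identity is `1 ⊗ 1`. Hence the constants of the two factors add. -/
theorem deviationAt_tensorMetric (hs : IsFrameOver E s) (ht : IsFrameOver F t)
    (φ : E ⟶ tensor E (cotangentSheaf n X)) (ψ : F ⟶ tensor F (cotangentSheaf n X)) (c₁ c₂ : ℂ)
    (e : Chart n X) (hVe : V ≤ e.dom) {x : X} (hx : x ∈ V) :
    deviationAt (tensorMetric h₁ h₂ hE hF) hV g (isFrameOver_tensor hs ht) (tensorField φ ψ)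
        (c₁ + c₂) e hVe x =
      deviationAt h₁ hV g hs φ c₁ e hVe x ⊗ₖ (1 : Matrix κ κ ℂ) +
        (1 : Matrix ι ι ℂ) ⊗ₖ deviationAt h₂ hV g ht ψ c₂ e hVe x := by
  have p₁ := (gram_posDef h₁ hV hs hx).isUnit_det
  have p₂ := (gram_posDef h₂ hV ht hx).isUnit_det
  have e1 : bracket (gram h₁ hV s x ⊗ₖ gram h₂ hV t x)
      (fun α => fieldAt (isFrameOver_tensor hs ht) (tensorField φ ψ) e hVe α x) = fun j k =>
      bracket (gram h₁ hV s x) (fun α => fieldAt hs φ e hVe α x) j k ⊗ₖ (1 : Matrix κ κ ℂ) +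
        (1 : Matrix ι ι ℂ) ⊗ₖ bracket (gram h₂ hV t x) (fun α => fieldAt ht ψ e hVe α x) j k := by
    funext j k
    simp only [fieldAt_tensorField hs ht φ ψ e hVe _ hx]
    exact bracket_kronecker p₁ p₂ _ _ j k
  rw [deviationAt, gram_tensorMetric h₁ h₂ hE hF hV hs ht hx, e1, contraction_kronecker,
    meanAt_tensorMetric h₁ h₂ hE hF hV g hs ht e hx (hVe hx), deviationAt, deviationAt]
  ext p q
  simp only [Matrix.add_apply, Matrix.sub_apply, kroneckerMap_apply, Matrix.smul_apply, smul_eq_mul,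
    ← one_kronecker_one (m := ι) (n := κ) (α := ℂ)]
  ring

theorem curvatureAt_sumMetric (hs : IsFrameOver E s) (ht : IsFrameOver F t) (e : Chart n X)
    (j k : Fin n) {x : X} (hx : x ∈ V) (hxe : x ∈ e.1.source) :
    curvatureAt (sumMetric h₁ h₂ hE hF) hV (sumFrame s t) e j k x =
      fromBlocks (curvatureAt h₁ hV s e j k x) 0 0 (curvatureAt h₂ hV t e j k x) := by
  have hzx := e.1.left_inv hxe
  have ev := eventually_mem_chart (V := V) e (e.1.map_source hxe) (by rwa [hzx])
  refine Eq.trans (curvatureOf_congr (ev.mono fun w hw =>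
    gram_sumMetric h₁ h₂ hE hF hV s t hw.2) j k) ?_
  exact curvatureOf_fromBlocks (ev.mono fun w hw => (gram_posDef h₁ hV hs hw.2).isUnit_det)
    (ev.mono fun w hw => (gram_posDef h₂ hV ht hw.2).isUnit_det) j k

theorem meanAt_sumMetric (hs : IsFrameOver E s) (ht : IsFrameOver F t) (e : Chart n X)
    {x : X} (hx : x ∈ V) (hxe : x ∈ e.1.source) :
    meanAt (sumMetric h₁ h₂ hE hF) hV g (sumFrame s t) e x =
      fromBlocks (meanAt h₁ hV g s e x) 0 0 (meanAt h₂ hV g t e x) := by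
  simp only [meanAt, curvatureAt_sumMetric h₁ h₂ hE hF hV hs ht e _ _ hx hxe]
  exact contraction_fromBlocks _ _ _

theorem normSqAt_sumMetric (hs : IsFrameOver E s) (ht : IsFrameOver F t) (e : Chart n X)
    {x : X} (hx : x ∈ V) (hxe : x ∈ e.1.source) :
    normSqAt (sumMetric h₁ h₂ hE hF) hV g (sumFrame s t) e x =
      normSqAt h₁ hV g s e x + normSqAt h₂ hV g t e x := by
  simp only [normSqAt, curvatureAt_sumMetric h₁ h₂ hE hF hV hs ht e _ _ hx hxe,
    gram_sumMetric h₁ h₂ hE hF hV s t hx]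
  exact formNormSqOf_fromBlocks (gram_posDef h₁ hV hs hx).isUnit_det
    (gram_posDef h₂ hV ht hx).isUnit_det _ _ _

theorem endPair_fromBlocks_le {H₁ A : Matrix ι ι ℂ} {H₂ B : Matrix κ κ ℂ} (p₁ : H₁.PosDef)
    (p₂ : H₂.PosDef) :
    Real.sqrt (endPair (fromBlocks H₁ 0 0 H₂) (fromBlocks A 0 0 B) (fromBlocks A 0 0 B)).re ≤
      Real.sqrt (endPair H₁ A A).re + Real.sqrt (endPair H₂ B B).re := by
  rw [endPair_fromBlocks p₁.isUnit_det p₂.isUnit_det, Complex.add_re]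
  exact sqrt_add_le (Complex.le_def.1 (endPair_self_nonneg p₁ A)).1
    (Complex.le_def.1 (endPair_self_nonneg p₂ B)).1

theorem fieldAt_sumField (hs : IsFrameOver E s) (ht : IsFrameOver F t)
    (φ : E ⟶ tensor E (cotangentSheaf n X)) (ψ : F ⟶ tensor F (cotangentSheaf n X))
    (e : Chart n X) (hVe : V ≤ e.dom) (α : Fin n) {x : X} (hx : x ∈ V) :
    fieldAt (isFrameOver_biprod hs ht) (HiggsModule.sumField φ ψ) e hVe α x =
      fromBlocks (fieldAt hs φ e hVe α x) 0 0 (fieldAt ht ψ e hVe α x) := by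
  have h11 : ∀ u, onSec (biprod.fst : E ⊞ F ⟶ _) V (onSec biprod.inl V u) = u :=
    fun u => congrArg (fun f => onSec f V u) (biprod.inl_fst (X := E) (Y := F))
  have h12 : ∀ u, onSec (biprod.snd : E ⊞ F ⟶ _) V (onSec biprod.inl V u) = 0 :=
    fun u => congrArg (fun f => onSec f V u) (biprod.inl_snd (X := E) (Y := F))
  have h21 : ∀ u, onSec (biprod.fst : E ⊞ F ⟶ _) V (onSec biprod.inr V u) = 0 :=
    fun u => congrArg (fun f => onSec f V u) (biprod.inr_fst (X := E) (Y := F))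
  have h22 : ∀ u, onSec (biprod.snd : E ⊞ F ⟶ _) V (onSec biprod.inr V u) = u :=
    fun u => congrArg (fun f => onSec f V u) (biprod.inr_snd (X := E) (Y := F))
  ext p (q | q)
  · rw [fieldAt_apply _ _ _ _ _ hx, HiggsModule.fieldComp_sumField, repr_sum hs ht]
    simp only [Sum.elim_inl, h11, h12, map_zero]
    rcases p with p | p
    · simp only [Sum.elim_inl, fromBlocks_apply₁₁, fieldAt_apply _ _ _ _ _ hx]
    · rfl
  · rw [fieldAt_apply _ _ _ _ _ hx, HiggsModule.fieldComp_sumField, repr_sum hs ht]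
    simp only [Sum.elim_inr, h21, h22, map_zero]
    rcases p with p | p
    · rfl
    · simp only [Sum.elim_inr, fromBlocks_apply₂₂, fieldAt_apply _ _ _ _ _ hx]

/-- A single scalar `c` has to serve both blocks; this is where the sum needs equal slopes. -/
theorem deviationAt_sumMetric (hs : IsFrameOver E s) (ht : IsFrameOver F t)
    (φ : E ⟶ tensor E (cotangentSheaf n X)) (ψ : F ⟶ tensor F (cotangentSheaf n X)) (c : ℂ)
    (e : Chart n X) (hVe : V ≤ e.dom) {x : X} (hx : x ∈ V) :
    deviationAt (sumMetric h₁ h₂ hE hF) hV g (isFrameOver_biprod hs ht)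
        (HiggsModule.sumField φ ψ) c e hVe x =
      fromBlocks (deviationAt h₁ hV g hs φ c e hVe x) 0 0
        (deviationAt h₂ hV g ht ψ c e hVe x) := by
  have p₁ := (gram_posDef h₁ hV hs hx).isUnit_det
  have p₂ := (gram_posDef h₂ hV ht hx).isUnit_det
  have e1 : bracket (fromBlocks (gram h₁ hV s x) 0 0 (gram h₂ hV t x))
      (fun α => fieldAt (isFrameOver_biprod hs ht) (HiggsModule.sumField φ ψ) e hVe α x) =
      fun j k => fromBlocks (bracket (gram h₁ hV s x) (fun α => fieldAt hs φ e hVe α x) j k) 0 0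
        (bracket (gram h₂ hV t x) (fun α => fieldAt ht ψ e hVe α x) j k) := by
    funext j k
    simp only [fieldAt_sumField hs ht φ ψ e hVe _ hx]
    exact bracket_fromBlocks p₁ p₂ _ _ j k
  rw [deviationAt, gram_sumMetric h₁ h₂ hE hF hV s t hx, e1, contraction_fromBlocks,
    meanAt_sumMetric h₁ h₂ hE hF hV g hs ht e hx (hVe hx), deviationAt, deviationAt,
    ← fromBlocks_one (l := ι) (m := κ) (α := ℂ)]
  ext (p | p) (q | q) <;> simp [-fromBlocks_one]

end pointwise

/-! ### Admissible structures from bounds -/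

section restrict
variable {n : ℕ} {X : Type} [TopologicalSpace X] [ChartedSpace (Fin n → ℂ) X]
variable {E : OModule n X} {U U' : Opens X} {x : X}

/-- The restriction of a metric to a smaller open set. -/
def HermitianMetric.restrict (h : HermitianMetric E U) (hU : U' ≤ U) : HermitianMetric E U' where
  inner V hV := h.inner V (hV.trans hU)
  add_left V hV := h.add_left V (hV.trans hU)
  smul_left V hV := h.smul_left V (hV.trans hU)
  conj_symm V hV := h.conj_symm V (hV.trans hU)
  res_eq V W hV := h.res_eq V W (hV.trans hU)
  smooth V hV := h.smooth V (hV.trans hU)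
  posDef V hV := h.posDef V (hV.trans hU)

/-- A local frame over an open set is a local frame over any larger one. -/
def LocalFrame.enlarge (T : LocalFrame E U' x) (hU : U' ≤ U) : LocalFrame E U x where
  chart := T.chart
  dom := T.dom
  mem_dom := T.mem_dom
  dom_le := T.dom_le.trans hU
  dom_le_chart := T.dom_le_chart
  rank := T.rank
  sec := T.sec
  isFrame := T.isFrame

theorem exists_localFrame (hE : LocallyFreeOn E U) (hx : x ∈ U) (e : Chart n X)
    (hxe : x ∈ e.1.source) : ∃ T : LocalFrame E U x, T.chart = e := by
  obtain ⟨V, hxV, hV, r, s, hs⟩ := hE x hx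
  exact ⟨⟨e, V ⊓ e.dom, ⟨hxV, hxe⟩, inf_le_left.trans hV, inf_le_right, r, _,
    IsFrameOver.res hs inf_le_left⟩, rfl⟩

end restrict

/-! ### Measurability and integrability of the curvature functions -/

section continuity
open Matrix Filter Topology MeasureTheory
variable {n : ℕ} {X : Type} [TopologicalSpace X] [ChartedSpace (Fin n → ℂ) X]
  [IsManifold 𝓘(ℂ, Fin n → ℂ) ∞ X]
variable {E : OModule n X} {U : Opens X} (h : HermitianMetric E U) (g : KahlerMetric n X)
  {ι : Type} [Fintype ι] [DecidableEq ι] {V : Opens X} (hV : V ≤ U) {s : ι → Sec E V}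

theorem curvatureAt_smooth (hs : IsFrameOver E s) (e : Chart n X) (j k : Fin n) {z : Fin n → ℂ}
    (hz : z ∈ e.1.target) (hzV : e.1.symm z ∈ V) :
    SmoothMatrixAt (fun w => curvatureAt h hV s e j k (e.1.symm w)) z := by
  have ev := eventually_mem_chart e hz hzV
  refine SmoothMatrixAt.congr (SmoothMatrixAt.curvatureOf
    (H := fun w => gram h hV s (e.1.symm w)) (gram_smooth h hV s e hz hzV)
    (gram_posDef h hV hs hzV).isUnit_det j k) ?_
  filter_upwards [ev] with w hw
  rw [curvatureAt, e.1.right_inv hw.1]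

theorem coeff_smooth_symm (e : Chart n X) {z : Fin n → ℂ} (hz : z ∈ e.1.target) :
    SmoothMatrixAt (fun w => g.coeff e (e.1 (e.1.symm w))) z := by
  refine SmoothMatrixAt.congr (g.coeff_smooth e hz) ?_
  filter_upwards [e.1.open_target.mem_nhds hz] with w hw
  rw [e.1.right_inv hw]

theorem meanAt_smooth (hs : IsFrameOver E s) (e : Chart n X) {z : Fin n → ℂ}
    (hz : z ∈ e.1.target) (hzV : e.1.symm z ∈ V) :
    SmoothMatrixAt (fun w => meanAt h hV g s e (e.1.symm w)) z := by
  refine smoothMatrixAt_contraction (coeff_smooth_symm g e hz) ?_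
    (a := fun j k w => curvatureAt h hV s e j k (e.1.symm w))
    fun j k => curvatureAt_smooth h hV hs e j k hz hzV
  rw [e.1.right_inv hz]
  exact (g.coeff_posDef e hz).isUnit_det

theorem normSqAt_smooth (hs : IsFrameOver E s) (e : Chart n X) {z : Fin n → ℂ}
    (hz : z ∈ e.1.target) (hzV : e.1.symm z ∈ V) :
    ContDiffAt ℝ ∞ (fun w => normSqAt h hV g s e (e.1.symm w)) z := by
  refine contDiffAt_formNormSqOf (coeff_smooth_symm g e hz) ?_ (gram_smooth h hV s e hz hzV)
    (gram_posDef h hV hs hzV).isUnit_det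
    (a := fun j k w => curvatureAt h hV s e j k (e.1.symm w))
    fun j k => curvatureAt_smooth h hV hs e j k hz hzV
  rw [e.1.right_inv hz]
  exact (g.coeff_posDef e hz).isUnit_det

theorem continuousAt_of_chart {β : Type} [TopologicalSpace β] {f : X → β} (e : Chart n X) {x : X}
    (hx : x ∈ e.1.source) (hf : ContinuousAt (fun z => f (e.1.symm z)) (e.1 x)) :
    ContinuousAt f x := by
  have := ContinuousAt.comp (f := e.1) (x := x) hf (e.1.continuousAt hx)
  refine this.congr ?_
  filter_upwards [e.1.open_source.mem_nhds hx] with y hy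
  exact congrArg f (e.1.left_inv hy)

/-- `G` is the local formula for `f` in a frame and a chart; continuity is local, so it suffices to
have it for the formula. Used only to get measurability. -/
theorem continuousOn_of_localFrame {f : X → ℝ} (hE : LocallyFreeOn E U)
    {G : ∀ (V : Opens X) (_ : V ≤ U) (r : ℕ) (_ : Fin r → Sec E V) (_ : Chart n X), X → ℝ}
    (hG : ∀ (V : Opens X) (hV : V ≤ U) (r : ℕ) (s : Fin r → Sec E V) (e : Chart n X),
      IsFrameOver E s → ∀ z ∈ e.1.target, e.1.symm z ∈ V →
        ContinuousAt (fun z => G V hV r s e (e.1.symm z)) z)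
    (hf : ∀ (V : Opens X) (hV : V ≤ U) (r : ℕ) (s : Fin r → Sec E V) (e : Chart n X),
      IsFrameOver E s → ∀ x ∈ V, x ∈ e.1.source → f x = G V hV r s e x) :
    ContinuousOn f U := by
  intro x hx
  refine ContinuousAt.continuousWithinAt ?_
  obtain ⟨V, hxV, hV, r, s, hs⟩ := hE x hx
  set e : Chart n X := ⟨chartAt (Fin n → ℂ) x, chart_mem_atlas _ x⟩
  have hxe : x ∈ e.1.source := mem_chart_source _ x
  refine (continuousAt_of_chart e hxe (hG V hV r s e hs _ (e.1.map_source hxe)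
    (by rwa [e.1.left_inv hxe]))).congr ?_
  filter_upwards [V.2.mem_nhds hxV, e.1.open_source.mem_nhds hxe] with y hy hye
  exact (hf V hV r s e hs y hy hye).symm

variable [MeasurableSpace X] [BorelSpace X] [T2Space X] [CompactSpace X]

/-- Frame independence makes `|R|²` a well-defined function on `U`. It is continuous there, hence
measurable, and lies between 0 and the integrable bound `F`. -/
theorem exists_curvatureNormSq_integrable (hE : LocallyFreeOn E U) {F : X → ℝ}
    (hF : IntegrableOn F U g.vol)
    (hb : ∀ (x : X) (T : LocalFrame E U x), T.curvatureNormSq g h ≤ F x) : ∃ f : X → ℝ,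
    (∀ (x : X) (T : LocalFrame E U x), f x = T.curvatureNormSq g h) ∧
    IntegrableOn f U g.vol := by
  classical
  have hT : ∀ x, x ∈ U → Nonempty (LocalFrame E U x) := fun x hx => by
    obtain ⟨T, -⟩ := exists_localFrame hE hx ⟨chartAt (Fin n → ℂ) x, chart_mem_atlas _ x⟩
      (mem_chart_source _ x)
    exact ⟨T⟩
  -- The value off `U` is immaterial: there are no local frames there, and integrability is asked
  -- only on `U`.
  set f : X → ℝ := fun x => if hx : x ∈ U then (hT x hx).some.curvatureNormSq g h else 0 with hfd
  have hf : ∀ (V : Opens X) (hV : V ≤ U) (r : ℕ) (s : Fin r → Sec E V) (e : Chart n X),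
      IsFrameOver E s → ∀ x ∈ V, x ∈ e.1.source → f x = normSqAt h hV g s e x := by
    intro V hV r s e hs x hx hxe
    rw [hfd]
    simp only [dif_pos (hV hx)]
    exact curvatureNormSq_eq_normSqAt h hV _ g hs e hx hxe
  have hfT : ∀ (x : X) (T : LocalFrame E U x), f x = T.curvatureNormSq g h := fun x T => by
    rw [T.curvatureNormSq_eq]
    exact hf _ _ _ _ _ T.isFrame x T.mem_dom T.mem_source
  refine ⟨f, hfT, hF.mono' ?_ ?_⟩
  · refine ContinuousOn.aestronglyMeasurable (continuousOn_of_localFrame hE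
      (G := fun V hV r s e => normSqAt h hV g s e) ?_ hf) U.2.measurableSet
    exact fun V hV r s e hs z hz hzV => (normSqAt_smooth h g hV hs e hz hzV).continuousAt
  · refine (ae_restrict_iff' U.2.measurableSet).2 (Eventually.of_forall fun x hx => ?_)
    obtain ⟨T⟩ := hT x hx
    have : 0 ≤ f x := by
      rw [hfT x T, T.curvatureNormSq_eq]
      exact formNormSqOf_nonneg (g.coeff_posDef _ (T.chart.1.map_source T.mem_source))
        (gram_posDef h _ T.isFrame T.mem_dom) _
    rw [Real.norm_of_nonneg this, hfT x T]
    exact hb x T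

theorem exists_mean_integrable (hE : LocallyFreeOn E U) {F : X → ℝ}
    (hF : IntegrableOn F U g.vol)
    (hb : ∀ (x : X) (T : LocalFrame E U x), endNorm (T.gramAt h) (T.meanCurvature g h) ≤ F x) :
    ∃ f : X → ℝ, (∀ (x : X) (T : LocalFrame E U x),
      f x = endNorm (T.gramAt h) (T.meanCurvature g h)) ∧ IntegrableOn f U g.vol := by
  classical
  have hT : ∀ x, x ∈ U → Nonempty (LocalFrame E U x) := fun x hx => by
    obtain ⟨T, -⟩ := exists_localFrame hE hx ⟨chartAt (Fin n → ℂ) x, chart_mem_atlas _ x⟩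
      (mem_chart_source _ x)
    exact ⟨T⟩
  set f : X → ℝ := fun x => if hx : x ∈ U then
    endNorm ((hT x hx).some.gramAt h) ((hT x hx).some.meanCurvature g h) else 0 with hfd
  have hf : ∀ (V : Opens X) (hV : V ≤ U) (r : ℕ) (s : Fin r → Sec E V) (e : Chart n X),
      IsFrameOver E s → ∀ x ∈ V, x ∈ e.1.source → f x =
        Real.sqrt (endPair (gram h hV s x) (meanAt h hV g s e x) (meanAt h hV g s e x)).re := by
    intro V hV r s e hs x hx hxe
    rw [hfd]
    simp only [dif_pos (hV hx)]
    exact endNorm_mean_eq h hV _ g hs e hx hxe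
  have hfT : ∀ (x : X) (T : LocalFrame E U x),
      f x = endNorm (T.gramAt h) (T.meanCurvature g h) := fun x T => by
    rw [hf _ _ _ _ _ T.isFrame x T.mem_dom T.mem_source]
    exact (endNorm_mean_eq h T.dom_le T g T.isFrame _ T.mem_dom T.mem_source).symm
  refine ⟨f, hfT, hF.mono' ?_ ?_⟩
  · refine ContinuousOn.aestronglyMeasurable (continuousOn_of_localFrame hE
      (G := fun V hV r s e x => Real.sqrt (endPair (gram h hV s x) (meanAt h hV g s e x)
        (meanAt h hV g s e x)).re) ?_ hf) U.2.measurableSet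
    intro V hV r s e hs z hz hzV
    exact (Complex.continuous_re.continuousAt.comp (contDiffAt_endPair
      (gram_smooth h hV s e hz hzV) (gram_posDef h hV hs hzV).isUnit_det
      (meanAt_smooth h g hV hs e hz hzV) (meanAt_smooth h g hV hs e hz hzV)).continuousAt).sqrt
  · refine (ae_restrict_iff' U.2.measurableSet).2 (Eventually.of_forall fun x hx => ?_)
    obtain ⟨T⟩ := hT x hx
    have : 0 ≤ f x := by
      rw [hfT x T]
      exact Real.sqrt_nonneg _
    rw [Real.norm_of_nonneg this, hfT x T]
    exact hb x T

end continuity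

/-! ### Local freeness of tensor products and sums -/

section locallyFree
open Limits
variable {n : ℕ} {X : Type} [TopologicalSpace X] [ChartedSpace (Fin n → ℂ) X]
  {E F : OModule n X} {U : Opens X}

theorem isFrame_reindex {ι : Type} [Fintype ι] [DecidableEq ι] {r : ℕ} {V : Opens X}
    {s : ι → Sec E V} (hs : IsFrameOver E s) (e : Fin r ≃ ι) : IsFrame E fun i => s (e i) :=
  isFrame_iff.2 (hs.reindex e)

theorem LocallyFreeOn.tensor (hE : LocallyFreeOn E U) (hF : LocallyFreeOn F U) :
    LocallyFreeOn (tensor E F) U := fun x hx => by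
  obtain ⟨W, hW, hxW, r, r', s, t, hs, ht⟩ := exists_common_frames hE hF le_rfl hx
  exact ⟨W, hxW, hW, r * r', _, isFrame_reindex (isFrameOver_tensor hs ht) finProdFinEquiv.symm⟩

theorem LocallyFreeOn.biprod (hE : LocallyFreeOn E U) (hF : LocallyFreeOn F U) :
    LocallyFreeOn (E ⊞ F) U := fun x hx => by
  obtain ⟨W, hW, hxW, r, r', s, t, hs, ht⟩ := exists_common_frames hE hF le_rfl hx
  exact ⟨W, hxW, hW, r + r', _, isFrame_reindex (isFrameOver_biprod hs ht) finSumFinEquiv.symm⟩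

end locallyFree

/-! ### Approximate Hermitian–Yang–Mills structures on tensor products and Whitney sums -/

section localBounds
open Matrix Filter Topology Limits
variable {n : ℕ} {X : Type} [TopologicalSpace X] [ChartedSpace (Fin n → ℂ) X]
  [IsManifold 𝓘(ℂ, Fin n → ℂ) ∞ X]
variable {E F : OModule n X} {U : Opens X} (h₁ : HermitianMetric E U) (h₂ : HermitianMetric F U)
  (hE : LocallyFreeOn E U) (hF : LocallyFreeOn F U) (g : KahlerMetric n X)
  (φ : E ⟶ tensor E (cotangentSheaf n X)) (ψ : F ⟶ tensor F (cotangentSheaf n X)) (c₁ c₂ : ℂ)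

/-- Reduces an arbitrary frame of the tensor product to a product frame taken inside its chart. The
ranks are prescribed so that the constants do not vary with the point. -/
theorem exists_tensor_bounds {x : X} {r₁ r₂ : ℕ} (hr₁ : ∀ T : LocalFrame E U x, T.rank = r₁)
    (hr₂ : ∀ T : LocalFrame F U x, T.rank = r₂) (T : LocalFrame (tensor E F) U x) :
    ∃ (T₁ : LocalFrame E U x) (T₂ : LocalFrame F U x),
      T.curvatureNormSq g (tensorMetric h₁ h₂ hE hF) ≤
        2 * (r₂ * T₁.curvatureNormSq g h₁) + 2 * (r₁ * T₂.curvatureNormSq g h₂) ∧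
      endNorm (T.gramAt (tensorMetric h₁ h₂ hE hF))
          (T.meanCurvature g (tensorMetric h₁ h₂ hE hF)) ≤
        Real.sqrt (2 * r₂) * endNorm (T₁.gramAt h₁) (T₁.meanCurvature g h₁) +
        Real.sqrt (2 * r₁) * endNorm (T₂.gramAt h₂) (T₂.meanCurvature g h₂) ∧
      endNorm (T.gramAt (tensorMetric h₁ h₂ hE hF))
          (T.hitchinSimpsonMeanCurvature g (tensorMetric h₁ h₂ hE hF) (tensorField φ ψ) -
            (c₁ + c₂) • 1) ≤
        Real.sqrt (2 * r₂) * endNorm (T₁.gramAt h₁)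
          (T₁.hitchinSimpsonMeanCurvature g h₁ φ - c₁ • 1) +
        Real.sqrt (2 * r₁) * endNorm (T₂.gramAt h₂)
          (T₂.hitchinSimpsonMeanCurvature g h₂ ψ - c₂ • 1) := by
  obtain ⟨W, hW, hxW, r, r', s, t, hs, ht⟩ :=
    exists_common_frames hE hF (inf_le_left : U ⊓ T.chart.dom ≤ U)
      ⟨T.dom_le T.mem_dom, T.mem_source⟩
  have hWU : W ≤ U := hW.trans inf_le_left
  have hWe : W ≤ T.chart.dom := hW.trans inf_le_right
  have hxe := T.mem_source
  have p₁ := gram_posDef h₁ hWU hs hxW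
  have p₂ := gram_posDef h₂ hWU ht hxW
  have hst := isFrameOver_tensor hs ht
  let T₁ : LocalFrame E U x := ⟨T.chart, W, hxW, hWU, hWe, r, s, hs⟩
  let T₂ : LocalFrame F U x := ⟨T.chart, W, hxW, hWU, hWe, r', t, ht⟩
  obtain rfl : r = r₁ := hr₁ T₁
  obtain rfl : r' = r₂ := hr₂ T₂
  refine ⟨T₁, T₂, ?_, ?_, ?_⟩
  · rw [curvatureNormSq_eq_normSqAt _ hWU T g hst T.chart hxW hxe, T₁.curvatureNormSq_eq,
      T₂.curvatureNormSq_eq]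
    have := normSqAt_tensorMetric_le h₁ h₂ hE hF hWU g hs ht T.chart hxW hxe
    simpa only [Fintype.card_fin] using this
  · rw [endNorm_mean_eq _ hWU T g hst T.chart hxW hxe,
      endNorm_mean_eq h₁ hWU T₁ g hs T.chart hxW hxe,
      endNorm_mean_eq h₂ hWU T₂ g ht T.chart hxW hxe, gram_tensorMetric h₁ h₂ hE hF hWU hs ht hxW,
      meanAt_tensorMetric h₁ h₂ hE hF hWU g hs ht T.chart hxW hxe]
    have := endPair_kronecker_add_le (A := meanAt h₁ hWU g s T.chart x)
      (B := meanAt h₂ hWU g t T.chart x) p₁ p₂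
    simpa only [Fintype.card_fin] using this
  · rw [endNorm_deviation_eq _ hWU T g _ _ hWe hst hxW,
      endNorm_deviation_eq h₁ hWU T₁ g φ c₁ hWe hs hxW,
      endNorm_deviation_eq h₂ hWU T₂ g ψ c₂ hWe ht hxW,
      gram_tensorMetric h₁ h₂ hE hF hWU hs ht hxW,
      deviationAt_tensorMetric h₁ h₂ hE hF hWU g hs ht φ ψ c₁ c₂ T.chart hWe hxW]
    have := endPair_kronecker_add_le (A := deviationAt h₁ hWU g hs φ c₁ T.chart hWe x)
      (B := deviationAt h₂ hWU g ht ψ c₂ T.chart hWe x) p₁ p₂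
    simpa only [Fintype.card_fin] using this

theorem exists_sum_bounds {x : X} (T : LocalFrame (E ⊞ F) U x) :
    ∃ (T₁ : LocalFrame E U x) (T₂ : LocalFrame F U x),
      T.curvatureNormSq g (sumMetric h₁ h₂ hE hF) ≤
        T₁.curvatureNormSq g h₁ + T₂.curvatureNormSq g h₂ ∧
      endNorm (T.gramAt (sumMetric h₁ h₂ hE hF)) (T.meanCurvature g (sumMetric h₁ h₂ hE hF)) ≤
        endNorm (T₁.gramAt h₁) (T₁.meanCurvature g h₁) +
          endNorm (T₂.gramAt h₂) (T₂.meanCurvature g h₂) ∧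
      endNorm (T.gramAt (sumMetric h₁ h₂ hE hF))
          (T.hitchinSimpsonMeanCurvature g (sumMetric h₁ h₂ hE hF) (HiggsModule.sumField φ ψ) -
            c₁ • 1) ≤
        endNorm (T₁.gramAt h₁) (T₁.hitchinSimpsonMeanCurvature g h₁ φ - c₁ • 1) +
          endNorm (T₂.gramAt h₂) (T₂.hitchinSimpsonMeanCurvature g h₂ ψ - c₁ • 1) := by
  obtain ⟨W, hW, hxW, r, r', s, t, hs, ht⟩ :=
    exists_common_frames hE hF (inf_le_left : U ⊓ T.chart.dom ≤ U)
      ⟨T.dom_le T.mem_dom, T.mem_source⟩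
  have hWU : W ≤ U := hW.trans inf_le_left
  have hWe : W ≤ T.chart.dom := hW.trans inf_le_right
  have hxe := T.mem_source
  have p₁ := gram_posDef h₁ hWU hs hxW
  have p₂ := gram_posDef h₂ hWU ht hxW
  have hst := isFrameOver_biprod hs ht
  let T₁ : LocalFrame E U x := ⟨T.chart, W, hxW, hWU, hWe, r, s, hs⟩
  let T₂ : LocalFrame F U x := ⟨T.chart, W, hxW, hWU, hWe, r', t, ht⟩
  refine ⟨T₁, T₂, ?_, ?_, ?_⟩
  · rw [curvatureNormSq_eq_normSqAt _ hWU T g hst T.chart hxW hxe, T₁.curvatureNormSq_eq,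
      T₂.curvatureNormSq_eq]
    exact (normSqAt_sumMetric h₁ h₂ hE hF hWU g hs ht T.chart hxW hxe).le
  · rw [endNorm_mean_eq _ hWU T g hst T.chart hxW hxe,
      endNorm_mean_eq h₁ hWU T₁ g hs T.chart hxW hxe,
      endNorm_mean_eq h₂ hWU T₂ g ht T.chart hxW hxe, gram_sumMetric h₁ h₂ hE hF hWU s t hxW,
      meanAt_sumMetric h₁ h₂ hE hF hWU g hs ht T.chart hxW hxe]
    exact endPair_fromBlocks_le p₁ p₂
  · rw [endNorm_deviation_eq _ hWU T g _ _ hWe hst hxW,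
      endNorm_deviation_eq h₁ hWU T₁ g φ c₁ hWe hs hxW,
      endNorm_deviation_eq h₂ hWU T₂ g ψ c₁ hWe ht hxW,
      gram_sumMetric h₁ h₂ hE hF hWU s t hxW,
      deviationAt_sumMetric h₁ h₂ hE hF hWU g hs ht φ ψ c₁ T.chart hWe hxW]
    exact endPair_fromBlocks_le p₁ p₂

end localBounds

/-! ### Intersections of complements of small analytic subsets -/

section bigOpen
variable {n : ℕ} {X : Type} [TopologicalSpace X] [ChartedSpace (Fin n → ℂ) X] {U V : Opens X}

/-- The union is cut out locally by all products of an equation of `A` with an equation of `B`. -/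
theorem IsAnalyticSubset.union {A B : Set X} (hA : IsAnalyticSubset n A)
    (hB : IsAnalyticSubset n B) : IsAnalyticSubset n (A ∪ B) := by
  intro x
  obtain ⟨V, hxV, p, f, hf⟩ := hA x
  obtain ⟨W, hxW, q, f', hf'⟩ := hB x
  refine ⟨V ⊓ W, ⟨hxV, hxW⟩, p * q, fun i =>
    (f (finProdFinEquiv.symm i).1).res inf_le_left *
      (f' (finProdFinEquiv.symm i).2).res inf_le_right, fun y hy => ?_⟩
  have e : ∀ i, ((f (finProdFinEquiv.symm i).1).res (inf_le_left : V ⊓ W ≤ V) *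
      (f' (finProdFinEquiv.symm i).2).res inf_le_right).eval y hy =
      (f (finProdFinEquiv.symm i).1).eval y hy.1 * (f' (finProdFinEquiv.symm i).2).eval y hy.2 :=
    fun i => rfl
  simp only [e, mul_eq_zero, Set.mem_union, hf y hy.1, hf' y hy.2]
  constructor
  · rintro (h | h) i
    · exact Or.inl (h _)
    · exact Or.inr (h _)
  · intro h
    by_contra! hc
    obtain ⟨⟨i, hi⟩, j, hj⟩ := hc
    have := h (finProdFinEquiv (i, j))
    simp [hi, hj] at this

/-- An immersed piece in the union either lies in `A` or meets its complement. In the second case,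
as `A` is closed, a nonempty open part of the piece avoids `A` and so lies in `B`. -/
theorem CodimAtLeastTwo.union {A B : Set X} (hA : CodimAtLeastTwo n A) (hB : CodimAtLeastTwo n B)
    (hAc : IsClosed A) : CodimAtLeastTwo n (A ∪ B) := by
  intro e V f hV hne hf hi hAB
  by_cases h : ∀ t ∈ V, e.1.symm (f t) ∈ A
  · exact hA e V f hV hne hf hi fun t ht => ⟨(hAB t ht).1, h t ht⟩
  · push Not at h
    obtain ⟨t₀, ht₀, hn⟩ := h
    have hc : ContinuousOn (fun t => e.1.symm (f t)) V :=
      e.1.continuousOn_symm.comp hf.continuousOn fun t ht => (hAB t ht).1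
    have ho : IsOpen (V ∩ (fun t => e.1.symm (f t)) ⁻¹' Aᶜ) :=
      hc.isOpen_inter_preimage hV hAc.isOpen_compl
    exact hB e _ f ho ⟨t₀, ht₀, hn⟩ (hf.mono Set.inter_subset_left)
      (fun t ht => hi t ht.1) fun t ht => ⟨(hAB t ht.1).1, (hAB t ht.1).2.resolve_left ht.2⟩

theorem IsBigOpen.inf (hU : IsBigOpen n U) (hV : IsBigOpen n V) : IsBigOpen n (U ⊓ V) := by
  have : ((U ⊓ V : Opens X) : Set X)ᶜ = (U : Set X)ᶜ ∪ (V : Set X)ᶜ := by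
    rw [Opens.coe_inf, Set.compl_inter]
  rw [IsBigOpen, this]
  exact ⟨hU.1.union hV.1, hU.2.union hV.2 U.2.isClosed_compl⟩

theorem LocallyFreeOfRankOn.locallyFreeOn {E : OModule n X} {r : ℕ}
    (h : LocallyFreeOfRankOn E r U) : LocallyFreeOn E U := fun x hx => by
  obtain ⟨V, hxV, hV, s, hs⟩ := h x hx
  exact ⟨V, hxV, hV, r, s, hs⟩

theorem LocallyFreeOfRankOn.rank_eq {E : OModule n X} {r : ℕ}
    (h : LocallyFreeOfRankOn E r U) (hV : V ≤ U) {x : X} (T : LocalFrame E V x) : T.rank = r := by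
  obtain ⟨W, hxW, hW, s, hs⟩ := h x (hV (T.dom_le T.mem_dom))
  have := IsFrameOver.card_eq (IsFrameOver.res T.isFrame (inf_le_left : T.dom ⊓ W ≤ _))
    (IsFrameOver.res hs (inf_le_right : T.dom ⊓ W ≤ _)) ⟨T.mem_dom, hxW⟩
  simpa using this

end bigOpen

/-! ### The approximate structures -/

section approx
open MeasureTheory
variable {n : ℕ} {X : Type} [TopologicalSpace X] [ChartedSpace (Fin n → ℂ) X]
  [IsManifold 𝓘(ℂ, Fin n → ℂ) ∞ X] [MeasurableSpace X] [BorelSpace X] [T2Space X]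
  [CompactSpace X] {g : KahlerMetric n X}

variable {E₁ E₂ : HiggsModule n X} {r₁ r₂ : ℕ} {D₁ D₂ : Opens X} {μ₁ μ₂ : ℝ}

theorem HasApproxHYM.tensorProduct (hD₁ : IsBigOpen n D₁) (hD₂ : IsBigOpen n D₂)
    (hr₁ : LocallyFreeOfRankOn E₁.sheaf r₁ D₁) (hr₂ : LocallyFreeOfRankOn E₂.sheaf r₂ D₂)
    (h₁ : HasApproxHYM g E₁ μ₁) (h₂ : HasApproxHYM g E₂ μ₂) :
    HasApproxHYM g (E₁.tensorProduct E₂) (μ₁ + μ₂) := by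
  intro ε hε
  set a := Real.sqrt (2 * r₂)
  set b := Real.sqrt (2 * r₁)
  have ha : 0 ≤ a := Real.sqrt_nonneg _
  have hb : 0 ≤ b := Real.sqrt_nonneg _
  have hab : 0 < a + b + 1 := by positivity
  -- The final error is at most `(a + b) η`; the extra 1 keeps the denominator positive and the
  -- resulting inequality strict.
  have hη : 0 < ε / (a + b + 1) := by positivity
  obtain ⟨A₁, δ₁, hδ₁, hA₁⟩ := h₁ _ hη
  obtain ⟨A₂, δ₂, hδ₂, hA₂⟩ := h₂ _ hη
  -- An admissible structure leaves the rank unspecified, so the domain is cut down to where the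
  -- ranks are known to be `r₁` and `r₂`.
  set U := A₁.dom ⊓ A₂.dom ⊓ (D₁ ⊓ D₂)
  have hU₁ : U ≤ A₁.dom := inf_le_left.trans inf_le_left
  have hU₂ : U ≤ A₂.dom := inf_le_left.trans inf_le_right
  have hUD₁ : U ≤ D₁ := inf_le_right.trans inf_le_left
  have hUD₂ : U ≤ D₂ := inf_le_right.trans inf_le_right
  have hU : IsBigOpen n U := (A₁.isBigOpen.inf A₂.isBigOpen).inf (hD₁.inf hD₂)
  have hE := A₁.locallyFree.mono hU₁
  have hF := A₂.locallyFree.mono hU₂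
  obtain ⟨F₁, hF₁, iF₁⟩ := A₁.curvature_sq_integrable
  obtain ⟨F₂, hF₂, iF₂⟩ := A₂.curvature_sq_integrable
  obtain ⟨G₁, hG₁, iG₁⟩ := A₁.mean_integrable
  obtain ⟨G₂, hG₂, iG₂⟩ := A₂.mean_integrable
  have key := fun (x : X) (T : LocalFrame (E₁.tensorProduct E₂).sheaf U x) =>
    exists_tensor_bounds (A₁.metric.restrict hU₁) (A₂.metric.restrict hU₂) hE hF g E₁.field E₂.field
      (hymConstant g μ₁ : ℂ) (hymConstant g μ₂ : ℂ) (hr₁.rank_eq hUD₁) (hr₂.rank_eq hUD₂) T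
  -- The constant is linear in the slope.
  have hc : ((hymConstant g (μ₁ + μ₂) : ℝ) : ℂ) = hymConstant g μ₁ + hymConstant g μ₂ := by
    rw [← Complex.ofReal_add, hymConstant, hymConstant, hymConstant]
    congr 1
    ring
  refine ⟨⟨U, hU, (hE.tensor hF),
    tensorMetric (A₁.metric.restrict hU₁) (A₂.metric.restrict hU₂) hE hF,
    exists_curvatureNormSq_integrable _ g (hE.tensor hF)
      (F := fun x => 2 * (r₂ * F₁ x) + 2 * (r₁ * F₂ x)) ?_ ?_,
    exists_mean_integrable _ g (hE.tensor hF)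
      (F := fun x => a * G₁ x + b * G₂ x) ?_ ?_⟩, a * δ₁ + b * δ₂, ?_, ?_⟩
  · exact (((iF₁.mono_set hU₁).const_mul _).const_mul _).add
      (((iF₂.mono_set hU₂).const_mul _).const_mul _)
  · intro x T
    obtain ⟨T₁, T₂, h, -, -⟩ := key x T
    rw [hF₁ x (T₁.enlarge hU₁), hF₂ x (T₂.enlarge hU₂)]
    exact h
  · exact ((iG₁.mono_set hU₁).const_mul _).add ((iG₂.mono_set hU₂).const_mul _)
  · intro x T
    obtain ⟨T₁, T₂, -, h, -⟩ := key x T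
    rw [hG₁ x (T₁.enlarge hU₁), hG₂ x (T₂.enlarge hU₂)]
    exact h
  · have h1 : a * δ₁ + b * δ₂ ≤ (a + b) * (ε / (a + b + 1)) := by
      rw [add_mul]
      gcongr
    have h2 : (a + b) * (ε / (a + b + 1)) < (a + b + 1) * (ε / (a + b + 1)) :=
      mul_lt_mul_of_pos_right (by linarith) hη
    rw [mul_div_cancel₀ _ hab.ne'] at h2
    exact h1.trans_lt h2
  · intro x T
    have k := key x T
    obtain ⟨T₁, T₂, -, -, h⟩ := k
    rw [hc]
    refine h.trans ?_
    have k₁ := hA₁ x (T₁.enlarge hU₁)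
    have k₂ := hA₂ x (T₂.enlarge hU₂)
    exact add_le_add (mul_le_mul_of_nonneg_left k₁ ha) (mul_le_mul_of_nonneg_left k₂ hb)

theorem HasApproxHYM.directSum (h₁ : HasApproxHYM g E₁ μ₁) (h₂ : HasApproxHYM g E₂ μ₁) :
    HasApproxHYM g (E₁.directSum E₂) μ₁ := by
  intro ε hε
  obtain ⟨A₁, δ₁, hδ₁, hA₁⟩ := h₁ _ (half_pos hε)
  obtain ⟨A₂, δ₂, hδ₂, hA₂⟩ := h₂ _ (half_pos hε)
  set U := A₁.dom ⊓ A₂.dom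
  have hU₁ : U ≤ A₁.dom := inf_le_left
  have hU₂ : U ≤ A₂.dom := inf_le_right
  have hU : IsBigOpen n U := A₁.isBigOpen.inf A₂.isBigOpen
  have hE := A₁.locallyFree.mono hU₁
  have hF := A₂.locallyFree.mono hU₂
  obtain ⟨F₁, hF₁, iF₁⟩ := A₁.curvature_sq_integrable
  obtain ⟨F₂, hF₂, iF₂⟩ := A₂.curvature_sq_integrable
  obtain ⟨G₁, hG₁, iG₁⟩ := A₁.mean_integrable
  obtain ⟨G₂, hG₂, iG₂⟩ := A₂.mean_integrable
  have key := fun (x : X) (T : LocalFrame (E₁.directSum E₂).sheaf U x) =>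
    exists_sum_bounds (A₁.metric.restrict hU₁) (A₂.metric.restrict hU₂) hE hF g E₁.field E₂.field
      (hymConstant g μ₁ : ℂ) T
  refine ⟨⟨U, hU, (hE.biprod hF),
    sumMetric (A₁.metric.restrict hU₁) (A₂.metric.restrict hU₂) hE hF,
    exists_curvatureNormSq_integrable _ g (hE.biprod hF)
      (F := fun x => F₁ x + F₂ x) ?_ ?_,
    exists_mean_integrable _ g (hE.biprod hF)
      (F := fun x => G₁ x + G₂ x) ?_ ?_⟩, δ₁ + δ₂, by linarith, ?_⟩
  · exact (iF₁.mono_set hU₁).add (iF₂.mono_set hU₂)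
  · intro x T
    obtain ⟨T₁, T₂, h, -, -⟩ := key x T
    rw [hF₁ x (T₁.enlarge hU₁), hF₂ x (T₂.enlarge hU₂)]
    exact h
  · exact (iG₁.mono_set hU₁).add (iG₂.mono_set hU₂)
  · intro x T
    obtain ⟨T₁, T₂, -, h, -⟩ := key x T
    rw [hG₁ x (T₁.enlarge hU₁), hG₂ x (T₂.enlarge hU₂)]
    exact h
  · intro x T
    have k := key x T
    obtain ⟨T₁, T₂, -, -, h⟩ := k
    refine h.trans ?_
    have k₁ := hA₁ x (T₁.enlarge hU₁)
    have k₂ := hA₂ x (T₂.enlarge hU₂)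
    exact add_le_add k₁ k₂

end approx

/-! ### Determinant line bundles -/

section det
open Matrix
variable {n : ℕ} {X : Type} [TopologicalSpace X] [ChartedSpace (Fin n → ℂ) X]
variable {E F L M : OModule n X} {ι κ : Type} [Fintype ι] [DecidableEq ι] [Fintype κ]
  [DecidableEq κ] {U V W : Opens X}

/-- An alternating map in as many variables as the rank is determined by its values on permutations
of a basis, and there both sides change by the sign of the permutation. -/
theorem alternatingMap_eq_det_smul {R N P : Type*} [CommRing R] [AddCommGroup N] [Module R N]
    [AddCommGroup P] [Module R P] (e : Module.Basis ι R N) (f : N [⋀^ι]→ₗ[R] P) (v : ι → N) :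
    f v = e.det v • f e := by
  have : f = (LinearMap.toSpanSingleton R P (f e)).compAlternatingMap e.det := by
    refine Module.Basis.ext_alternating e fun w hw => ?_
    let σ : Equiv.Perm ι := Equiv.ofBijective w (Finite.injective_iff_bijective.1 hw)
    have hσ : (fun i => e (w i)) = ⇑e ∘ σ := rfl
    rw [hσ, AlternatingMap.map_perm, LinearMap.compAlternatingMap_apply, AlternatingMap.map_perm,
      Module.Basis.det_self]
    simp
  conv_lhs => rw [this]
  rfl

theorem IsFrameOver.repr_reindex {s : ι → Sec E V} (hs : IsFrameOver E s) (e : κ ≃ ι)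
    (u : Sec E V) (k : κ) : (hs.reindex e).basis.repr u k = hs.basis.repr u (e k) := by
  refine (hs.reindex e).repr_eq (a := fun k => hs.basis.repr u (e k)) ?_ k
  exact (hs.sum_repr u).symm.trans (e.sum_comp fun i => hs.basis.repr u i • s i).symm

theorem IsFrameOver.det_res {s : ι → Sec E V} (hs : IsFrameOver E s) (hW : W ≤ V)
    (v : ι → Sec E V) : (hs.res hW).basis.det (fun i => HYM.res E hW (v i)) =
      (hs.basis.det v).res hW := by
  rw [Module.Basis.det_apply, Module.Basis.det_apply]
  refine Eq.trans ?_ ((Hol.resHom hW).map_det _).symm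
  congr 1
  ext i j
  rw [Module.Basis.toMatrix_apply, hs.repr_res hW (hs.res hW) fun _ => rfl]
  rfl

theorem IsFrameOver.det_mul {s t : ι → Sec E V} (hs : IsFrameOver E s) (ht : IsFrameOver E t)
    (v : ι → Sec E V) : hs.basis.det t * ht.basis.det v = hs.basis.det v := by
  have := alternatingMap_eq_det_smul ht.basis hs.basis.det v
  rw [this, ht.coe_basis, smul_eq_mul, mul_comm]

/-- A generator of a line bundle. -/
abbrev IsGen (L : OModule n X) (l : Sec L V) : Prop := IsFrameOver L fun _ : Fin 1 => l

theorem IsGen.smul_unit {l : Sec L V} (hl : IsGen L l) {f : Hol n V} (hf : IsUnit f) :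
    IsGen L (f • l) := by
  obtain ⟨f', hf'⟩ := hf.exists_left_inv
  intro W hW t
  have hr : f'.res hW * f.res hW = 1 := by
    have := congrArg (Hol.resHom hW) hf'
    rwa [map_mul, map_one] at this
  obtain ⟨a, ha, hu⟩ := hl W hW t
  refine ⟨fun i => a i * f'.res hW, ?_, fun b hb => ?_⟩
  · rw [ha]
    refine Finset.sum_congr rfl fun i _ => ?_
    rw [res_smul, smul_smul, mul_assoc, hr, mul_one]
  · have := hu (fun i => b i * f.res hW) (hb.trans (Finset.sum_congr rfl fun i _ => by
      rw [res_smul, smul_smul]))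
    funext i
    rw [← congrFun this i, mul_assoc, mul_comm (f.res hW), hr, mul_one]

theorem IsGen.tmul {l : Sec L V} {m : Sec M V} (hl : IsGen L l) (hm : IsGen M m) :
    IsGen (tensor L M) (HYM.tmul l m) :=
  (isFrameOver_tensor hl hm).reindex (Equiv.prodUnique (Fin 1) (Fin 1)).symm

variable {r : ℕ} {D : Opens X}

/-- A determinant line bundle from compatible generators attached to local frames. -/
theorem exists_detBundle (R : ∀ W : Opens X, (Fin r → Sec E W) → Sec L W → Prop)
    (hL : LocallyFreeOfRankOn L 1 ⊤) (hD : IsBigOpen n D)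
    (hfr : ∀ W s l, R W s l → IsFrameOver E s) (hgen : ∀ W s l, R W s l → IsGen L l)
    (hres : ∀ (V W : Opens X) (h : W ≤ V) s l, R V s l → R W (fun i => res E h (s i)) (res L h l))
    (hchange : ∀ (W : Opens X) s l s' l' (hs : IsFrameOver E s), R W s l → R W s' l' →
      l' = hs.basis.det s' • l)
    (hloc : ∀ x ∈ D, ∃ W ≤ D, x ∈ W ∧ ∃ s l, R W s l) :
    ∃ B : DetBundle E r, B.bundle = L := by
  have hloc' : ∀ V ≤ D, ∀ x ∈ V, ∃ (W : Opens X) (_ : W ≤ V), x ∈ W ∧ ∃ s l, R W s l := by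
    intro V hV x hx
    obtain ⟨W, -, hxW, s, l, h⟩ := hloc x (hV hx)
    exact ⟨W ⊓ V, inf_le_right, ⟨hxW, hx⟩, _, _, hres W _ inf_le_left s l h⟩
  -- The determinant of `v` is locally its determinant in a distinguished frame times the attached
  -- generator; `hchange` and the multiplicativity of determinants make these agree on overlaps.
  have key : ∀ (V : Opens X) (_ : V ≤ D) (v : Fin r → Sec E V), ∃ u : Sec L V,
      ∀ (W : Opens X) (h : W ≤ V) s l (hR : R W s l),
        res L h u = (hfr W s l hR).basis.det (fun i => res E h (v i)) • l := by
    intro V hV v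
    have loc := hloc' V hV
    choose! W hW hx s l hR using loc
    have comp : ∀ (W₁ W₂ : Opens X) (h₁ : W₁ ≤ V) (h₂ : W₂ ≤ V) s₁ l₁ (hR₁ : R W₁ s₁ l₁) s₂ l₂
        (hR₂ : R W₂ s₂ l₂), res L (inf_le_left : W₁ ⊓ W₂ ≤ W₁)
          ((hfr W₁ s₁ l₁ hR₁).basis.det (fun i => res E h₁ (v i)) • l₁) =
        res L (inf_le_right : W₁ ⊓ W₂ ≤ W₂)
          ((hfr W₂ s₂ l₂ hR₂).basis.det (fun i => res E h₂ (v i)) • l₂) := by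
      intro W₁ W₂ h₁ h₂ s₁ l₁ hR₁ s₂ l₂ hR₂
      have k₁ := hres _ _ (inf_le_left : W₁ ⊓ W₂ ≤ W₁) _ _ hR₁
      have k₂ := hres _ _ (inf_le_right : W₁ ⊓ W₂ ≤ W₂) _ _ hR₂
      have e := hchange _ _ _ _ _ ((hfr _ _ _ hR₁).res inf_le_left) k₁ k₂
      rw [res_smul, res_smul, ← IsFrameOver.det_res, ← IsFrameOver.det_res, e, smul_smul,
        mul_comm, ← IsFrameOver.det_mul ((hfr _ _ _ hR₁).res (inf_le_left : W₁ ⊓ W₂ ≤ W₁))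
          ((hfr _ _ _ hR₂).res (inf_le_right : W₁ ⊓ W₂ ≤ W₂))]
      simp only [res_res]
    obtain ⟨u, hu⟩ := sec_glue L (V := V) (fun x : V => W x.1) (fun x => hW x.1 x.2)
      (fun x hx' => ⟨⟨x, hx'⟩, hx x hx'⟩)
      (fun x => (hfr _ _ _ (hR x.1 x.2)).basis.det (fun i => res E (hW x.1 x.2) (v i)) • l x.1)
      (fun x y => comp _ _ _ _ _ _ (hR x.1 x.2) _ _ (hR y.1 y.2))
    refine ⟨u, fun W' h' s' l' hR' => ?_⟩
    refine sec_ext _ _ _ fun x hx' => ?_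
    refine ⟨W' ⊓ W x, inf_le_left, ⟨hx', hx x (h' hx')⟩, ?_⟩
    rw [comp W' (W x) h' (hW x (h' hx')) s' l' hR' _ _ (hR x (h' hx')), ← hu ⟨x, h' hx'⟩, res_res,
      res_res]
  choose d hd using key
  -- Sections are compared over the open sets that carry a distinguished frame; linearity,
  -- alternation and restriction then reduce to the ordinary determinant.
  have hext : ∀ (V : Opens X) (hV : V ≤ D) (u u' : Sec L V),
      (∀ (W : Opens X) (h : W ≤ V) s l, R W s l → res L h u = res L h u') → u = u' := by
    intro V hV u u' hu
    refine sec_ext _ _ _ fun x hx => ?_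
    obtain ⟨W, hW, hxW, s, l, hR⟩ := hloc' V hV x hx
    exact ⟨W, hW, hxW, hu W hW s l hR⟩
  have hupd : ∀ {V W : Opens X} (h : W ≤ V) [DecidableEq (Fin r)] (v : Fin r → Sec E V) (i : Fin r)
      (x : Sec E V), (fun j => res E h (Function.update v i x j)) =
        Function.update (fun j => res E h (v j)) i (res E h x) := by
    intro V W h _ v i x
    funext j
    by_cases hj : j = i
    · subst hj
      simp
    · simp [hj]
  refine ⟨⟨D, hD, fun x hx => ?_, L, hL, fun V hV =>
    { toFun := d V hV
      map_update_add' := fun v i x y => hext V hV _ _ fun W h s l hR => by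
        rw [res_add, hd V hV _ W h s l hR, hd V hV _ W h s l hR, hd V hV _ W h s l hR, hupd, hupd,
          hupd, res_add, AlternatingMap.map_update_add, add_smul]
      map_update_smul' := fun v i c x => hext V hV _ _ fun W h s l hR => by
        rw [res_smul, hd V hV _ W h s l hR, hd V hV _ W h s l hR, hupd, hupd, res_smul,
          AlternatingMap.map_update_smul, smul_assoc]
      map_eq_zero_of_eq' := fun v i j hv hij => hext V hV _ _ fun W h s l hR => by
        rw [hd V hV _ W h s l hR, AlternatingMap.map_eq_zero_of_eq _ _ (by rw [hv]) hij, zero_smul]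
        exact ((resHom L h).map_zero).symm }, ?_, ?_⟩, rfl⟩
  · obtain ⟨W, hW, hxW, s, l, hR⟩ := hloc x hx
    exact ⟨W, hxW, hW, s, hfr W s l hR⟩
  · intro V W hV h v
    refine hext W (h.trans hV) _ _ fun W' h' s l hR => ?_
    refine (res_res L h' h _).trans ?_
    refine (hd V hV v W' (h'.trans h) s l hR).trans ?_
    refine Eq.trans ?_ (hd W (h.trans hV) (fun i => res E h (v i)) W' h' s l hR).symm
    simp only [res_res]
  -- For a frame `v` the local determinant is a unit, so the image is a unit times a generator.
  · intro V hV v hv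
    refine IsFrameOver.of_locally fun x hx => ?_
    obtain ⟨W, hW, hxW, s, l, hR⟩ := hloc' V hV x hx
    refine ⟨W, hW, hxW, ?_⟩
    have e : res L hW (d V hV v) = _ := hd V hV v W hW s l hR
    have hv' := IsFrameOver.res (isFrame_iff.1 hv) hW
    have hu := Module.Basis.isUnit_det (hfr W s l hR).basis hv'.basis
    rw [hv'.coe_basis] at hu
    have := (hgen W s l hR).smul_unit hu
    rw [← e] at this
    exact this

end det

/-! ### Powers of line bundles -/

section powers
variable {n : ℕ} {X : Type} [TopologicalSpace X] [ChartedSpace (Fin n → ℂ) X]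
variable {E F L M : OModule n X} {U V W : Opens X}

/-- The power `L^{⊗ (k + 1)}`. -/
def tpow (L : OModule n X) : ℕ → OModule n X
  | 0 => L
  | k + 1 => tensor (tpow L k) L

/-- The section `s^{⊗ (k + 1)}`. -/
def spow (s : Sec L V) : ∀ k : ℕ, Sec (tpow L k) V
  | 0 => s
  | k + 1 => tmul (spow s k) s

theorem res_spow (h : W ≤ V) (s : Sec L V) : ∀ k, res _ h (spow s k) = spow (res L h s) k
  | 0 => rfl
  | k + 1 => (res_tmul h _ _).trans (by rw [res_spow h s k]; rfl)

theorem spow_smul (f : Hol n V) (s : Sec L V) : ∀ k, spow (f • s) k = f ^ (k + 1) • spow s k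
  | 0 => by
    rw [zero_add, pow_one]
    rfl
  | k + 1 => by
    change tmul (spow (f • s) k) (f • s) = _
    rw [spow_smul f s k, smul_tmul, tmul_smul, smul_smul, ← pow_succ]
    rfl

theorem IsGen.spow {s : Sec L V} (hs : IsGen L s) : ∀ k, IsGen (tpow L k) (HYM.spow s k)
  | 0 => hs
  | k + 1 => (hs.spow k).tmul hs

variable [IsManifold 𝓘(ℂ, Fin n → ℂ) ∞ X] {g : KahlerMetric n X} {K K' : X → ℝ}

/-- `L` is a line bundle with a metric whose mean curvature is `K`. -/
def HasMeanCurvature (g : KahlerMetric n X) (L : OModule n X) (K : X → ℝ) : Prop :=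
  LocallyFreeOfRankOn L 1 ⊤ ∧ ∃ h : HermitianMetric L ⊤,
    ∀ (x : X) (T : LocalFrame L ⊤ x), (T.meanCurvature g h).trace = (K x : ℂ)

open Matrix in
-- For line bundles both identity factors have size one, so the trace of `K ⊗ 1 + 1 ⊗ K'` is the
-- sum.
theorem HasMeanCurvature.tensor (hL : HasMeanCurvature g L K) (hM : HasMeanCurvature g M K') :
    HasMeanCurvature g (HYM.tensor L M) (K + K') := by
  obtain ⟨fL, h, hK⟩ := hL
  obtain ⟨fM, h', hK'⟩ := hM
  refine ⟨fun x hx => ?_, tensorMetric h h' fL.locallyFreeOn fM.locallyFreeOn, fun x T => ?_⟩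
  · obtain ⟨V, hxV, -, s, hs⟩ := fL x hx
    obtain ⟨W, hxW, -, t, ht⟩ := fM x hx
    exact ⟨V ⊓ W, ⟨hxV, hxW⟩, le_top, _, isFrame_reindex (isFrameOver_tensor
      (IsFrameOver.res hs inf_le_left) (IsFrameOver.res ht inf_le_right)) finProdFinEquiv.symm⟩
  · obtain ⟨V, hxV, -, s, hs⟩ := fL x trivial
    obtain ⟨W, hxW, -, t, ht⟩ := fM x trivial
    have hx : x ∈ V ⊓ W ⊓ T.chart.dom := ⟨⟨hxV, hxW⟩, T.mem_source⟩
    have hs' := IsFrameOver.res hs (inf_le_left.trans inf_le_left : V ⊓ W ⊓ T.chart.dom ≤ V)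
    have ht' := IsFrameOver.res ht (inf_le_left.trans inf_le_right : V ⊓ W ⊓ T.chart.dom ≤ W)
    let T₁ : LocalFrame L ⊤ x := ⟨T.chart, _, hx, le_top, inf_le_right, 1, _, hs'⟩
    let T₂ : LocalFrame M ⊤ x := ⟨T.chart, _, hx, le_top, inf_le_right, 1, _, ht'⟩
    rw [trace_mean_eq _ le_top T g (isFrameOver_tensor hs' ht') T.chart hx T.mem_source,
      meanAt_tensorMetric h h' _ _ le_top g hs' ht' T.chart hx T.mem_source, trace_add,
      trace_kronecker, trace_kronecker, ← trace_mean_eq h le_top T₁ g hs' T.chart hx T.mem_source,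
      ← trace_mean_eq h' le_top T₂ g ht' T.chart hx T.mem_source, hK, hK']
    simp

theorem HasMeanCurvature.tpow (hL : HasMeanCurvature g L K) :
    ∀ k : ℕ, HasMeanCurvature g (HYM.tpow L k) (fun x => (k + 1) * K x)
  | 0 => by
    have e : K = fun x => (((0 : ℕ) : ℝ) + 1) * K x := by
      funext x
      simp
    exact e ▸ hL
  | k + 1 => by
    have e : (fun x => ((k : ℝ) + 1) * K x) + K = fun x => (((k + 1 : ℕ) : ℝ) + 1) * K x := by
      funext x
      simp only [Pi.add_apply]
      push_cast
      ring
    exact e ▸ (hL.tpow k).tensor hL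

end powers

/-! ### Degrees and slopes of tensor products and sums -/

section degree
open Matrix MeasureTheory Limits
open scoped Kronecker
variable {n : ℕ} {X : Type} [TopologicalSpace X] [ChartedSpace (Fin n → ℂ) X]
variable {E F : OModule n X} {U V W : Opens X} {r₁ r₂ : ℕ}

/-- The transition matrix is a Kronecker product, whose determinant is `(det A)^{r₂} (det B)^{r₁}`;
these exponents dictate the powers of the determinant bundles. -/
theorem det_reindex_tensor {s s' : Fin r₁ → Sec E V} {t t' : Fin r₂ → Sec F V}
    (hs : IsFrameOver E s) (ht : IsFrameOver F t) :
    ((isFrameOver_tensor hs ht).reindex finProdFinEquiv.symm).basis.det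
      (tensorFrame s' t' ∘ finProdFinEquiv.symm) =
      hs.basis.det s' ^ r₂ * ht.basis.det t' ^ r₁ := by
  have e : ((isFrameOver_tensor hs ht).reindex finProdFinEquiv.symm).basis.toMatrix
      (tensorFrame s' t' ∘ finProdFinEquiv.symm) =
      (hs.basis.toMatrix s' ⊗ₖ ht.basis.toMatrix t').submatrix finProdFinEquiv.symm
        finProdFinEquiv.symm := by
    ext i j
    rw [Module.Basis.toMatrix_apply, IsFrameOver.repr_reindex]
    exact repr_tmul hs ht _ _ _
  rw [Module.Basis.det_apply, e, det_submatrix_equiv_self, det_kronecker, Fintype.card_fin,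
    Fintype.card_fin]
  rfl

theorem det_reindex_sum {s s' : Fin r₁ → Sec E V} {t t' : Fin r₂ → Sec F V}
    (hs : IsFrameOver E s) (ht : IsFrameOver F t) :
    ((isFrameOver_biprod hs ht).reindex finSumFinEquiv.symm).basis.det
      (sumFrame s' t' ∘ finSumFinEquiv.symm) = hs.basis.det s' * ht.basis.det t' := by
  have e : ((isFrameOver_biprod hs ht).reindex finSumFinEquiv.symm).basis.toMatrix
      (sumFrame s' t' ∘ finSumFinEquiv.symm) =
      (fromBlocks (hs.basis.toMatrix s') 0 0 (ht.basis.toMatrix t')).submatrix finSumFinEquiv.symm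
        finSumFinEquiv.symm := by
    ext i j
    rw [Module.Basis.toMatrix_apply, IsFrameOver.repr_reindex, submatrix_apply, Function.comp_apply]
    generalize finSumFinEquiv.symm i = p
    generalize finSumFinEquiv.symm j = q
    rcases q with q | q
    · have := repr_sum hs ht (s' q) 0 p
      rw [map_zero, add_zero] at this
      refine this.trans ?_
      rcases p with p | p
      · rfl
      · simp
    · have := repr_sum hs ht 0 (t' q) p
      rw [map_zero, zero_add] at this
      refine this.trans ?_
      rcases p with p | p
      · simp
      · rfl
  rw [Module.Basis.det_apply, e, det_submatrix_equiv_self, det_fromBlocks_zero₂₁]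
  rfl

theorem DetBundle.exists_frames (D₁ : DetBundle E r₁) (D₂ : DetBundle F r₂) {x : X}
    (hx : x ∈ D₁.dom ⊓ D₂.dom) : ∃ W ≤ D₁.dom ⊓ D₂.dom, x ∈ W ∧ ∃ (s : Fin r₁ → Sec E W)
      (t : Fin r₂ → Sec F W), IsFrameOver E s ∧ IsFrameOver F t := by
  obtain ⟨V, hxV, -, s, hs⟩ := D₁.locallyFree x hx.1
  obtain ⟨W, hxW, -, t, ht⟩ := D₂.locallyFree x hx.2
  exact ⟨V ⊓ W ⊓ (D₁.dom ⊓ D₂.dom), inf_le_right, ⟨⟨hxV, hxW⟩, hx⟩, _, _,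
    IsFrameOver.res hs (inf_le_left.trans inf_le_left),
    IsFrameOver.res ht (inf_le_left.trans inf_le_right)⟩

theorem DetBundle.det_eq_smul (D : DetBundle E r₁) (hV : V ≤ D.dom) {s : Fin r₁ → Sec E V}
    (hs : IsFrameOver E s) (s' : Fin r₁ → Sec E V) :
    D.det V hV s' = hs.basis.det s' • D.det V hV s := by
  rw [alternatingMap_eq_det_smul hs.basis (D.det V hV) s', hs.coe_basis]

/-- Distinguished frames are the product frames, with generator `(det s)^{r₂ + 1} ⊗ (det t)^{r₁ +
1}`. Ranks are written as successors because `tpow L k` is the power of exponent `k + 1`, which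
avoids the trivial zeroth power. -/
theorem exists_detBundle_tensor (D₁ : DetBundle E (r₁ + 1)) (D₂ : DetBundle F (r₂ + 1))
    (hL : LocallyFreeOfRankOn (tensor (tpow D₁.bundle r₂) (tpow D₂.bundle r₁)) 1 ⊤) :
    ∃ B : DetBundle (tensor E F) ((r₁ + 1) * (r₂ + 1)),
      B.bundle = tensor (tpow D₁.bundle r₂) (tpow D₂.bundle r₁) := by
  refine exists_detBundle (D := D₁.dom ⊓ D₂.dom)
    (fun W σ l => ∃ (hW : W ≤ D₁.dom ⊓ D₂.dom) (s : Fin (r₁ + 1) → Sec E W)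
      (t : Fin (r₂ + 1) → Sec F W), IsFrameOver E s ∧ IsFrameOver F t ∧
      σ = tensorFrame s t ∘ finProdFinEquiv.symm ∧
      l = tmul (spow (D₁.det W (hW.trans inf_le_left) s) r₂)
        (spow (D₂.det W (hW.trans inf_le_right) t) r₁))
    hL (D₁.isBigOpen.inf D₂.isBigOpen) ?_ ?_ ?_ ?_ ?_
  · rintro W σ l ⟨hW, s, t, hs, ht, rfl, rfl⟩
    exact (isFrameOver_tensor hs ht).reindex _
  · rintro W σ l ⟨hW, s, t, hs, ht, rfl, rfl⟩
    exact (IsGen.spow (D₁.det_frame W _ s hs) _).tmul (IsGen.spow (D₂.det_frame W _ t ht) _)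
  · rintro V W h σ l ⟨hV, s, t, hs, ht, rfl, rfl⟩
    refine ⟨h.trans hV, _, _, hs.res h, ht.res h, ?_, ?_⟩
    · funext i
      exact res_tmul h _ _
    · rw [res_tmul, res_spow, res_spow, D₁.res_det, D₂.res_det]
  · rintro W σ l σ' l' hσ ⟨hW, s, t, hs, ht, rfl, rfl⟩ ⟨_, s', t', hs', ht', rfl, rfl⟩
    refine Eq.trans ?_ (congrArg (· • _) (det_reindex_tensor hs ht).symm)
    rw [D₁.det_eq_smul _ hs s', D₂.det_eq_smul _ ht t', spow_smul, spow_smul, smul_tmul, tmul_smul,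
      smul_smul]
  · intro x hx
    obtain ⟨W, hW, hxW, s, t, hs, ht⟩ := D₁.exists_frames D₂ hx
    exact ⟨W, hW, hxW, _, _, hW, s, t, hs, ht, rfl, rfl⟩

/-- The transition matrix of combined frames is block diagonal, so its determinant is the product
and the generators `det s ⊗ det t` are compatible. -/
theorem exists_detBundle_sum (D₁ : DetBundle E r₁) (D₂ : DetBundle F r₂)
    (hL : LocallyFreeOfRankOn (tensor D₁.bundle D₂.bundle) 1 ⊤) :
    ∃ B : DetBundle (E ⊞ F) (r₁ + r₂), B.bundle = tensor D₁.bundle D₂.bundle := by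
  refine exists_detBundle (D := D₁.dom ⊓ D₂.dom)
    (fun W σ l => ∃ (hW : W ≤ D₁.dom ⊓ D₂.dom) (s : Fin r₁ → Sec E W)
      (t : Fin r₂ → Sec F W), IsFrameOver E s ∧ IsFrameOver F t ∧
      σ = sumFrame s t ∘ finSumFinEquiv.symm ∧
      l = tmul (D₁.det W (hW.trans inf_le_left) s) (D₂.det W (hW.trans inf_le_right) t))
    hL (D₁.isBigOpen.inf D₂.isBigOpen) ?_ ?_ ?_ ?_ ?_
  · rintro W σ l ⟨hW, s, t, hs, ht, rfl, rfl⟩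
    exact (isFrameOver_biprod hs ht).reindex _
  · rintro W σ l ⟨hW, s, t, hs, ht, rfl, rfl⟩
    exact IsGen.tmul (D₁.det_frame W _ s hs) (D₂.det_frame W _ t ht)
  · rintro V W h σ l ⟨hV, s, t, hs, ht, rfl, rfl⟩
    refine ⟨h.trans hV, _, _, hs.res h, ht.res h, ?_, ?_⟩
    · funext i
      simp only [Function.comp_apply]
      rcases finSumFinEquiv.symm i with p | p
      · exact onSec_res _ h _
      · exact onSec_res _ h _
    · rw [res_tmul, D₁.res_det, D₂.res_det]
  · rintro W σ l σ' l' hσ ⟨hW, s, t, hs, ht, rfl, rfl⟩ ⟨_, s', t', hs', ht', rfl, rfl⟩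
    refine Eq.trans ?_ (congrArg (· • _) (det_reindex_sum hs ht).symm)
    rw [D₁.det_eq_smul _ hs s', D₂.det_eq_smul _ ht t', smul_tmul, tmul_smul, smul_smul]
  · intro x hx
    obtain ⟨W, hW, hxW, s, t, hs, ht⟩ := D₁.exists_frames D₂ hx
    exact ⟨W, hW, hxW, _, _, hW, s, t, hs, ht, rfl, rfl⟩

variable [IsManifold 𝓘(ℂ, Fin n → ℂ) ∞ X] [MeasurableSpace X] [T2Space X] [CompactSpace X]
  {g : KahlerMetric n X} {d₁ d₂ μ₁ μ₂ : ℝ}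

theorem DetBundle.hasRankDegree {r : ℕ} {L : OModule n X} {K : X → ℝ}
    (hB : ∃ B : DetBundle E r, B.bundle = L) (hK : HasMeanCurvature g L K)
    (hi : Integrable K g.vol) :
    HasRankDegree g E r ((n - 1).factorial / (2 * Real.pi) * ∫ x, K x ∂g.vol) := by
  obtain ⟨B, rfl⟩ := hB
  obtain ⟨-, h, hh⟩ := hK
  exact ⟨B, h, K, hh, hi, rfl⟩

/-- The metric on the determinant bundle has mean curvature `(r₂ + 1) K₁ + (r₁ + 1) K₂`, which is
then integrated. -/
theorem HasRankDegree.tensor (h₁ : HasRankDegree g E (r₁ + 1) d₁)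
    (h₂ : HasRankDegree g F (r₂ + 1) d₂) :
    HasRankDegree g (tensor E F) ((r₁ + 1) * (r₂ + 1)) ((r₂ + 1) * d₁ + (r₁ + 1) * d₂) := by
  obtain ⟨D₁, m₁, K₁, hK₁, i₁, rfl⟩ := h₁
  obtain ⟨D₂, m₂, K₂, hK₂, i₂, rfl⟩ := h₂
  have k := (HasMeanCurvature.tpow ⟨D₁.isLineBundle, m₁, hK₁⟩ r₂).tensor
    (HasMeanCurvature.tpow ⟨D₂.isLineBundle, m₂, hK₂⟩ r₁)
  have := DetBundle.hasRankDegree (exists_detBundle_tensor D₁ D₂ k.1) k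
    ((i₁.const_mul _).add (i₂.const_mul _))
  simp only [Pi.add_apply] at this
  rw [integral_add (i₁.const_mul _) (i₂.const_mul _), integral_const_mul,
    integral_const_mul] at this
  convert this using 1
  ring

theorem HasRankDegree.sum (h₁ : HasRankDegree g E r₁ d₁) (h₂ : HasRankDegree g F r₂ d₂) :
    HasRankDegree g (E ⊞ F) (r₁ + r₂) (d₁ + d₂) := by
  obtain ⟨D₁, m₁, K₁, hK₁, i₁, rfl⟩ := h₁
  obtain ⟨D₂, m₂, K₂, hK₂, i₂, rfl⟩ := h₂
  have k := HasMeanCurvature.tensor ⟨D₁.isLineBundle, m₁, hK₁⟩ ⟨D₂.isLineBundle, m₂, hK₂⟩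
  have := DetBundle.hasRankDegree (exists_detBundle_sum D₁ D₂ k.1) k (i₁.add i₂)
  simp only [Pi.add_apply] at this
  rw [integral_add i₁ i₂] at this
  convert this using 1
  ring

theorem HasSlope.tensor (h₁ : HasSlope g E μ₁) (h₂ : HasSlope g F μ₂) :
    HasSlope g (tensor E F) (μ₁ + μ₂) := by
  obtain ⟨r₁, d₁, p₁, k₁, rfl⟩ := h₁
  obtain ⟨r₂, d₂, p₂, k₂, rfl⟩ := h₂
  obtain ⟨r₁, rfl⟩ := Nat.exists_eq_succ_of_ne_zero p₁.ne'
  obtain ⟨r₂, rfl⟩ := Nat.exists_eq_succ_of_ne_zero p₂.ne'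
  refine ⟨_, _, by positivity, k₁.tensor k₂, ?_⟩
  push_cast
  field_simp

theorem HasSlope.sum (h₁ : HasSlope g E μ₁) (h₂ : HasSlope g F μ₁) : HasSlope g (E ⊞ F) μ₁ := by
  obtain ⟨r₁, d₁, p₁, k₁, e₁⟩ := h₁
  obtain ⟨r₂, d₂, p₂, k₂, e₂⟩ := h₂
  refine ⟨_, _, by positivity, k₁.sum k₂, ?_⟩
  have q₁ : (0 : ℝ) < r₁ := by exact_mod_cast p₁
  have q₂ : (0 : ℝ) < r₂ := by exact_mod_cast p₂
  rw [eq_div_iff q₁.ne'] at e₁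
  rw [eq_div_iff q₂.ne'] at e₂
  rw [eq_div_iff (by positivity), ← e₁, ← e₂]
  push_cast
  ring

end degree

end HYM
end

theorem mainTheorem7 {n : ℕ} (hn : 0 < n) {X : Type} [TopologicalSpace X] [T2Space X]
    [CompactSpace X] [ConnectedSpace X] [MeasurableSpace X] [BorelSpace X]
    [ChartedSpace (Fin n → ℂ) X] [IsManifold 𝓘(ℂ, Fin n → ℂ) ∞ X]
    (g : HYM.KahlerMetric n X) (E₁ E₂ : HYM.HiggsModule n X)
    (hcoh₁ : HYM.IsCoherent E₁.sheaf) (hcoh₂ : HYM.IsCoherent E₂.sheaf)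
    (htf₁ : HYM.IsTorsionFree E₁.sheaf) (htf₂ : HYM.IsTorsionFree E₂.sheaf)
    (μ₁ μ₂ : ℝ) (hμ₁ : HYM.HasSlope g E₁.sheaf μ₁) (hμ₂ : HYM.HasSlope g E₂.sheaf μ₂)
    (h₁ : HYM.HasApproxHYM g E₁ μ₁) (h₂ : HYM.HasApproxHYM g E₂ μ₂) :
    (∃ μ, HYM.HasSlope g (E₁.tensorProduct E₂).sheaf μ ∧
      HYM.HasApproxHYM g (E₁.tensorProduct E₂) μ) ∧
    (μ₁ = μ₂ → ∃ μ, HYM.HasSlope g (E₁.directSum E₂).sheaf μ ∧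
      HYM.HasApproxHYM g (E₁.directSum E₂) μ) := by
  refine ⟨⟨μ₁ + μ₂, hμ₁.tensor hμ₂, ?_⟩, fun h => ?_⟩
  -- The determinant bundles behind the slopes supply open sets with small complement on which the
  -- ranks are constant.
  · obtain ⟨r₁, d₁, -, ⟨D₁, -⟩, -⟩ := hμ₁
    obtain ⟨r₂, d₂, -, ⟨D₂, -⟩, -⟩ := hμ₂
    exact h₁.tensorProduct D₁.isBigOpen D₂.isBigOpen D₁.locallyFree D₂.locallyFree h₂
  · subst h
    exact ⟨μ₁, hμ₁.sum hμ₂, h₁.directSum h₂⟩
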